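/- Let $M$ be a finite-dimensional smooth manifold (Hausdorff, second countable), let $\pi\colon Y\to M$ be a smooth map from a smooth manifold $Y$ (possibly infinite-dimensional, modelled on a normed space) that admits smooth local sections near every point of $M$, and put $Y^{[2]}=\{(y_1,y_2): \pi(y_1)=\pi(y_2)\}$. Let $(L,Y)$ be a bundle gerbe over $M$: a smooth hermitian line bundle $L\to Y^{[2]}$ with a smooth, associative, hermitian product $L_{(y_1,y_2)}\otimes L_{(y_2,y_3)}\xrightarrow{\sim}L_{(y_1,y_3)}$. (A function on a fibre product $Y^{[p]}\subset Y^p$ is smooth if it is locally the restriction of a smooth function on an open subset of $Y^p$.) A bundle gerbe module is a smooth hermitian vector bundle $E\to Y$ of finite positive (locally constant) rank with a smooth hermitian isomorphism $L_{(y_1,y_2)}\otimes E_{y_2}\xrightarrow{\sim}E_{y_1}$ compatible with the product of $L$. Let $\mathrm{Mod}(L)$ be the set of isomorphism classes of bundle gerbe modules, and let $\mathrm{Mod}(L)/\mathrm{Lin}(M)$ be its quotient by $E\mapsto \pi^{-1}(K)\otimes E$ for hermitian line bundles $K\to M$. A projective bundle on $M$ is a smooth bundle with fibres $P(\mathbb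 C^r)$, $r\ge 1$ finite and locally constant, and structure group $PU(r)$. Dixmier–Douady classes in the Čech group $H^3(M,\mathbb Z)$ are defined as follows. For the gerbe, choose an open cover $\{U_i\}$ of $M$, smooth sections $s_i$ of $\pi$ over $U_i$ and smooth unit sections $\sigma_{ij}$ of $(s_i,s_j)^{-1}L$ over $U_i\cap U_j$, and write $\sigma_{ij}\sigma_{jk}=g_{ijk}\sigma_{ik}$. For a projective bundle, choose local trivialisations over the $U_i$ and smooth lifts $u_{ij}$ of their transition functions to unitary matrices, and write $u_{ij}u_{jk}=g_{ijk}u_{ik}$. In both cases, with the choices made so that $g_{ijk}=e^{2\pi i h_{ijk}}$ for smooth real $h_{ijk}$, the class is that of the integer cocycle $\delta h$. Then the Dixmier–Douady class $d(L)\in H^3(M,\mathbb Z)$ is well defined and, if $\mathrm{Pro}(M,d(L))$ denotes the set of isomorphism classes of projective bundles on $M$ with Dixmier–Douady class $d(L)$, there is a bijection $$\mathrm{Mod}(L)/\mathrm{Lin}(M)\longrightarrow \mathrm{Pro}(M,d(L))$$ which sends the class of $E$ to the class of the projective bundle on $M$ to which the projectivisation $P(E)\to Y$ descends: a projective bundle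 $\mathcal P\to M$ represents the image of $E$ if and only if there is an isomorphism $P(E)\cong\pi^{-1}(\mathcal P)$ of projective bundles on $Y$ under which the identifications $P(E_{y_2})\to P(E_{y_1})$, $[e]\mapsto[a\cdot e]$, for $0\ne a\in L_{(y_1,y_2)}$, correspond to the identity of $\mathcal P_{\pi(y_1)}=\mathcal P_{\pi(y_2)}$. -/

import Mathlib

open Set Filter Topology
open scoped Manifold ContDiff TensorProduct LinearAlgebra.Projectivization InnerProductSpace

/-! ### Smooth functions on subspaces of manifolds -/

section Smooth

variable {E : Type*} [NormedAddCommGroup E] [NormedSpace ℝ E] {H : Type*} [TopologicalSpace H]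
  (I : ModelWithCorners ℝ E H) {N : Type*} [TopologicalSpace N] [ChartedSpace H N]
  {B : Type*} [TopologicalSpace B] (inc : B → N)

/-- Let `B` be a space mapped into a manifold `N` by `inc` (in practice `N` itself, with `inc = id`,
or a subset of `N` with the subspace topology).  A function `f : B → ℂ` is *smooth near `b`* if, on
a neighbourhood of `b`, it is the restriction of a smooth function defined on an open subset of
`N`. -/
def SmoothNear (f : B → ℂ) (b : B) : Prop :=
  ∃ (V : Set N) (g : N → ℂ), IsOpen V ∧ inc b ∈ V ∧ ContMDiffOn I 𝓘(ℝ, ℂ) ∞ g V ∧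
    f =ᶠ[𝓝 b] fun b' => g (inc b')

variable {I inc}

theorem SmoothNear.congr {f f' : B → ℂ} {b : B} (h : SmoothNear I inc f b) (e : f' =ᶠ[𝓝 b] f) :
    SmoothNear I inc f' b := by
  obtain ⟨V, g, hV, hb, hg, hf⟩ := h
  exact ⟨V, g, hV, hb, hg, e.trans hf⟩

theorem SmoothNear.zero (b : B) : SmoothNear I inc (fun _ => 0) b :=
  ⟨univ, fun _ => 0, isOpen_univ, mem_univ _, contMDiffOn_const, EventuallyEq.rfl⟩

theorem SmoothNear.add {f f' : B → ℂ} {b : B} (h : SmoothNear I inc f b)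
    (h' : SmoothNear I inc f' b) : SmoothNear I inc (fun x => f x + f' x) b := by
  obtain ⟨V, g, hV, hb, hg, hf⟩ := h
  obtain ⟨V', g', hV', hb', hg', hf'⟩ := h'
  refine ⟨V ∩ V', fun x => g x + g' x, hV.inter hV', ⟨hb, hb'⟩,
    (hg.mono inter_subset_left).add (hg'.mono inter_subset_right), ?_⟩
  filter_upwards [hf, hf'] with x h1 h2
  rw [h1, h2]

theorem SmoothNear.mul {f f' : B → ℂ} {b : B} (h : SmoothNear I inc f b)
    (h' : SmoothNear I inc f' b) : SmoothNear I inc (fun x => f x * f' x) b := by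
  obtain ⟨V, g, hV, hb, hg, hf⟩ := h
  obtain ⟨V', g', hV', hb', hg', hf'⟩ := h'
  refine ⟨V ∩ V', fun x => g x * g' x, hV.inter hV', ⟨hb, hb'⟩, ?_, ?_⟩
  · have hm : ContDiff ℝ ∞ (fun p : ℂ × ℂ => p.1 * p.2) := contDiff_fst.mul contDiff_snd
    exact hm.contMDiff.comp_contMDiffOn
      ((hg.mono inter_subset_left).prodMk_space (hg'.mono inter_subset_right))
  · filter_upwards [hf, hf'] with x h1 h2
    rw [h1, h2]

theorem SmoothNear.conj {f : B → ℂ} {b : B} (h : SmoothNear I inc f b) :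
    SmoothNear I inc (fun x => starRingEnd ℂ (f x)) b := by
  obtain ⟨V, g, hV, hb, hg, hf⟩ := h
  refine ⟨V, fun x => starRingEnd ℂ (g x), hV, hb, ?_, ?_⟩
  · exact (Complex.conjCLE.contDiff.contMDiff).comp_contMDiffOn hg
  · filter_upwards [hf] with x h1
    rw [h1]

theorem SmoothNear.sum {κ : Type*} (s : Finset κ) {f : κ → B → ℂ} {b : B}
    (h : ∀ k ∈ s, SmoothNear I inc (f k) b) : SmoothNear I inc (fun x => ∑ k ∈ s, f k x) b := by
  classical
  induction s using Finset.induction_on with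
  | empty => simpa using SmoothNear.zero b
  | insert k s hk ih =>
    refine ((h k (Finset.mem_insert_self k s)).add
      (ih fun j hj => h j (Finset.mem_insert_of_mem hj))).congr (Eventually.of_forall fun x => ?_)
    simp [Finset.sum_insert hk]

end Smooth

/-! ### Hermitian vector bundles -/

section Hermitian

variable {E : Type*} [NormedAddCommGroup E] [NormedSpace ℝ E] {H : Type*} [TopologicalSpace H]
  {N : Type*} [TopologicalSpace N] [ChartedSpace H N] {B : Type*} [TopologicalSpace B]

/-- A smooth hermitian vector bundle of finite rank (locally constant, hence constant on connected
components) over `B`, presented by its fibres and by a unitary frame `frame a` over an open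
neighbourhood `dom a` of every point `a`; the transition functions between these frames are smooth.
The values of `frame a` outside `dom a` carry no information. -/
structure HermitianBundle (I : ModelWithCorners ℝ E H) (inc : B → N) where
  Fiber : B → Type
  [normedAddCommGroup : ∀ b, NormedAddCommGroup (Fiber b)]
  [innerProductSpace : ∀ b, InnerProductSpace ℂ (Fiber b)]
  rank : B → ℕ
  dom : B → Set B
  isOpen_dom : ∀ a, IsOpen (dom a)
  mem_dom : ∀ a, a ∈ dom a
  frame : ∀ a : B, Fin (rank a) → ∀ b, Fiber b
  orthonormal_frame : ∀ a, ∀ b ∈ dom a, Orthonormal ℂ (fun i => frame a i b)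
  span_frame : ∀ a, ∀ b ∈ dom a, Submodule.span ℂ (range fun i => frame a i b) = ⊤
  smooth_frame : ∀ a a', ∀ b ∈ dom a ∩ dom a', ∀ i j,
    SmoothNear I inc (fun b' => ⟪frame a i b', frame a' j b'⟫_ℂ) b

attribute [instance] HermitianBundle.normedAddCommGroup HermitianBundle.innerProductSpace

namespace HermitianBundle

variable {I : ModelWithCorners ℝ E H} {inc : B → N}

/-- A section `σ` of the pullback of `V` along a map `f : B' → B` is smooth near `b` if its
coordinates in the frame of `V` around `f b` are. -/
def SmoothSectionNear (V : HermitianBundle I inc)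
    {E' : Type*} [NormedAddCommGroup E'] [NormedSpace ℝ E'] {H' : Type*} [TopologicalSpace H']
    (I' : ModelWithCorners ℝ E' H') {N' : Type*} [TopologicalSpace N'] [ChartedSpace H' N']
    {B' : Type*} [TopologicalSpace B'] (inc' : B' → N')
    (f : B' → B) (σ : ∀ b, V.Fiber (f b)) (b : B') : Prop :=
  ∀ i, SmoothNear I' inc' (fun b' => ⟪V.frame (f b) i (f b'), σ b'⟫_ℂ) b

/-- A fibrewise isometric isomorphism `V → W` is smooth if it maps the frames of `V` to smooth
sections of `W`. -/
def IsSmoothIso (V W : HermitianBundle I inc) (θ : ∀ b, V.Fiber b ≃ₗᵢ[ℂ] W.Fiber b) : Prop :=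
  ∀ b i, W.SmoothSectionNear I inc id (fun b' => θ b' (V.frame b i b')) b

/-- Expansion of an inner product in a local frame. -/
theorem inner_eq_sum (V : HermitianBundle I inc) {a b : B} (hb : b ∈ V.dom a) (v w : V.Fiber b) :
    ⟪v, w⟫_ℂ = ∑ i, ⟪v, V.frame a i b⟫_ℂ * ⟪V.frame a i b, w⟫_ℂ := by
  have h := (OrthonormalBasis.mk (V.orthonormal_frame a b hb)
    (V.span_frame a b hb).ge).sum_inner_mul_inner v w
  simpa using h.symm

theorem isSmoothIso_refl (V : HermitianBundle I inc) :
    V.IsSmoothIso V (fun b => LinearIsometryEquiv.refl ℂ (V.Fiber b)) :=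
  fun b i j => V.smooth_frame b b b ⟨V.mem_dom b, V.mem_dom b⟩ j i

theorem IsSmoothIso.symm {V W : HermitianBundle I inc} {θ : ∀ b, V.Fiber b ≃ₗᵢ[ℂ] W.Fiber b}
    (h : V.IsSmoothIso W θ) : W.IsSmoothIso V (fun b => (θ b).symm) := by
  intro b i j
  refine (h b j i).conj.congr (Eventually.of_forall fun x => ?_)
  simp only [id]
  rw [inner_conj_symm, ← (θ x).inner_map_map, LinearIsometryEquiv.apply_symm_apply]

theorem IsSmoothIso.trans {V W X : HermitianBundle I inc} {θ : ∀ b, V.Fiber b ≃ₗᵢ[ℂ] W.Fiber b}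
    {η : ∀ b, W.Fiber b ≃ₗᵢ[ℂ] X.Fiber b} (h : V.IsSmoothIso W θ) (h' : W.IsSmoothIso X η) :
    V.IsSmoothIso X (fun b => (θ b).trans (η b)) := by
  intro b i j
  refine (SmoothNear.sum Finset.univ fun k _ => (h' b k j).mul (h b i k)).congr ?_
  filter_upwards [(W.isOpen_dom b).mem_nhds (W.mem_dom b)] with x hx
  have key : ∀ (w : X.Fiber x) (v : W.Fiber x), ⟪w, η x v⟫_ℂ = ⟪(η x).symm w, v⟫_ℂ := by
    intro w v
    rw [← (η x).inner_map_map, LinearIsometryEquiv.apply_symm_apply]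
  simp only [id, LinearIsometryEquiv.trans_apply, key]
  exact W.inner_eq_sum hx _ _

/-- The unitary isomorphism `ℂ^r ≃ V_b` given by the frame around `a`, for `b ∈ dom a`. -/
noncomputable def frameIso (V : HermitianBundle I inc) {a b : B} (hb : b ∈ V.dom a) :
    EuclideanSpace ℂ (Fin (V.rank a)) ≃ₗᵢ[ℂ] V.Fiber b :=
  (OrthonormalBasis.mk (V.orthonormal_frame a b hb) (V.span_frame a b hb).ge).repr.symm

/-- A hermitian line bundle. -/
def IsLine (V : HermitianBundle I inc) : Prop := ∀ b, V.rank b = 1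

end HermitianBundle

end Hermitian

/-! ### Projective bundles -/

section Projective

/-- The map of projective spaces induced by a unitary isomorphism. -/
noncomputable def projMap {V W : Type*} [NormedAddCommGroup V] [InnerProductSpace ℂ V] [NormedAddCommGroup W]
    [InnerProductSpace ℂ W] (u : V ≃ₗᵢ[ℂ] W) : ℙ ℂ V → ℙ ℂ W :=
  Projectivization.map u.toLinearEquiv.toLinearMap u.injective

theorem projMap_refl {V : Type*} [NormedAddCommGroup V] [InnerProductSpace ℂ V] (p : ℙ ℂ V) :
    projMap (LinearIsometryEquiv.refl ℂ V) p = p := by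
  induction p using Projectivization.ind with
  | h v hv => simp [projMap, Projectivization.map_mk]

theorem projMap_trans {V W X : Type*} [NormedAddCommGroup V] [InnerProductSpace ℂ V]
    [NormedAddCommGroup W] [InnerProductSpace ℂ W] [NormedAddCommGroup X] [InnerProductSpace ℂ X]
    (u : V ≃ₗᵢ[ℂ] W) (u' : W ≃ₗᵢ[ℂ] X) (p : ℙ ℂ V) :
    projMap (u.trans u') p = projMap u' (projMap u p) := by
  induction p using Projectivization.ind with
  | h v hv => simp [projMap, Projectivization.map_mk]

variable {E : Type*} [NormedAddCommGroup E] [NormedSpace ℝ E] {H : Type*} [TopologicalSpace H]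
  (I : ModelWithCorners ℝ E H) {M : Type*} [TopologicalSpace M] [ChartedSpace H M]

/-- A family of linear maps `ℂ^m → ℂ^n` whose matrix entries are smooth near `x`. -/
def SmoothMatrixNear {B N : Type*} [TopologicalSpace B] [TopologicalSpace N] [ChartedSpace H N]
    (inc : B → N) {m n : ℕ}
    (u : B → EuclideanSpace ℂ (Fin m) → EuclideanSpace ℂ (Fin n)) (b : B) : Prop :=
  ∀ i j, SmoothNear I inc (fun b' => u b' (EuclideanSpace.single i 1) j) b

/-- Let `F`, `G` be families of sets over `M`, parametrised by projective spaces through `α` and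
`β`.  Then `θ : F → G` is *projectively unitary near `x`* if, in these parametrisations, it is given
near `x` by a smooth function with values in the projective unitary group, i.e. by the class of a
smooth function with values in the unitary group.  (Smooth functions to `PU(n) = U(n)/U(1)` are
those that lift locally to smooth functions to `U(n)`.) -/
def ProjUnitaryNear {m n : ℕ} {F G : M → Type}
    (α : ∀ x, ℙ ℂ (EuclideanSpace ℂ (Fin m)) → F x) (β : ∀ x, ℙ ℂ (EuclideanSpace ℂ (Fin n)) → G x)
    (θ : ∀ x, F x → G x) (x : M) : Prop :=
  ∃ u : M → (EuclideanSpace ℂ (Fin m) ≃ₗᵢ[ℂ] EuclideanSpace ℂ (Fin n)),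
    SmoothMatrixNear I id (fun y => u y) x ∧ ∀ᶠ y in 𝓝 x, ∀ p, θ y (α y p) = β y (projMap (u y) p)

variable {I}

theorem ProjUnitaryNear.trans {m n k : ℕ} {F G K : M → Type}
    {α : ∀ x, ℙ ℂ (EuclideanSpace ℂ (Fin m)) → F x} {β : ∀ x, ℙ ℂ (EuclideanSpace ℂ (Fin n)) → G x}
    {γ : ∀ x, ℙ ℂ (EuclideanSpace ℂ (Fin k)) → K x} {θ : ∀ x, F x → G x} {η : ∀ x, G x → K x}
    {x : M} (h : ProjUnitaryNear I α β θ x) (h' : ProjUnitaryNear I β γ η x) :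
    ProjUnitaryNear I α γ (fun y p => η y (θ y p)) x := by
  obtain ⟨u, hu, hθ⟩ := h
  obtain ⟨u', hu', hη⟩ := h'
  refine ⟨fun y => (u y).trans (u' y), fun i j => ?_, ?_⟩
  · refine (SmoothNear.sum Finset.univ fun l _ => (hu i l).mul (hu' l j)).congr
      (Eventually.of_forall fun y => ?_)
    have h1 : u y (EuclideanSpace.single i 1) = ∑ l, (u y (EuclideanSpace.single i 1) l) •
        EuclideanSpace.single l (1 : ℂ) := by
      ext l
      simp [Finset.sum_apply, Pi.single_apply]
    simp only [LinearIsometryEquiv.trans_apply]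
    conv_lhs => rw [h1]
    simp
  · filter_upwards [hθ, hη] with y h1 h2 p
    rw [h1, h2, projMap_trans]

theorem ProjUnitaryNear.symm {m n : ℕ} {F G : M → Type}
    {α : ∀ x, ℙ ℂ (EuclideanSpace ℂ (Fin m)) → F x} {β : ∀ x, ℙ ℂ (EuclideanSpace ℂ (Fin n)) → G x}
    {θ : ∀ x, F x ≃ G x} {x : M} (h : ProjUnitaryNear I α β (fun y => θ y) x) :
    ProjUnitaryNear I β α (fun y => (θ y).symm) x := by
  obtain ⟨u, hu, hθ⟩ := h
  refine ⟨fun y => (u y).symm, fun i j => ?_, ?_⟩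
  · refine (hu j i).conj.congr (Eventually.of_forall fun y => ?_)
    have h1 : ∀ (l : ℕ) (v : EuclideanSpace ℂ (Fin l)) (a : Fin l),
        v a = ⟪EuclideanSpace.single a (1 : ℂ), v⟫_ℂ := by
      intro l v a
      simp [EuclideanSpace.inner_single_left]
    simp only [h1]
    rw [inner_conj_symm, ← (u y).inner_map_map, LinearIsometryEquiv.apply_symm_apply]
  · filter_upwards [hθ] with y h1 p
    rw [Equiv.symm_apply_eq, h1, ← projMap_trans, LinearIsometryEquiv.symm_trans_self, projMap_refl]

variable (I M) in
/-- A bundle of finite-dimensional projective spaces over the manifold `M`: its fibre over `x` is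
isomorphic to `P(ℂ^r)`, where `r ≥ 1` is locally constant, and its structure group is `PU(r)`.  It
is presented by a local trivialisation `chart a` over an open neighbourhood `dom a` of each point
`a`, with smooth transition functions in the projective unitary group.  The values of `chart a`
outside `dom a` carry no information. -/
structure ProjectiveBundle where
  Fiber : M → Type
  rank : M → ℕ
  rank_pos : ∀ x, 0 < rank x
  dom : M → Set M
  isOpen_dom : ∀ a, IsOpen (dom a)
  mem_dom : ∀ a, a ∈ dom a
  chart : ∀ a x, ℙ ℂ (EuclideanSpace ℂ (Fin (rank a))) → Fiber x
  bijective_chart : ∀ a, ∀ x ∈ dom a, Function.Bijective (chart a x)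
  transition : ∀ a a', ∀ x ∈ dom a ∩ dom a',
    ProjUnitaryNear I (chart a) (chart a') (fun _ p => p) x

namespace ProjectiveBundle

/-- Isomorphism of projective bundles over `M`: a fibrewise bijection that is given by smooth
functions with values in the projective unitary group in the local trivialisations. -/
def Iso (P Q : ProjectiveBundle I M) : Prop :=
  ∃ θ : ∀ x, P.Fiber x ≃ Q.Fiber x,
    ∀ x, ProjUnitaryNear I (P.chart x) (Q.chart x) (fun y => θ y) x

variable (I M) in
instance isoSetoid : Setoid (ProjectiveBundle I M) where
  r := Iso
  iseqv :=
    { refl := fun P => ⟨fun _ => Equiv.refl _, fun x =>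
        P.transition x x x ⟨P.mem_dom x, P.mem_dom x⟩⟩
      symm := fun ⟨θ, h⟩ => ⟨fun x => (θ x).symm, fun x => (h x).symm⟩
      trans := fun ⟨θ, h⟩ ⟨η, h'⟩ => ⟨fun x => (θ x).trans (η x), fun x => (h x).trans (h' x)⟩ }

end ProjectiveBundle

end Projective

/-! ### Čech cohomology with integer coefficients

The Čech cohomology of `M` is the colimit of the cohomologies of the open covers of `M`.  The covers
`(U_x)`, `x ∈ M`, with `x ∈ U_x`, are cofinal, and every two of them have the common refinement
`(U_x ∩ U'_x)`.  A Čech cochain of degree `k` is written as a function `c` of `x_0, …, x_k` and of a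
point `t` of `M`; only its values for `t ∈ U_{x_0} ∩ … ∩ U_{x_k}` matter. -/

section Cech

variable {M : Type*}

/-- The intersection of the members of the cover indexed by `x_0, …, x_k`. -/
def overlap (U : M → Set M) {k : ℕ} (x : Fin k → M) : Set M := {t | ∀ i, t ∈ U (x i)}

/-- The Čech coboundary. -/
def cechD {A : Type*} [AddCommGroup A] {k : ℕ} (c : (Fin (k + 1) → M) → M → A)
    (x : Fin (k + 2) → M) (t : M) : A :=
  ∑ i : Fin (k + 2), ((-1 : ℤ) ^ (i : ℕ)) • c (x ∘ i.succAbove) t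

theorem cechD_add {A : Type*} [AddCommGroup A] {k : ℕ} (c c' : (Fin (k + 1) → M) → M → A) :
    cechD (c + c') = cechD c + cechD c' := by
  funext x t
  simp [cechD, Finset.sum_add_distrib]

theorem cechD_neg {A : Type*} [AddCommGroup A] {k : ℕ} (c : (Fin (k + 1) → M) → M → A) :
    cechD (-c) = -cechD c := by
  funext x t
  simp [cechD]

variable [TopologicalSpace M]

/-- An open cover indexed by the points of the space, `U x` being a neighbourhood of `x`. -/
def IsPointedCover (U : M → Set M) : Prop := ∀ x, IsOpen (U x) ∧ x ∈ U x

theorem IsPointedCover.inter {U V : M → Set M} (hU : IsPointedCover U) (hV : IsPointedCover V) :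
    IsPointedCover fun x => U x ∩ V x :=
  fun x => ⟨(hU x).1.inter (hV x).1, (hU x).2, (hV x).2⟩

variable (M) in
/-- Čech `k`-cocycles with values in the sheaf of locally constant integer-valued functions: on some
open cover, `c` is locally constant on the intersections and its coboundary vanishes. -/
def cechCocycles (k : ℕ) : AddSubgroup ((Fin (k + 1) → M) → M → ℤ) where
  carrier := {c | ∃ U : M → Set M, IsPointedCover U ∧ (∀ x, ContinuousOn (c x) (overlap U x)) ∧
    ∀ x, ∀ t ∈ overlap U x, cechD c x t = 0}
  zero_mem' := ⟨fun _ => univ, fun _ => ⟨isOpen_univ, mem_univ _⟩, fun _ => continuousOn_const,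
    fun _ _ _ => by simp [cechD]⟩
  add_mem' := by
    rintro c c' ⟨U, hU, hc, hd⟩ ⟨U', hU', hc', hd'⟩
    refine ⟨_, hU.inter hU', fun x => ((hc x).mono fun t ht i => (ht i).1).add
      ((hc' x).mono fun t ht i => (ht i).2), fun x t ht => ?_⟩
    simp [cechD_add, hd x t fun i => (ht i).1, hd' x t fun i => (ht i).2]
  neg_mem' := by
    rintro c ⟨U, hU, hc, hd⟩
    refine ⟨U, hU, fun x => (hc x).neg, fun x t ht => ?_⟩
    simp [cechD_neg, hd x t ht]

variable (M) in
/-- Čech `(k+1)`-coboundaries: on some open cover, `c` is the coboundary of a `k`-cochain. -/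
def cechCoboundaries (k : ℕ) : AddSubgroup ((Fin (k + 2) → M) → M → ℤ) where
  carrier := {c | ∃ (U : M → Set M) (b : (Fin (k + 1) → M) → M → ℤ), IsPointedCover U ∧
    (∀ x, ContinuousOn (b x) (overlap U x)) ∧ ∀ x, ∀ t ∈ overlap U x, c x t = cechD b x t}
  zero_mem' := ⟨fun _ => univ, 0, fun _ => ⟨isOpen_univ, mem_univ _⟩, fun _ => continuousOn_const,
    fun _ _ _ => by simp [cechD]⟩
  add_mem' := by
    rintro c c' ⟨U, b, hU, hb, hd⟩ ⟨U', b', hU', hb', hd'⟩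
    refine ⟨_, b + b', hU.inter hU', fun x => ((hb x).mono fun t ht i => (ht i).1).add
      ((hb' x).mono fun t ht i => (ht i).2), fun x t ht => ?_⟩
    simp [cechD_add, hd x t fun i => (ht i).1, hd' x t fun i => (ht i).2]
  neg_mem' := by
    rintro c ⟨U, b, hU, hb, hd⟩
    refine ⟨U, -b, hU, fun x => (hb x).neg, fun x t ht => ?_⟩
    simp [cechD_neg, hd x t ht]

variable (M) in
/-- The third Čech cohomology group `H³(M, ℤ)`. -/
abbrev CechH3 : Type _ :=
  cechCocycles M 3 ⧸ (cechCoboundaries M 2).addSubgroupOf (cechCocycles M 3)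

end Cech

section Main

variable {EM : Type*} [NormedAddCommGroup EM] [NormedSpace ℝ EM] {HM : Type*} [TopologicalSpace HM]
  (IM : ModelWithCorners ℝ EM HM) {M : Type*} [TopologicalSpace M] [ChartedSpace HM M]
  {EY : Type*} [NormedAddCommGroup EY] [NormedSpace ℝ EY] {HY : Type*} [TopologicalSpace HY]
  (IY : ModelWithCorners ℝ EY HY) {Y : Type*} [TopologicalSpace Y] [ChartedSpace HY Y]

/-! ### The image of a `U(1)`-valued Čech 2-cocycle in `H³(M, ℤ)` -/

/-- `c ∈ H³(M, ℤ)` is the image of the `U(1)`-valued 2-cocycle `g` on the cover `U` under the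
connecting homomorphism of `0 → ℤ → C^∞(ℝ) → C^∞(U(1)) → 0`, computed by smooth logarithms of `g` on
the triple intersections of `U`:
`g = exp(2πi h)`, and `c` is the class of the integer cocycle `δh`. -/
def IsConnectingImage (U : M → Set M) (g : (Fin 3 → M) → M → ℂ) (c : CechH3 M) : Prop :=
  ∃ (h : (Fin 3 → M) → M → ℝ) (z : cechCocycles M 3),
    (∀ x, ContMDiffOn IM 𝓘(ℝ, ℝ) ∞ (h x) (overlap U x)) ∧
    (∀ x, ∀ t ∈ overlap U x, g x t = Complex.exp (2 * Real.pi * Complex.I * h x t)) ∧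
    (∀ x, ∀ t ∈ overlap U x, ((z.1 x t : ℤ) : ℝ) = cechD h x t) ∧
    QuotientAddGroup.mk z = c

/-! ### The class of a projective bundle -/

variable {IM} in
/-- `c` is represented by a Čech cocycle of the projective bundle `P`: with respect to a cover by
domains of local trivialisations `chart (k x)` on `U x`, let `u x y` be smooth lifts to the unitary
group of the transition functions from `chart (k y)` to `chart (k x)`, with
`u x y ∘ u y z = g x y z • u x z`.  Then `g` is the `U(1)`-valued cocycle of the lifting bundle gerbe
of the principal bundle underlying `P`, and `c` is its image in `H³(M, ℤ)`. -/
def ProjectiveBundle.Represents (P : ProjectiveBundle IM M) (c : CechH3 M) : Prop :=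
  ∃ (U : M → Set M) (k : M → M)
    (u : ∀ x y, M → (EuclideanSpace ℂ (Fin (P.rank (k y))) →ₗ[ℂ]
      EuclideanSpace ℂ (Fin (P.rank (k x)))))
    (g : (Fin 3 → M) → M → ℂ),
    IsPointedCover U ∧ (∀ x, U x ⊆ P.dom (k x)) ∧
    (∀ x y, ∀ t ∈ U x ∩ U y, SmoothMatrixNear IM id (fun t' => u x y t') t) ∧
    (∀ x y, ∀ t ∈ U x ∩ U y,
      ∃ e : EuclideanSpace ℂ (Fin (P.rank (k y))) ≃ₗᵢ[ℂ] EuclideanSpace ℂ (Fin (P.rank (k x))),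
        (∀ v, u x y t v = e v) ∧ ∀ p, P.chart (k y) t p = P.chart (k x) t (projMap e p)) ∧
    (∀ x : Fin 3 → M, ∀ t ∈ overlap U x, ∀ v,
      u (x 0) (x 1) t (u (x 1) (x 2) t v) = g x t • u (x 0) (x 2) t v) ∧
    IsConnectingImage IM U g c

variable {IM} in
/-- `c` is the Dixmier–Douady class of `P`: the one class that the Čech cocycles of `P`
represent. -/
def ProjectiveBundle.HasDDClass (P : ProjectiveBundle IM M) (c : CechH3 M) : Prop :=
  ∀ c', P.Represents c' ↔ c' = c

/-- `Pro(M, c)`: the isomorphism classes of projective bundles on `M` with Dixmier–Douady class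
`c`. -/
def Pro (c : CechH3 M) : Set (Quotient (ProjectiveBundle.isoSetoid IM M)) :=
  {p | ∃ P : ProjectiveBundle IM M, P.HasDDClass c ∧ Quotient.mk _ P = p}

/-! ### Bundle gerbes -/

/-- The fibre product `Y^{[2]}`, with the subspace topology of `Y × Y`. -/
abbrev FibreProd2 (π : Y → M) : Type _ := {p : Y × Y // π p.1 = π p.2}

/-- The fibre product `Y^{[3]}`, with the subspace topology of `Y × Y × Y`. -/
abbrev FibreProd3 (π : Y → M) : Type _ :=
  {q : Y × Y × Y // π q.1 = π q.2.1 ∧ π q.2.1 = π q.2.2}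

/-- The point `(y₁, y₂)` of `Y^{[2]}`. -/
abbrev ypair {π : Y → M} {y₁ y₂ : Y} (h : π y₁ = π y₂) : FibreProd2 π := ⟨(y₁, y₂), h⟩

/-- A smooth map that admits smooth local sections. -/
def IsLocallySplit (π : Y → M) : Prop :=
  ContMDiff IY IM ∞ π ∧ ∀ x : M, ∃ (U : Set M) (s : M → Y), IsOpen U ∧ x ∈ U ∧
    ContMDiffOn IM IY ∞ s U ∧ ∀ t ∈ U, π (s t) = t

/-- A (hermitian) bundle gerbe `(L, Y)` over `M`: a locally split map `π : Y → M` and a hermitian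
line bundle `L → Y^{[2]}` with a smooth associative hermitian product
`L_{(y₁,y₂)} ⊗ L_{(y₂,y₃)} ≃ L_{(y₁,y₃)}`. -/
structure BundleGerbe (π : Y → M) where
  locallySplit : IsLocallySplit IM IY π
  L : HermitianBundle (IY.prod IY) (Subtype.val : FibreProd2 π → Y × Y)
  line : L.IsLine
  mul : ∀ {y₁ y₂ y₃ : Y} (h₁₂ : π y₁ = π y₂) (h₂₃ : π y₂ = π y₃),
    L.Fiber (ypair h₁₂) ⊗[ℂ] L.Fiber (ypair h₂₃) ≃ₗᵢ[ℂ] L.Fiber (ypair (h₁₂.trans h₂₃))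
  smooth_mul : ∀ (q₀ : FibreProd3 π) i j,
    L.SmoothSectionNear (IY.prod (IY.prod IY)) (Subtype.val : FibreProd3 π → Y × Y × Y)
      (fun q => ypair (q.2.1.trans q.2.2))
      (fun q => mul q.2.1 q.2.2
        (L.frame (ypair q₀.2.1) i (ypair q.2.1) ⊗ₜ L.frame (ypair q₀.2.2) j (ypair q.2.2))) q₀
  mul_assoc : ∀ {y₁ y₂ y₃ y₄ : Y} (h₁₂ : π y₁ = π y₂) (h₂₃ : π y₂ = π y₃) (h₃₄ : π y₃ = π y₄)
    (a : L.Fiber (ypair h₁₂)) (b : L.Fiber (ypair h₂₃)) (c : L.Fiber (ypair h₃₄)),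
    mul (h₁₂.trans h₂₃) h₃₄ (mul h₁₂ h₂₃ (a ⊗ₜ b) ⊗ₜ c) =
      mul h₁₂ (h₂₃.trans h₃₄) (a ⊗ₜ mul h₂₃ h₃₄ (b ⊗ₜ c))

namespace BundleGerbe

variable {IM IY} {π : Y → M}

/-- `c` is represented by a Čech cocycle of the bundle gerbe: with respect to an open cover `U`, let
`s x` be a smooth local section of `π` on `U x`, let `σ x y` be a smooth unit section of the pullback
of `L` along `(s x, s y)` on `U x ∩ U y`, and let `g` be the `U(1)`-valued cocycle with
`σ x y · σ y z = g x y z • σ x z`.  Then `c` is its image in `H³(M, ℤ)`.  (The `s x` are written as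
set-theoretic sections on all of `M`; only their restrictions to `U x` matter, and likewise for
`σ`.) -/
def Represents (G : BundleGerbe IM IY π) (c : CechH3 M) : Prop :=
  ∃ (U : M → Set M) (s : M → M → Y) (hs : ∀ x t, π (s x t) = t)
    (σ : ∀ x y t, G.L.Fiber (ypair ((hs x t).trans (hs y t).symm)))
    (g : (Fin 3 → M) → M → ℂ),
    IsPointedCover U ∧ (∀ x, ContMDiffOn IM IY ∞ (s x) (U x)) ∧
    (∀ x y, ∀ t ∈ U x ∩ U y, ‖σ x y t‖ = 1) ∧
    (∀ x y, ∀ t ∈ U x ∩ U y, G.L.SmoothSectionNear IM (id : M → M)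
      (fun t' => ypair ((hs x t').trans (hs y t').symm)) (σ x y) t) ∧
    (∀ x : Fin 3 → M, ∀ t ∈ overlap U x,
      G.mul ((hs (x 0) t).trans (hs (x 1) t).symm) ((hs (x 1) t).trans (hs (x 2) t).symm)
        (σ (x 0) (x 1) t ⊗ₜ σ (x 1) (x 2) t) = g x t • σ (x 0) (x 2) t) ∧
    IsConnectingImage IM U g c

/-- `c` is the Dixmier–Douady class `d(L)` of the bundle gerbe: the one class that its Čech cocycles
represent. -/
def HasDDClass (G : BundleGerbe IM IY π) (c : CechH3 M) : Prop :=
  ∀ c', G.Represents c' ↔ c' = c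

/-! ### Bundle gerbe modules -/

/-- A bundle gerbe module: a hermitian vector bundle `E → Y` of finite positive rank with a smooth
hermitian isomorphism `L_{(y₁,y₂)} ⊗ E_{y₂} ≃ E_{y₁}` compatible with the bundle gerbe product. -/
structure GerbeModule (G : BundleGerbe IM IY π) where
  E : HermitianBundle IY (id : Y → Y)
  rank_pos : ∀ y, 0 < E.rank y
  act : ∀ {y₁ y₂ : Y} (h : π y₁ = π y₂), G.L.Fiber (ypair h) ⊗[ℂ] E.Fiber y₂ ≃ₗᵢ[ℂ] E.Fiber y₁
  smooth_act : ∀ (q₀ : FibreProd2 π) i j,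
    E.SmoothSectionNear (IY.prod IY) (Subtype.val : FibreProd2 π → Y × Y) (fun q => q.1.1)
      (fun q => act q.2 (G.L.frame q₀ i q ⊗ₜ E.frame q₀.1.2 j q.1.2)) q₀
  act_mul : ∀ {y₁ y₂ y₃ : Y} (h₁₂ : π y₁ = π y₂) (h₂₃ : π y₂ = π y₃)
    (a : G.L.Fiber (ypair h₁₂)) (b : G.L.Fiber (ypair h₂₃)) (e : E.Fiber y₃),
    act h₁₂ (a ⊗ₜ act h₂₃ (b ⊗ₜ e)) = act (h₁₂.trans h₂₃) (G.mul h₁₂ h₂₃ (a ⊗ₜ b) ⊗ₜ e)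

namespace GerbeModule

variable {G : BundleGerbe IM IY π}

/-- Isomorphism of bundle gerbe modules: a smooth isomorphism of hermitian bundles that preserves
the action of the bundle gerbe. -/
def Iso (A B : GerbeModule G) : Prop :=
  ∃ θ : ∀ y, A.E.Fiber y ≃ₗᵢ[ℂ] B.E.Fiber y, A.E.IsSmoothIso B.E θ ∧
    ∀ {y₁ y₂ : Y} (h : π y₁ = π y₂) (a : G.L.Fiber (ypair h)) (e : A.E.Fiber y₂),
      θ y₁ (A.act h (a ⊗ₜ e)) = B.act h (a ⊗ₜ θ y₂ e)

instance isoSetoid (G : BundleGerbe IM IY π) : Setoid (GerbeModule G) where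
  r := Iso
  iseqv :=
    { refl := fun A => ⟨_, A.E.isSmoothIso_refl, fun _ _ _ => rfl⟩
      symm := fun ⟨θ, h, h'⟩ => ⟨_, h.symm, fun {y₁ y₂} hy a e => by
        rw [LinearIsometryEquiv.symm_apply_eq, h', LinearIsometryEquiv.apply_symm_apply]⟩
      trans := fun ⟨θ, h, h'⟩ ⟨η, k, k'⟩ => ⟨_, h.trans k, fun {y₁ y₂} hy a e => by
        simp only [LinearIsometryEquiv.trans_apply, h', k']⟩ }

/-- `A` is isomorphic, as a bundle gerbe module, to `π⁻¹(K) ⊗ B`, where `K` is a hermitian line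
bundle on `M` and the bundle gerbe acts on the second factor. -/
def IsTwist (K : HermitianBundle IM (id : M → M)) (A B : GerbeModule G) : Prop :=
  ∃ θ : ∀ {x : M} {y : Y}, π y = x → (K.Fiber x ⊗[ℂ] B.E.Fiber y ≃ₗᵢ[ℂ] A.E.Fiber y),
    (∀ (y₀ : Y) i j, A.E.SmoothSectionNear IY (id : Y → Y) id
      (fun y => θ rfl (K.frame (π y₀) i (π y) ⊗ₜ B.E.frame y₀ j y)) y₀) ∧
    ∀ {x : M} {y₁ y₂ : Y} (h₁ : π y₁ = x) (h₂ : π y₂ = x) (k : K.Fiber x)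
      (a : G.L.Fiber (ypair (h₁.trans h₂.symm))) (e : B.E.Fiber y₂),
      θ h₁ (k ⊗ₜ B.act (h₁.trans h₂.symm) (a ⊗ₜ e)) =
        A.act (h₁.trans h₂.symm) (a ⊗ₜ θ h₂ (k ⊗ₜ e))

/-- `P` is the projective bundle on `M` to which the projectivisation of `E → Y` descends: there is
an isomorphism of projective bundles `P(E) ≃ π⁻¹(P)` on `Y`, given by bijections
`P(E_y) ≃ P_x` for `π y = x`, under which the identifications `[e] ↦ [a · e]`
of `P(E_{y₂})` with `P(E_{y₁})`, for `a ∈ L_{(y₁,y₂)}` non-zero, become identities. -/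
def DescendsTo (A : GerbeModule G) (P : ProjectiveBundle IM M) : Prop :=
  ∃ θ : ∀ {x : M} {y : Y}, π y = x → (ℙ ℂ (A.E.Fiber y) ≃ P.Fiber x),
    (∀ y₀ : Y, ∃ u : Y → (EuclideanSpace ℂ (Fin (A.E.rank y₀)) ≃ₗᵢ[ℂ]
        EuclideanSpace ℂ (Fin (P.rank (π y₀)))),
      SmoothMatrixNear IY (id : Y → Y) (fun y => u y) y₀ ∧
      ∀ᶠ y in 𝓝 y₀, ∀ (hy : y ∈ A.E.dom y₀) p,
        θ rfl (projMap (A.E.frameIso hy) p) = P.chart (π y₀) (π y) (projMap (u y) p)) ∧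
    ∀ {x : M} {y₁ y₂ : Y} (h₁ : π y₁ = x) (h₂ : π y₂ = x)
      (a : G.L.Fiber (ypair (h₁.trans h₂.symm))) (e : A.E.Fiber y₂) (he : e ≠ 0)
      (hae : A.act (h₁.trans h₂.symm) (a ⊗ₜ e) ≠ 0),
      θ h₁ (Projectivization.mk ℂ _ hae) = θ h₂ (Projectivization.mk ℂ e he)

end GerbeModule

/-- `Mod(L)`: the isomorphism classes of bundle gerbe modules. -/
def Mod (G : BundleGerbe IM IY π) : Type _ := Quotient (GerbeModule.isoSetoid G)

/-- Two elements of `Mod(L)` are in the same orbit of `Lin(M)`: one is obtained from the other by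
tensoring with the pullback of a hermitian line bundle on `M`. -/
def linRel (G : BundleGerbe IM IY π) (p q : G.Mod) : Prop :=
  ∃ (K : HermitianBundle IM (id : M → M)) (A B : GerbeModule G), K.IsLine ∧
    Quotient.mk _ A = p ∧ Quotient.mk _ B = q ∧ GerbeModule.IsTwist K A B

/-- `Mod(L) / Lin(M)`. -/
def ModModLin (G : BundleGerbe IM IY π) : Type _ := Quot G.linRel

/-- The class of a bundle gerbe module in `Mod(L) / Lin(M)`. -/
def GerbeModule.toModModLin {G : BundleGerbe IM IY π} (A : GerbeModule G) : G.ModModLin :=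
  Quot.mk _ (Quotient.mk _ A : G.Mod)

end BundleGerbe

end Main

/-! ### Unitary maps, orthonormal bases and lines -/

section LinearAlgebra

variable {V W X : Type*} [NormedAddCommGroup V] [InnerProductSpace ℂ V]
  [NormedAddCommGroup W] [InnerProductSpace ℂ W] [NormedAddCommGroup X] [InnerProductSpace ℂ X]

/-! `L` acts on `E` through lines, so the identifications of `P(E_{y₂})` with `P(E_{y₁})` do not
depend on the vector of `L` (`tr_eq`). Compatibility with the product makes them a descent datum
(`tr_tr`), hence `P(E)` descends to `M` (`exists_descendsTo`), uniquely up to isomorphism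
(`DescendsTo.iso`).

The descended bundle has class `d(L)`. With frames `f_i` of `E` along local sections `s_i` of `π`,
the matrices `u_ij = f_i⁻¹ ∘ (σ_ij ·) ∘ f_j` lift its transition functions, and `σ_ij σ_jk = g_ijk
σ_ik` gives `u_ij u_jk = g_ijk u_ik` with the very same `g` (`IsDescent.represents`). The class does
not depend on choices, because other choices change `g` by the coboundary of a smooth `U(1)`-valued
cochain (`Represents.unique`), and this does not affect the integer class (`connecting_eq`).

Injectivity modulo `Lin(M)`: if `A` and `B` descend to the same `P`, the unitary maps `B_y ≃ A_y`
that lift the identity of `P` form a circle over each `y`. The action of `L` moves them consistently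
along the fibres of `π`, so these circles come from a line bundle `K` on `M`, and `A ≃ π⁻¹(K) ⊗ B`
(`exists_isTwist`).

Surjectivity: if `P` has class `d(L)`, the cocycle `g` of the gerbe and the cocycle `g'` of `P`
differ by the coboundary of some `l_ij`, because a partition of unity contracts the Čech complex of
smooth real functions (`exists_isCohomologousVia`). The matrices `l_ij u_ij` then fail to be a
cocycle exactly by `g`, and so they glue the bundles `L_{(y, s_i)} ⊗ ℂ^r` to a module that descends
to `P` (`exists_module_descendsTo`).

Covers are indexed by the points of `M`. Logarithms and unit sections exist at first only near
points; `exists_refinement` turns them into data on whole overlaps. -/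

theorem projMap_mk (u : V ≃ₗᵢ[ℂ] W) {v : V} (hv : v ≠ 0) (hv' : u v ≠ 0) :
    projMap u (Projectivization.mk ℂ v hv) = Projectivization.mk ℂ (u v) hv' := by
  simp [projMap, Projectivization.map_mk]

/-- The bijection of projective spaces induced by a unitary isomorphism. -/
noncomputable def projEquiv (u : V ≃ₗᵢ[ℂ] W) : ℙ ℂ V ≃ ℙ ℂ W where
  toFun := projMap u
  invFun := projMap u.symm
  left_inv p := by rw [← projMap_trans, LinearIsometryEquiv.self_trans_symm, projMap_refl]
  right_inv p := by rw [← projMap_trans, LinearIsometryEquiv.symm_trans_self, projMap_refl]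

@[simp] theorem projEquiv_apply (u : V ≃ₗᵢ[ℂ] W) (p : ℙ ℂ V) : projEquiv u p = projMap u p := rfl

theorem projMap_smul_eq {u u' : V ≃ₗᵢ[ℂ] W} {c : ℂ} (h : ∀ v, u' v = c • u v) (p : ℙ ℂ V) :
    projMap u' p = projMap u p := by
  induction p using Projectivization.ind with
  | h v hv =>
    have h1 : u v ≠ 0 := by simpa using hv
    have h2 : u' v ≠ 0 := by simpa using hv
    rw [projMap_mk u hv h1, projMap_mk u' hv h2, Projectivization.mk_eq_mk_iff']
    exact ⟨c, (h v).symm⟩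

/-- Unitary maps that agree on projective spaces differ by a phase. -/
theorem exists_smul_of_projMap_eq (u u' : V ≃ₗᵢ[ℂ] W) (h : ∀ p, projMap u' p = projMap u p) :
    ∃ c : ℂ, ‖c‖ = 1 ∧ ∀ v, u' v = c • u v := by
  -- A linear map that sends each vector to a multiple of itself is a homothety; this is applied to
  -- `u⁻¹ ∘ u'`.
  have key : ∀ v, ¬ LinearIndependent ℂ ![v, (u'.trans u.symm).toLinearEquiv.toLinearMap v] := by
    intro v hli
    have hv : v ≠ 0 := by simpa using hli.ne_zero 0
    have h1 : u v ≠ 0 := by simpa using hv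
    have h2 : u' v ≠ 0 := by simpa using hv
    have h3 := h (Projectivization.mk ℂ v hv)
    rw [projMap_mk u hv h1, projMap_mk u' hv h2, Projectivization.mk_eq_mk_iff'] at h3
    obtain ⟨a, ha⟩ := h3
    rw [LinearIndependent.pair_iff] at hli
    have h4 := hli a (-1) (by simp [← ha])
    simp at h4
  obtain ⟨a, ha⟩ := LinearMap.exists_eq_smul_id_of_forall_notLinearIndependent key
  have ha' : ∀ v, u' v = a • u v := by
    intro v
    have := congrArg u (LinearMap.congr_fun ha v)
    simpa using this
  by_cases hV : ∃ v : V, v ≠ 0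
  · obtain ⟨v, hv⟩ := hV
    refine ⟨a, ?_, ha'⟩
    have h1 := congrArg norm (ha' v)
    rw [norm_smul, u.norm_map, u'.norm_map] at h1
    have h2 : ‖v‖ ≠ 0 := by simpa using hv
    field_simp at h1
    exact h1.symm
  -- On the zero space every phase works.
  · push Not at hV
    exact ⟨1, by simp, fun v => by simp [hV v]⟩

/-- If `u' = c • u`, then `c` is an inner product. -/
theorem inner_eq_of_eq_smul {u u' : W} {c : ℂ} (h : u' = c • u) (hu : ‖u‖ = 1) : ⟪u, u'⟫_ℂ = c := by
  rw [h, inner_smul_right, inner_self_eq_norm_sq_to_K, hu]; simp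

/-- The vectors `f i` form an orthonormal basis. -/
def IsONB {n : ℕ} (f : Fin n → V) : Prop :=
  Orthonormal ℂ f ∧ Submodule.span ℂ (range f) = ⊤

namespace IsONB

variable {n : ℕ} {f : Fin n → V}

/-- The unitary isomorphism `ℂ^n ≃ V` given by an orthonormal basis. -/
noncomputable def iso (h : IsONB f) : EuclideanSpace ℂ (Fin n) ≃ₗᵢ[ℂ] V :=
  (OrthonormalBasis.mk h.1 h.2.ge).repr.symm

theorem iso_single (h : IsONB f) (i : Fin n) : h.iso (EuclideanSpace.single i 1) = f i := by
  simp [iso]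

theorem iso_symm_apply (h : IsONB f) (v : V) (i : Fin n) : h.iso.symm v i = ⟪f i, v⟫_ℂ := by
  simp [iso, OrthonormalBasis.repr_apply_apply]

theorem expand (h : IsONB f) (v : V) : v = ∑ i, ⟪f i, v⟫_ℂ • f i := by
  have := (OrthonormalBasis.mk h.1 h.2.ge).sum_repr' v
  simpa using this.symm

theorem inner_eq_sum (h : IsONB f) (v w : V) : ⟪v, w⟫_ℂ = ∑ i, ⟪v, f i⟫_ℂ * ⟪f i, w⟫_ℂ := by
  have := (OrthonormalBasis.mk h.1 h.2.ge).sum_inner_mul_inner v w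
  simpa using this.symm

theorem of_iso (e : EuclideanSpace ℂ (Fin n) ≃ₗᵢ[ℂ] V) (he : ∀ i, e (EuclideanSpace.single i 1) = f i) :
    IsONB f := by
  have h1 : f = (EuclideanSpace.basisFun (Fin n) ℂ).map e := by
    funext i; simp [he]
  rw [h1]
  refine ⟨OrthonormalBasis.orthonormal _, ?_⟩
  rw [← OrthonormalBasis.coe_toBasis]
  exact Module.Basis.span_eq _

theorem norm_eq (h : IsONB f) (i : Fin n) : ‖f i‖ = 1 := h.1.norm_eq_one i

end IsONB

theorem euclidean_ext {n : ℕ} {e e' : EuclideanSpace ℂ (Fin n) →ₗ[ℂ] V}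
    (h : ∀ i, e (EuclideanSpace.single i 1) = e' (EuclideanSpace.single i 1)) : e = e' := by
  apply (EuclideanSpace.basisFun (Fin n) ℂ).toBasis.ext
  intro i
  simpa using h i

/-- In a line, a unit vector spans. -/
theorem eq_inner_smul (hV : Module.finrank ℂ V = 1) {ε : V} (hε : ‖ε‖ = 1) (a : V) :
    a = ⟪ε, a⟫_ℂ • ε := by
  have h0 : ε ≠ 0 := by rintro rfl; simp at hε
  obtain ⟨c, hc⟩ := (finrank_eq_one_iff_of_nonzero' ε h0).1 hV a
  rw [inner_eq_of_eq_smul hc.symm hε, hc]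

theorem exists_norm_eq_one_of_finrank (hV : Module.finrank ℂ V = 1) : ∃ ε : V, ‖ε‖ = 1 := by
  have : Nontrivial V := Module.nontrivial_of_finrank_eq_succ hV
  obtain ⟨v, hv⟩ := exists_ne (0 : V)
  exact ⟨((‖v‖⁻¹ : ℝ) : ℂ) • v, by rw [norm_smul]; simp [hv]⟩

theorem norm_inner_eq_one (hV : Module.finrank ℂ V = 1) {ε a : V} (hε : ‖ε‖ = 1) (ha : ‖a‖ = 1) :
    ‖⟪ε, a⟫_ℂ‖ = 1 := by
  have h := congrArg norm (eq_inner_smul hV hε a)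
  rw [norm_smul, hε, ha, mul_one] at h
  exact h.symm

/-- A unit vector `ε` of a line `V` gives `V ≃ ℂ`. -/
noncomputable def lineIso (hV : Module.finrank ℂ V = 1) {ε : V} (hε : ‖ε‖ = 1) : V ≃ₗᵢ[ℂ] ℂ :=
  LinearIsometryEquiv.ofSurjective
    { toLinearMap := (innerSL ℂ ε).toLinearMap
      norm_map' := fun a => by
        conv_rhs => rw [eq_inner_smul hV hε a, norm_smul, hε, mul_one]
        rfl }
    (fun c => ⟨c • ε, by
      change ⟪ε, c • ε⟫_ℂ = c
      exact inner_eq_of_eq_smul rfl hε⟩)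

theorem lineIso_apply (hV : Module.finrank ℂ V = 1) {ε : V} (hε : ‖ε‖ = 1) (a : V) :
    lineIso hV hε a = ⟪ε, a⟫_ℂ := rfl

/-- A unit vector `ε` of a line `V` and a unitary isomorphism `W ≃ X` give `V ⊗ W ≃ X`. -/
noncomputable def lineTensorIso (hV : Module.finrank ℂ V = 1) {ε : V} (hε : ‖ε‖ = 1)
    (φ : W ≃ₗᵢ[ℂ] X) : V ⊗[ℂ] W ≃ₗᵢ[ℂ] X :=
  (TensorProduct.congrIsometry (lineIso hV hε) φ).trans (TensorProduct.lidIsometry ℂ X)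

theorem lineTensorIso_tmul (hV : Module.finrank ℂ V = 1) {ε : V} (hε : ‖ε‖ = 1)
    (φ : W ≃ₗᵢ[ℂ] X) (a : V) (w : W) :
    lineTensorIso hV hε φ (a ⊗ₜ w) = ⟪ε, a⟫_ℂ • φ w := by
  simp [lineTensorIso, lineIso_apply]

/-- A unitary isomorphism `V ⊗ W ≃ X` and a unit vector of a line `V` give `W ≃ X`. -/
noncomputable def tensorLineIso (hV : Module.finrank ℂ V = 1) (m : V ⊗[ℂ] W ≃ₗᵢ[ℂ] X)
    {a : V} (ha : ‖a‖ = 1) : W ≃ₗᵢ[ℂ] X :=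
  (lineTensorIso hV ha (LinearIsometryEquiv.refl ℂ W)).symm.trans m

theorem tensorLineIso_apply (hV : Module.finrank ℂ V = 1) (m : V ⊗[ℂ] W ≃ₗᵢ[ℂ] X)
    {a : V} (ha : ‖a‖ = 1) (w : W) : tensorLineIso hV m ha w = m (a ⊗ₜ w) := by
  have h : lineTensorIso hV ha (LinearIsometryEquiv.refl ℂ W) (a ⊗ₜ w) = w := by
    rw [lineTensorIso_tmul, inner_self_eq_norm_sq_to_K, ha]; simp
  rw [tensorLineIso, LinearIsometryEquiv.trans_apply]
  congr 1
  rw [LinearIsometryEquiv.symm_apply_eq, h]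

/-- Unitary maps are usually constructed only at points near `b`. This completes them to a family
defined everywhere by arbitrary values. A choice made pointwise need not be smooth, so in the
applications `Q` also prescribes the matrix entries or the values on a frame, from which smoothness
is read off. -/
theorem exists_choice_of_eventually {B : Type*} [TopologicalSpace B] {b : B} {T : B → Type*}
    {Q : ∀ b, T b → Prop} (hT : ∀ b, Nonempty (T b)) (h : ∀ᶠ b' in 𝓝 b, ∃ e, Q b' e) :
    ∃ u : ∀ b, T b, ∀ᶠ b' in 𝓝 b, Q b' (u b') := by
  classical
  refine ⟨fun b' => if h : ∃ e, Q b' e then h.choose else (hT b').some, ?_⟩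
  filter_upwards [h] with b' hb'
  rw [dif_pos hb']
  exact hb'.choose_spec

end LinearAlgebra

/-! ### Smooth maps between subspaces of manifolds -/

section SmoothCalculus

variable {E : Type*} [NormedAddCommGroup E] [NormedSpace ℝ E] {H : Type*} [TopologicalSpace H]
  {I : ModelWithCorners ℝ E H} {N : Type*} [TopologicalSpace N] [ChartedSpace H N]
  {B : Type*} [TopologicalSpace B] {inc : B → N}
  {E' : Type*} [NormedAddCommGroup E'] [NormedSpace ℝ E'] {H' : Type*} [TopologicalSpace H']
  {I' : ModelWithCorners ℝ E' H'} {N' : Type*} [TopologicalSpace N'] [ChartedSpace H' N']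
  {B' : Type*} [TopologicalSpace B'] {inc' : B' → N'}

variable (I inc I' inc') in
/-- A map between subspaces of manifolds is *smooth near `b`* if it is continuous at `b` and, on a
neighbourhood of `b`, the restriction of a smooth map defined on an open subset. -/
def SmoothMapNear (φ : B → B') (b : B) : Prop :=
  ContinuousAt φ b ∧ ∃ (V : Set N) (g : N → N'), IsOpen V ∧ inc b ∈ V ∧ ContMDiffOn I I' ∞ g V ∧
    (fun x => inc' (φ x)) =ᶠ[𝓝 b] fun x => g (inc x)

/-- The topology of `B'` need not be induced by `inc'`, so the continuity of `φ` is a separate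
clause of `SmoothMapNear`. Here it pulls back the neighbourhood on which `f` agrees with its smooth
extension. -/
theorem SmoothNear.comp {f : B' → ℂ} {φ : B → B'} {b : B} (hf : SmoothNear I' inc' f (φ b))
    (hφ : SmoothMapNear I inc I' inc' φ b) : SmoothNear I inc (fun x => f (φ x)) b := by
  obtain ⟨V, g, hV, hb, hg, hfg⟩ := hf
  obtain ⟨hc, W, k, hW, hbW, hk, hφk⟩ := hφ
  refine ⟨W ∩ k ⁻¹' V, fun x => g (k x), hk.continuousOn.isOpen_inter_preimage hW hV,
    ⟨hbW, ?_⟩, ?_, ?_⟩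
  · have := hφk.eq_of_nhds
    simpa [← this] using hb
  · exact hg.comp (hk.mono inter_subset_left) fun x hx => hx.2
  · filter_upwards [hφk, hc.eventually hfg] with x h1 h2
    rw [h2, h1]

theorem SmoothNear.eventually {f : B → ℂ} {b : B} (h : SmoothNear I inc f b)
    (hinc : Continuous inc) : ∀ᶠ x in 𝓝 b, SmoothNear I inc f x := by
  obtain ⟨V, g, hV, hb, hg, hf⟩ := h
  filter_upwards [hinc.continuousAt.preimage_mem_nhds (hV.mem_nhds hb), hf.eventually_nhds]
    with x h1 h2
  exact ⟨V, g, hV, h1, hg, h2⟩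

theorem SmoothNear.contMDiffAt {f : N → ℂ} {b : N} (h : SmoothNear I id f b) :
    ContMDiffAt I 𝓘(ℝ, ℂ) ∞ f b := by
  obtain ⟨V, g, hV, hb, hg, hf⟩ := h
  exact (hg.contMDiffAt (hV.mem_nhds hb)).congr_of_eventuallyEq hf

theorem SmoothNear.of_contMDiffOn {f : N → ℂ} {b : N} {V : Set N} (hV : IsOpen V) (hb : b ∈ V)
    (h : ContMDiffOn I 𝓘(ℝ, ℂ) ∞ f V) : SmoothNear I id f b :=
  ⟨V, f, hV, hb, h, EventuallyEq.rfl⟩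

theorem SmoothMapNear.of_contMDiffOn {φ : N → N'} {V : Set N} (hV : IsOpen V)
    (h : ContMDiffOn I I' ∞ φ V) {b : N} (hb : b ∈ V) : SmoothMapNear I id I' id φ b :=
  ⟨h.continuousOn.continuousAt (hV.mem_nhds hb), V, φ, hV, hb, h, EventuallyEq.rfl⟩

variable {E'' : Type*} [NormedAddCommGroup E''] [NormedSpace ℝ E''] {H'' : Type*}
  [TopologicalSpace H''] {I'' : ModelWithCorners ℝ E'' H''} {N'' : Type*} [TopologicalSpace N'']
  [ChartedSpace H'' N''] {B'' : Type*} [TopologicalSpace B''] {inc'' : B'' → N''}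

theorem SmoothMapNear.comp {ψ : B' → B''} {φ : B → B'} {b : B}
    (hψ : SmoothMapNear I' inc' I'' inc'' ψ (φ b))
    (hφ : SmoothMapNear I inc I' inc' φ b) : SmoothMapNear I inc I'' inc'' (fun x => ψ (φ x)) b := by
  obtain ⟨hc', V, g, hV, hb, hg, hfg⟩ := hψ
  obtain ⟨hc, W, k, hW, hbW, hk, hφk⟩ := hφ
  refine ⟨ContinuousAt.comp hc' hc, W ∩ k ⁻¹' V, fun x => g (k x),
    hk.continuousOn.isOpen_inter_preimage hW hV, ⟨hbW, ?_⟩, ?_, ?_⟩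
  · have := hφk.eq_of_nhds
    simpa [← this] using hb
  · exact hg.comp (hk.mono inter_subset_left) fun x hx => hx.2
  · filter_upwards [hφk, hc.eventually hfg] with x h1 h2
    rw [h2, h1]

/-- The product of smooth maps, as a map into a subspace of a product of manifolds. -/
theorem SmoothMapNear.prodMk {P : Type*} [TopologicalSpace P] {ι : P → N' × N''}
    (hι : IsInducing ι) {φ : B → B'} {ψ : B → B''} {χ : B → P} {b : B}
    (hφ : SmoothMapNear I inc I' inc' φ b) (hψ : SmoothMapNear I inc I'' inc'' ψ b)
    (hi : Continuous inc') (hi' : Continuous inc'')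
    (h : ∀ x, ι (χ x) = (inc' (φ x), inc'' (ψ x))) :
    SmoothMapNear I inc (I'.prod I'') ι χ b := by
  obtain ⟨hc', V, g, hV, hb, hg, hfg⟩ := hψ
  obtain ⟨hc, W, k, hW, hbW, hk, hφk⟩ := hφ
  refine ⟨?_, W ∩ V, fun x => (k x, g x), hW.inter hV, ⟨hbW, hb⟩,
    (hk.mono inter_subset_left).prodMk (hg.mono inter_subset_right), ?_⟩
  · rw [hι.continuousAt_iff]
    have h1 : ι ∘ χ = fun x => (inc' (φ x), inc'' (ψ x)) := funext h
    rw [h1]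
    exact (hi.continuousAt.comp hc).prodMk (hi'.continuousAt.comp hc')
  · filter_upwards [hφk, hfg] with x h1 h2
    rw [h, h1, h2]

end SmoothCalculus

/-! ### Smooth sections in a local frame -/

section SmoothSections

variable {E : Type*} [NormedAddCommGroup E] [NormedSpace ℝ E] {H : Type*} [TopologicalSpace H]
  (I : ModelWithCorners ℝ E H) {N : Type*} [TopologicalSpace N] [ChartedSpace H N]
  {B : Type*} [TopologicalSpace B] (inc : B → N)
  {F F' F'' : B → Type*} [∀ b, NormedAddCommGroup (F b)] [∀ b, InnerProductSpace ℂ (F b)]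
  [∀ b, NormedAddCommGroup (F' b)] [∀ b, InnerProductSpace ℂ (F' b)]
  [∀ b, NormedAddCommGroup (F'' b)] [∀ b, InnerProductSpace ℂ (F'' b)]

/-- Smoothness near `b` of a section of a family of inner product spaces, in terms of its
coordinates in a frame. -/
def SmoothSec {n : ℕ} (e : Fin n → ∀ b, F b) (σ : ∀ b, F b) (b : B) : Prop :=
  ∀ i, SmoothNear I inc (fun x => ⟪e i x, σ x⟫_ℂ) b

variable {I inc}
variable {n n' n'' : ℕ} {e : Fin n → ∀ b, F b} {e' : Fin n' → ∀ b, F' b} {e'' : Fin n'' → ∀ b, F'' b}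
  {b : B}

theorem SmoothSec.congr {σ τ : ∀ b, F b} (h : SmoothSec I inc e σ b) (hστ : ∀ᶠ x in 𝓝 b, τ x = σ x) :
    SmoothSec I inc e τ b := fun i =>
  (h i).congr (by filter_upwards [hστ] with x hx; rw [hx])

theorem SmoothSec.inner {σ τ : ∀ b, F b} (hσ : SmoothSec I inc e σ b) (hτ : SmoothSec I inc e τ b)
    (he : ∀ᶠ x in 𝓝 b, IsONB fun i => e i x) : SmoothNear I inc (fun x => ⟪σ x, τ x⟫_ℂ) b := by
  refine (SmoothNear.sum Finset.univ fun i _ => ((hσ i).conj.mul (hτ i))).congr ?_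
  filter_upwards [he] with x hx
  simp only [inner_conj_symm]
  exact hx.inner_eq_sum _ _

theorem SmoothSec.smul {σ : ∀ b, F b} {c : B → ℂ} (hσ : SmoothSec I inc e σ b)
    (hc : SmoothNear I inc c b) : SmoothSec I inc e (fun x => c x • σ x) b := fun i =>
  (hc.mul (hσ i)).congr (Eventually.of_forall fun x => by simp)

theorem SmoothSec.sum {κ : Type*} (s : Finset κ) {σ : κ → ∀ b, F b}
    (hσ : ∀ k ∈ s, SmoothSec I inc e (σ k) b) : SmoothSec I inc e (fun x => ∑ k ∈ s, σ k x) b :=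
  fun i => (SmoothNear.sum s fun k hk => hσ k hk i).congr
    (Eventually.of_forall fun x => by simp)

/-- Change of frame. -/
theorem SmoothSec.change {f : Fin n' → ∀ b, F b} {σ : ∀ b, F b} (hσ : SmoothSec I inc e σ b)
    (he : ∀ᶠ x in 𝓝 b, IsONB fun i => e i x) (hf : ∀ j, SmoothSec I inc e (f j) b) :
    SmoothSec I inc f σ b := fun j => (hf j).inner hσ he

/-- A family of linear maps that is smooth on a frame is smooth. -/
theorem SmoothSec.map {σ : ∀ b, F b} (hσ : SmoothSec I inc e σ b)
    (he : ∀ᶠ x in 𝓝 b, IsONB fun i => e i x) (Ψ : ∀ x, F x →ₗ[ℂ] F' x)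
    (hΨ : ∀ i, SmoothSec I inc e' (fun x => Ψ x (e i x)) b) :
    SmoothSec I inc e' (fun x => Ψ x (σ x)) b := by
  refine (SmoothSec.sum Finset.univ fun i _ => (hΨ i).smul (hσ i)).congr ?_
  filter_upwards [he] with x hx
  conv_lhs => rw [hx.expand (σ x), map_sum]
  simp

/-- A family of unitary maps that is smooth on a frame has a smooth inverse. -/
theorem SmoothSec.symm_map {σ : ∀ b, F' b} (hσ : SmoothSec I inc e' σ b)
    (he' : ∀ᶠ x in 𝓝 b, IsONB fun i => e' i x) (Ψ : ∀ x, F x ≃ₗᵢ[ℂ] F' x)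
    (hΨ : ∀ i, SmoothSec I inc e' (fun x => Ψ x (e i x)) b) :
    SmoothSec I inc e (fun x => (Ψ x).symm (σ x)) b := by
  intro i
  refine ((hΨ i).inner hσ he').congr (Eventually.of_forall fun x => ?_)
  simp only
  -- Unitarity moves `Ψ` to the other side of the inner product, so no matrix has to be inverted.
  rw [← (Ψ x).inner_map_map, LinearIsometryEquiv.apply_symm_apply]

/-- A family of maps on tensor products that is smooth on frames is smooth. -/
theorem SmoothSec.tmul {σ : ∀ b, F b} {τ : ∀ b, F' b} (hσ : SmoothSec I inc e σ b)
    (hτ : SmoothSec I inc e' τ b) (he : ∀ᶠ x in 𝓝 b, IsONB fun i => e i x)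
    (he' : ∀ᶠ x in 𝓝 b, IsONB fun i => e' i x) (m : ∀ x, F x ⊗[ℂ] F' x →ₗ[ℂ] F'' x)
    (hm : ∀ i j, SmoothSec I inc e'' (fun x => m x (e i x ⊗ₜ e' j x)) b) :
    SmoothSec I inc e'' (fun x => m x (σ x ⊗ₜ τ x)) b := by
  refine (SmoothSec.sum Finset.univ fun i _ => SmoothSec.sum Finset.univ fun j _ =>
    ((hm i j).smul (hτ j)).smul (hσ i)).congr ?_
  filter_upwards [he, he'] with x hx hx'
  conv_lhs => rw [hx.expand (σ x), TensorProduct.sum_tmul, map_sum]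
  refine Finset.sum_congr rfl fun i _ => ?_
  conv_lhs => rw [hx'.expand (τ x), TensorProduct.tmul_sum, map_sum]
  refine Finset.sum_congr rfl fun j _ => ?_
  rw [TensorProduct.tmul_smul, ← TensorProduct.smul_tmul', map_smul, map_smul, smul_comm]

end SmoothSections

/-! ### Sections of hermitian bundles pulled back along smooth maps -/

namespace HermitianBundle

variable {E : Type*} [NormedAddCommGroup E] [NormedSpace ℝ E] {H : Type*} [TopologicalSpace H]
  {I : ModelWithCorners ℝ E H} {N : Type*} [TopologicalSpace N] [ChartedSpace H N]
  {B : Type*} [TopologicalSpace B] {inc : B → N} (V : HermitianBundle I inc)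
  {E' : Type*} [NormedAddCommGroup E'] [NormedSpace ℝ E'] {H' : Type*} [TopologicalSpace H']
  {I' : ModelWithCorners ℝ E' H'} {N' : Type*} [TopologicalSpace N'] [ChartedSpace H' N']
  {B' : Type*} [TopologicalSpace B'] {inc' : B' → N'}

theorem isONB {a b : B} (h : b ∈ V.dom a) : IsONB fun i => V.frame a i b :=
  ⟨V.orthonormal_frame a b h, V.span_frame a b h⟩

theorem frameIso_eq {a b : B} (h : b ∈ V.dom a) : V.frameIso h = (V.isONB h).iso := rfl

theorem finrank_of_isLine (hV : V.IsLine) (b : B) : Module.finrank ℂ (V.Fiber b) = 1 := by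
  have h := (V.isONB (V.mem_dom b)).iso.toLinearEquiv.finrank_eq
  rw [← h, finrank_euclideanSpace_fin, hV b]

theorem eventually_isONB {f : B' → B} {a : B} {b : B'} (hf : ContinuousAt f b) (h : f b ∈ V.dom a) :
    ∀ᶠ x in 𝓝 b, IsONB fun i => V.frame a i (f x) := by
  filter_upwards [hf.preimage_mem_nhds ((V.isOpen_dom a).mem_nhds h)] with x hx
  exact V.isONB hx

variable {V}

theorem smoothSec_frame {f : B' → B} {b : B'} (hf : SmoothMapNear I' inc' I inc f b) {a a' : B}
    (h : f b ∈ V.dom a) (h' : f b ∈ V.dom a') (i : Fin (V.rank a')) :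
    SmoothSec I' inc' (fun i x => V.frame a i (f x)) (fun x => V.frame a' i (f x)) b := fun j =>
  (V.smooth_frame a a' (f b) ⟨h, h'⟩ j i).comp hf

/-- Smoothness of a section does not depend on the frame. -/
theorem smoothSec_iff {f : B' → B} {b : B'} (hf : SmoothMapNear I' inc' I inc f b) {a : B}
    (h : f b ∈ V.dom a) {σ : ∀ b, V.Fiber (f b)} :
    V.SmoothSectionNear I' inc' f σ b ↔ SmoothSec I' inc' (fun i x => V.frame a i (f x)) σ b := by
  refine ⟨fun hσ => ?_, fun hσ => ?_⟩
  · exact SmoothSec.change (e := fun i x => V.frame (f b) i (f x)) hσ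
      (V.eventually_isONB hf.1 (V.mem_dom _)) fun j => smoothSec_frame hf (V.mem_dom _) h j
  · exact SmoothSec.change hσ
      (V.eventually_isONB hf.1 h) fun j => smoothSec_frame hf h (V.mem_dom _) j

theorem smoothSectionNear_frame {f : B' → B} {b : B'} (hf : SmoothMapNear I' inc' I inc f b) {a : B}
    (h : f b ∈ V.dom a) (i : Fin (V.rank a)) :
    V.SmoothSectionNear I' inc' f (fun x => V.frame a i (f x)) b :=
  smoothSec_frame hf (V.mem_dom _) h i

theorem SmoothSectionNear.inner {f : B' → B} {b : B'} (hf : ContinuousAt f b)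
    {σ τ : ∀ b, V.Fiber (f b)} (hσ : V.SmoothSectionNear I' inc' f σ b)
    (hτ : V.SmoothSectionNear I' inc' f τ b) : SmoothNear I' inc' (fun x => ⟪σ x, τ x⟫_ℂ) b :=
  SmoothSec.inner (e := fun i x => V.frame (f b) i (f x)) hσ hτ
    (V.eventually_isONB hf (V.mem_dom _))

theorem SmoothSectionNear.congr {f : B' → B} {b : B'} {σ τ : ∀ b, V.Fiber (f b)}
    (hσ : V.SmoothSectionNear I' inc' f σ b) (h : ∀ᶠ x in 𝓝 b, τ x = σ x) :
    V.SmoothSectionNear I' inc' f τ b :=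
  SmoothSec.congr (e := fun i x => V.frame (f b) i (f x)) hσ h

theorem SmoothSectionNear.smul {f : B' → B} {b : B'} {σ : ∀ b, V.Fiber (f b)} {c : B' → ℂ}
    (hσ : V.SmoothSectionNear I' inc' f σ b) (hc : SmoothNear I' inc' c b) :
    V.SmoothSectionNear I' inc' f (fun x => c x • σ x) b :=
  SmoothSec.smul (e := fun i x => V.frame (f b) i (f x)) hσ hc

variable {E'' : Type*} [NormedAddCommGroup E''] [NormedSpace ℝ E''] {H'' : Type*}
  [TopologicalSpace H''] {I'' : ModelWithCorners ℝ E'' H''} {N'' : Type*} [TopologicalSpace N'']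
  [ChartedSpace H'' N''] {B'' : Type*} [TopologicalSpace B''] {inc'' : B'' → N''}

theorem SmoothSectionNear.comp {f : B' → B} {φ : B'' → B'} {b : B''}
    {σ : ∀ b, V.Fiber (f b)} (hσ : V.SmoothSectionNear I' inc' f σ (φ b))
    (hφ : SmoothMapNear I'' inc'' I' inc' φ b) :
    V.SmoothSectionNear I'' inc'' (fun x => f (φ x)) (fun x => σ (φ x)) b :=
  fun i => (hσ i).comp hφ

end HermitianBundle

/-! ### Čech cochains in low degrees -/

section CechFormulas

variable {M : Type*}

theorem vec3_eta (x : Fin 3 → M) : ![x 0, x 1, x 2] = x := by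
  ext i; fin_cases i <;> rfl

theorem vec4_eta (x : Fin 4 → M) : ![x 0, x 1, x 2, x 3] = x := by
  ext i; fin_cases i <;> rfl

theorem overlap_vec3 {U : M → Set M} {a b c t : M} (ha : t ∈ U a) (hb : t ∈ U b) (hc : t ∈ U c) :
    t ∈ overlap U ![a, b, c] := by
  intro i; fin_cases i <;> assumption

theorem overlap_vec4 {U : M → Set M} {a b c d t : M} (ha : t ∈ U a) (hb : t ∈ U b) (hc : t ∈ U c)
    (hd : t ∈ U d) : t ∈ overlap U ![a, b, c, d] := by
  intro i; fin_cases i <;> assumption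

theorem overlap_vec5 {U : M → Set M} {a b c d e t : M} (ha : t ∈ U a) (hb : t ∈ U b) (hc : t ∈ U c)
    (hd : t ∈ U d) (he : t ∈ U e) : t ∈ overlap U ![a, b, c, d, e] := by
  intro i; fin_cases i <;> assumption

theorem cechD_cast {k : ℕ} (n : (Fin (k + 1) → M) → M → ℤ) (x : Fin (k + 2) → M) (t : M) :
    ((cechD n x t : ℤ) : ℝ) = cechD (fun x t => (n x t : ℝ)) x t := by
  simp [cechD]

variable {A : Type*} [AddCommGroup A]

theorem cechD_apply_four (c : (Fin 3 → M) → M → A) (a b d e : M) (t : M) :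
    cechD c ![a, b, d, e] t =
      c ![b, d, e] t - c ![a, d, e] t + c ![a, b, e] t - c ![a, b, d] t := by
  have h0 : ![a, b, d, e] ∘ (0 : Fin 4).succAbove = ![b, d, e] := by ext i; fin_cases i <;> rfl
  have h1 : ![a, b, d, e] ∘ (1 : Fin 4).succAbove = ![a, d, e] := by ext i; fin_cases i <;> rfl
  have h2 : ![a, b, d, e] ∘ (2 : Fin 4).succAbove = ![a, b, e] := by ext i; fin_cases i <;> rfl
  have h3 : ![a, b, d, e] ∘ (3 : Fin 4).succAbove = ![a, b, d] := by ext i; fin_cases i <;> rfl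
  change ∑ i : Fin 4, ((-1 : ℤ) ^ (i : ℕ)) • c (![a, b, d, e] ∘ i.succAbove) t = _
  simp only [Fin.sum_univ_four, h0, h1, h2, h3]
  simp [pow_succ]
  abel

theorem cechD_apply_five (c : (Fin 4 → M) → M → A) (a b d e f : M) (t : M) :
    cechD c ![a, b, d, e, f] t =
      c ![b, d, e, f] t - c ![a, d, e, f] t + c ![a, b, e, f] t - c ![a, b, d, f] t
        + c ![a, b, d, e] t := by
  have h0 : ![a, b, d, e, f] ∘ (0 : Fin 5).succAbove = ![b, d, e, f] := by
    ext i; fin_cases i <;> rfl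
  have h1 : ![a, b, d, e, f] ∘ (1 : Fin 5).succAbove = ![a, d, e, f] := by
    ext i; fin_cases i <;> rfl
  have h2 : ![a, b, d, e, f] ∘ (2 : Fin 5).succAbove = ![a, b, e, f] := by
    ext i; fin_cases i <;> rfl
  have h3 : ![a, b, d, e, f] ∘ (3 : Fin 5).succAbove = ![a, b, d, f] := by
    ext i; fin_cases i <;> rfl
  have h4 : ![a, b, d, e, f] ∘ (4 : Fin 5).succAbove = ![a, b, d, e] := by
    ext i; fin_cases i <;> rfl
  change ∑ i : Fin 5, ((-1 : ℤ) ^ (i : ℕ)) • c (![a, b, d, e, f] ∘ i.succAbove) t = _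
  simp only [Fin.sum_univ_five, h0, h1, h2, h3, h4]
  simp [pow_succ]
  abel

theorem forall_vec4 {p : (Fin 4 → M) → Prop} : (∀ x, p x) ↔ ∀ a b c d, p ![a, b, c, d] :=
  ⟨fun h _ _ _ _ => h _, fun h x => vec4_eta x ▸ h _ _ _ _⟩

theorem forall_vec3 {p : (Fin 3 → M) → Prop} : (∀ x, p x) ↔ ∀ a b c, p ![a, b, c] :=
  ⟨fun h _ _ _ => h _, fun h x => vec3_eta x ▸ h _ _ _⟩

variable [TopologicalSpace M]

theorem IsPointedCover.isOpen_overlap {U : M → Set M} (hU : IsPointedCover U) {k : ℕ}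
    (x : Fin k → M) : IsOpen (overlap U x) := by
  have : overlap U x = ⋂ i, U (x i) := by ext; simp [overlap]
  rw [this]
  exact isOpen_iInter_of_finite fun i => (hU _).1

/-- Pulling back an integer cocycle along a refinement does not change its class. -/
theorem sub_comp_mem_cechCoboundaries {V W : M → Set M} {κ : M → M} (hV : IsPointedCover V)
    (hW : IsPointedCover W) (hWV : ∀ x, W x ⊆ V (κ x)) {z : (Fin 4 → M) → M → ℤ}
    (hz : ∀ x, ContinuousOn (z x) (overlap V x)) (hd : ∀ x, ∀ t ∈ overlap V x, cechD z x t = 0) :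
    (z - fun x => z (κ ∘ x)) ∈ cechCoboundaries M 2 := by
  -- The primitive is the prism operator, the cochain homotopy between the identity and the pullback
  -- by `κ`. It evaluates `z` on `(κ x₀, …, κ xᵢ, xᵢ, …, x₂)` with alternating signs. The cover `W ∩
  -- V` is needed because both `xᵢ` and `κ xᵢ` occur as indices for `V`.
  refine ⟨_, fun x t => z ![κ (x 0), x 0, x 1, x 2] t - z ![κ (x 0), κ (x 1), x 1, x 2] t
    + z ![κ (x 0), κ (x 1), κ (x 2), x 2] t, hW.inter hV, fun x => ?_, forall_vec4.2 ?_⟩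
  · refine (ContinuousOn.sub ?_ ?_).add ?_ <;> refine (hz _).mono fun t ht => ?_
    · exact overlap_vec4 (hWV _ (ht 0).1) (ht 0).2 (ht 1).2 (ht 2).2
    · exact overlap_vec4 (hWV _ (ht 0).1) (hWV _ (ht 1).1) (ht 1).2 (ht 2).2
    · exact overlap_vec4 (hWV _ (ht 0).1) (hWV _ (ht 1).1) (hWV _ (ht 2).1) (ht 2).2
  · intro a b c d t ht
    have ha := ht 0; have hb := ht 1; have hc := ht 2; have hd' := ht 3
    have e1 := hd _ t (overlap_vec5 (hWV _ ha.1) ha.2 hb.2 hc.2 hd'.2)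
    have e2 := hd _ t (overlap_vec5 (hWV _ ha.1) (hWV _ hb.1) hb.2 hc.2 hd'.2)
    have e3 := hd _ t (overlap_vec5 (hWV _ ha.1) (hWV _ hb.1) (hWV _ hc.1) hc.2 hd'.2)
    have e4 := hd _ t (overlap_vec5 (hWV _ ha.1) (hWV _ hb.1) (hWV _ hc.1) (hWV _ hd'.1) hd'.2)
    rw [cechD_apply_five] at e1 e2 e3 e4
    rw [cechD_apply_four]
    have h1 : κ ∘ ![a, b, c, d] = ![κ a, κ b, κ c, κ d] := by ext i; fin_cases i <;> rfl
    simp only [Pi.sub_apply, h1, Matrix.cons_val_zero, Matrix.cons_val_one, Matrix.cons_val]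
    simp only [Matrix.cons_val_zero, Matrix.cons_val_one, Matrix.cons_val] at e1 e2 e3 e4
    linear_combination e1 - e2 + e3 - e4

theorem continuousOn_int_of_real {X : Type*} [TopologicalSpace X] {n : X → ℤ} {r : X → ℝ} {s : Set X}
    (hr : ContinuousOn r s) (h : ∀ t ∈ s, (n t : ℝ) = r t) : ContinuousOn n s := by
  rw [Int.isClosedEmbedding_coe_real.isEmbedding.continuousOn_iff]
  exact hr.congr h

end CechFormulas

/-! ### Refinements of pointed covers -/

section Refinement

variable {EM : Type*} [NormedAddCommGroup EM] [NormedSpace ℝ EM] [FiniteDimensional ℝ EM]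
  {HM : Type*} [TopologicalSpace HM] {M : Type*} [TopologicalSpace M] [ChartedSpace HM M]
  [T2Space M] [SigmaCompactSpace M]

/-- Local data on triple intersections of a cover become global data on the triple intersections of
a refinement. -/
theorem exists_refinement (IM : ModelWithCorners ℝ EM HM) [IsManifold IM ∞ M]
    {U : M → Set M} (hU : IsPointedCover U) (N : M → M → M → M → Set M)
    (hN : ∀ i j k t, t ∈ U i → t ∈ U j → t ∈ U k → N i j k t ∈ 𝓝 t) :
    ∃ (U' : M → Set M) (κ : M → M), IsPointedCover U' ∧ (∀ x, U' x ⊆ U (κ x)) ∧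
      ∀ x y z, (U' x ∩ U' y ∩ U' z).Nonempty →
        x ∈ U (κ x) ∧ x ∈ U (κ y) ∧ x ∈ U (κ z) ∧ U' x ⊆ N (κ x) (κ y) (κ z) x := by
  classical
  obtain ⟨ρ, hρ⟩ := SmoothPartitionOfUnity.exists_isSubordinate IM isClosed_univ U
    (fun x => (hU x).1) (fun x _ => mem_iUnion.2 ⟨x, (hU x).2⟩)
  have hpos : ∀ x, ∃ i, 0 < ρ i x := fun x => ρ.exists_pos_of_mem (mem_univ x)
  choose κ hκ using hpos
  have hfin : ∀ x, {i | x ∈ tsupport (ρ i)}.Finite := fun x =>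
    ρ.locallyFinite.closure.point_finite x
  have hsub : ∀ {i x}, x ∈ tsupport (ρ i) → x ∈ U i := fun {i x} h => hρ i h
  have hκs : ∀ x, x ∈ tsupport (ρ (κ x)) := fun x => subset_tsupport _ (hκ x).ne'
  -- If `A x` and `A w` share a point `t`, then `ρ (κ w)` is nonzero at `t`, while `A x` avoids all
  -- supports that do not contain `x`; so `x` lies in the support of `ρ (κ w)`. Only finitely many
  -- indices `i` have `x` in the support of `ρ i`, so intersecting over these suffices and leaves a
  -- neighbourhood of `x`.
  let A : M → Set M := fun x => Function.support (ρ (κ x)) ∩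
    (⋂ i, ⋂ (_ : x ∉ tsupport (ρ i)), (tsupport (ρ i))ᶜ) ∩
    ⋂ i ∈ {i | x ∈ tsupport (ρ i)}, ⋂ j ∈ {i | x ∈ tsupport (ρ i)}, N (κ x) i j x
  have hA : ∀ x, A x ∈ 𝓝 x := by
    intro x
    refine inter_mem (inter_mem ?_ ?_) ?_
    · exact (isOpen_ne_fun (ρ (κ x)).contMDiff.continuous continuous_const).mem_nhds (hκ x).ne'
    · exact ρ.locallyFinite.closure.iInter_compl_mem_nhds (fun i => isClosed_tsupport _) x
    · refine (biInter_mem (hfin x)).2 fun i hi => (biInter_mem (hfin x)).2 fun j hj => ?_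
      exact hN _ _ _ _ (hsub (hκs x)) (hsub hi) (hsub hj)
  refine ⟨fun x => interior (A x), κ, fun x => ⟨isOpen_interior, mem_interior_iff_mem_nhds.2 (hA x)⟩,
    fun x t ht => hsub (subset_tsupport _ (interior_subset ht).1.1), ?_⟩
  rintro x y z ⟨t, ⟨hx, hy⟩, hz⟩
  have key : ∀ w, t ∈ interior (A w) → x ∈ tsupport (ρ (κ w)) := by
    intro w hw
    by_contra hcon
    have h1 := (interior_subset hx).1.2
    simp only [mem_iInter] at h1
    exact h1 _ hcon (subset_tsupport _ (interior_subset hw).1.1)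
  refine ⟨hsub (hκs x), hsub (key y hy), hsub (key z hz), fun s hs => ?_⟩
  have h2 := (interior_subset hs).2
  simp only [mem_iInter] at h2
  exact h2 _ (key y hy) _ (key z hz)

end Refinement

/-! ### The connecting homomorphism -/

section Connecting

variable {EM : Type*} [NormedAddCommGroup EM] [NormedSpace ℝ EM]
  {HM : Type*} [TopologicalSpace HM] {IM : ModelWithCorners ℝ EM HM}
  {M : Type*} [TopologicalSpace M] [ChartedSpace HM M]

theorem exp_two_pi_int (n : ℤ) : Complex.exp (2 * Real.pi * Complex.I * ((n : ℝ) : ℂ)) = 1 := by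
  rw [Complex.exp_eq_one_iff]
  exact ⟨n, by push_cast; ring⟩

/-- The use of `round` gives integer cochains that are defined everywhere without a choice of
integer at each point. -/
theorem exists_int_of_exp_two_pi {r : ℝ} (h : Complex.exp (2 * Real.pi * Complex.I * r) = 1) :
    ((round r : ℤ) : ℝ) = r := by
  obtain ⟨n, hn⟩ := Complex.exp_eq_one_iff.1 h
  have hpi : (2 * Real.pi * Complex.I : ℂ) ≠ 0 := Complex.two_pi_I_ne_zero
  have h1 : (r : ℂ) = n := by
    apply mul_left_cancel₀ hpi
    rw [hn]; ring
  have h2 : r = n := by exact_mod_cast h1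
  rw [h2, round_intCast]

theorem norm_exp_two_pi (r : ℝ) : ‖Complex.exp (2 * Real.pi * Complex.I * r)‖ = 1 := by
  have : (2 * Real.pi * Complex.I * r : ℂ) = ((2 * Real.pi * r : ℝ) : ℂ) * Complex.I := by
    push_cast; ring
  rw [this, Complex.norm_exp_ofReal_mul_I]

theorem smoothNear_exp {ℓ : M → ℝ} {V : Set M} (hV : IsOpen V)
    (h : ContMDiffOn IM 𝓘(ℝ, ℝ) ∞ ℓ V) {t : M} (ht : t ∈ V) :
    SmoothNear IM id (fun t => Complex.exp (2 * Real.pi * Complex.I * ℓ t)) t := by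
  refine SmoothNear.of_contMDiffOn hV ht ?_
  have h1 : ContDiff ℝ ∞ fun r : ℝ => Complex.exp (2 * Real.pi * Complex.I * r) :=
    (contDiff_const.mul Complex.ofRealCLM.contDiff).cexp
  exact h1.contMDiff.comp_contMDiffOn h

/-- A smooth `U(1)`-valued function has smooth logarithms locally. -/
theorem exists_local_log {f : M → ℂ} {t₀ : M} (hf : ∀ᶠ t in 𝓝 t₀, SmoothNear IM id f t)
    (h1 : ∀ᶠ t in 𝓝 t₀, ‖f t‖ = 1) :
    ∃ (V : Set M) (h : M → ℝ), V ∈ 𝓝 t₀ ∧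
      ∀ t ∈ V, ContMDiffAt IM 𝓘(ℝ, ℝ) ∞ h t ∧ f t = Complex.exp (2 * Real.pi * Complex.I * h t) := by
  have hc : ContinuousAt (fun t => f t / f t₀) t₀ :=
    (hf.self_of_nhds.contMDiffAt.continuousAt).div_const _
  have hn0 : f t₀ ≠ 0 := by
    intro h0
    have := h1.self_of_nhds
    simp [h0] at this
  have hslit : ∀ᶠ t in 𝓝 t₀, f t / f t₀ ∈ Complex.slitPlane := by
    refine hc.preimage_mem_nhds (Complex.isOpen_slitPlane.mem_nhds ?_)
    simp [hn0]
  -- Division by `f t₀` moves the value at `t₀` to `1`, where the principal logarithm is smooth;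
  -- adding `arg (f t₀)` compensates for it.
  refine ⟨{t | SmoothNear IM id f t ∧ ‖f t‖ = 1 ∧ f t / f t₀ ∈ Complex.slitPlane},
    fun t => (2 * Real.pi)⁻¹ * ((Complex.log (f t / f t₀)).im + Complex.arg (f t₀)), ?_, ?_⟩
  · filter_upwards [hf, h1, hslit] with t a b c using ⟨a, b, c⟩
  · rintro t ⟨hs, hu, hsl⟩
    constructor
    · have h2 : ContDiffAt ℝ ∞ (fun w : ℂ => (2 * Real.pi)⁻¹ *
          ((Complex.log (w / f t₀)).im + Complex.arg (f t₀))) (f t) := by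
        have h3 : ContDiffAt ℝ ∞ (fun w : ℂ => Complex.log (w / f t₀)) (f t) := by
          have h4 : ContDiffAt ℝ ∞ Complex.log (f t / f t₀) :=
            (Complex.contDiffAt_log hsl).restrict_scalars ℝ
          exact h4.comp (f t) (contDiffAt_id.div_const _)
        exact contDiffAt_const.mul
          ((Complex.imCLM.contDiff.contDiffAt.comp _ h3).add contDiffAt_const)
      exact h2.contMDiffAt.comp t hs.contMDiffAt
    · have h5 : (2 * Real.pi * Complex.I * (((2 * Real.pi)⁻¹ *
          ((Complex.log (f t / f t₀)).im + Complex.arg (f t₀)) : ℝ) : ℂ) : ℂ) =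
          (Complex.arg (f t / f t₀) : ℂ) * Complex.I + (Complex.arg (f t₀) : ℂ) * Complex.I := by
        have : (Real.pi : ℂ) ≠ 0 := by exact_mod_cast Real.pi_ne_zero
        rw [Complex.log_im]
        push_cast
        field_simp
      have hu0 : ‖f t₀‖ = 1 := h1.self_of_nhds
      have h6 := Complex.norm_mul_exp_arg_mul_I (f t / f t₀)
      have h7 := Complex.norm_mul_exp_arg_mul_I (f t₀)
      rw [norm_div, hu, hu0] at h6
      rw [hu0] at h7
      rw [h5, Complex.exp_add]
      simp only [div_one, Complex.ofReal_one, one_mul] at h6 h7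
      rw [h6, h7]
      field_simp

variable (IM) in
/-- The `U(1)`-valued cochains `g` on `U` and `g'` on `U'` differ, on the cover `W`, by the
coboundary of the `U(1)`-valued cochain `l`. -/
structure IsCohomologousVia (U U' W : M → Set M) (g g' : (Fin 3 → M) → M → ℂ)
    (l : M → M → M → ℂ) : Prop where
  isPointedCover : IsPointedCover W
  subset_left : ∀ x, W x ⊆ U x
  subset_right : ∀ x, W x ⊆ U' x
  norm_eq : ∀ x y, ∀ t ∈ W x ∩ W y, ‖l x y t‖ = 1
  smooth : ∀ x y, ∀ t ∈ W x ∩ W y, SmoothNear IM id (l x y) t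
  eq : ∀ x : Fin 3 → M, ∀ t ∈ overlap W x,
    g x t * l (x 0) (x 2) t = l (x 0) (x 1) t * l (x 1) (x 2) t * g' x t

/-! ### Cohomologous cocycles and their integer classes -/

section Global

variable [FiniteDimensional ℝ EM] [IsManifold IM ∞ M] [T2Space M] [SigmaCompactSpace M]

/-- Cohomologous `U(1)`-valued cocycles have the same image in `H³(M, ℤ)`. -/
theorem IsCohomologousVia.connecting_eq {U U' W : M → Set M} {g g' : (Fin 3 → M) → M → ℂ}
    {l : M → M → M → ℂ} {c c' : CechH3 M} (H : IsCohomologousVia IM U U' W g g' l)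
    (hc : IsConnectingImage IM U g c) (hc' : IsConnectingImage IM U' g' c') : c = c' := by
  obtain ⟨h, z, hh, hgh, hzh, rfl⟩ := hc
  obtain ⟨h', z', hh', hgh', hzh', rfl⟩ := hc'
  obtain ⟨V, hV, hVz, hVd⟩ := z.2
  obtain ⟨V', hV', hVz', hVd'⟩ := z'.2
  have hlog : ∀ i j t, t ∈ W i ∩ W j → ∃ (A : Set M) (m : M → ℝ), A ∈ 𝓝 t ∧
      ∀ s ∈ A, ContMDiffAt IM 𝓘(ℝ, ℝ) ∞ m s ∧
        l i j s = Complex.exp (2 * Real.pi * Complex.I * m s) := by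
    intro i j t ht
    have hn : W i ∩ W j ∈ 𝓝 t :=
      ((H.isPointedCover i).1.inter (H.isPointedCover j).1).mem_nhds ht
    exact exists_local_log (by filter_upwards [hn] with s hs using H.smooth i j s hs)
      (by filter_upwards [hn] with s hs using H.norm_eq i j s hs)
  choose! A m hA hm using hlog
  obtain ⟨W', κ, hW', hsub, hW'A⟩ := exists_refinement IM
    ((H.isPointedCover.inter hV).inter hV') (fun i j _ t => A i j t)
    (fun i j k t hi hj _ => hA i j t ⟨hi.1.1, hj.1.1⟩)
  -- The logarithm of `l` chosen near the point `x` serves the whole overlap, since the refinement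
  -- puts `W' x` inside its domain.
  let ℓ : M → M → M → ℝ := fun x y => m (κ x) (κ y) x
  have hℓ : ∀ x y t, t ∈ W' x → t ∈ W' y → ContMDiffAt IM 𝓘(ℝ, ℝ) ∞ (ℓ x y) t ∧
      l (κ x) (κ y) t = Complex.exp (2 * Real.pi * Complex.I * ℓ x y t) := by
    intro x y t hx hy
    have h1 := hW'A x y y ⟨t, ⟨hx, hy⟩, hy⟩
    exact hm _ _ _ ⟨h1.1.1.1, h1.2.1.1.1⟩ t (h1.2.2.2 hx)
  -- This is `h - h' - δℓ`. The relation between `g`, `g'` and `l` makes its exponential `1`, so it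
  -- takes integer values, and its coboundary is `δh - δh'`, that is, `z - z'` pulled back by `κ`.
  let r : (Fin 3 → M) → M → ℝ := fun x t =>
    h (κ ∘ x) t - h' (κ ∘ x) t + (ℓ (x 0) (x 2) t - ℓ (x 0) (x 1) t - ℓ (x 1) (x 2) t)
  have hoW : ∀ {k : ℕ} {x : Fin k → M} {t}, t ∈ overlap W' x → t ∈ overlap W (κ ∘ x) :=
    fun ht i => (hsub _ (ht i)).1.1
  have hoU : ∀ {k : ℕ} {x : Fin k → M} {t}, t ∈ overlap W' x → t ∈ overlap U (κ ∘ x) :=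
    fun ht i => H.subset_left _ (hoW ht i)
  have hoU' : ∀ {k : ℕ} {x : Fin k → M} {t}, t ∈ overlap W' x → t ∈ overlap U' (κ ∘ x) :=
    fun ht i => H.subset_right _ (hoW ht i)
  have hrc : ∀ x, ContinuousOn (r x) (overlap W' x) := by
    intro x
    have hl : ∀ i j, ContinuousOn (ℓ (x i) (x j)) (overlap W' x) := fun i j t ht =>
      ((hℓ _ _ t (ht i) (ht j)).1.continuousAt).continuousWithinAt
    exact (((hh _).continuousOn.mono fun t ht => hoU ht).sub
      ((hh' _).continuousOn.mono fun t ht => hoU' ht)).add (((hl 0 2).sub (hl 0 1)).sub (hl 1 2))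
  have hrz : ∀ x, ∀ t ∈ overlap W' x, ((round (r x t) : ℤ) : ℝ) = r x t := by
    intro x t ht
    apply exists_int_of_exp_two_pi
    have e := H.eq (κ ∘ x) t (hoW ht)
    rw [hgh _ t (hoU ht), hgh' _ t (hoU' ht)] at e
    simp only [Function.comp_apply] at e
    rw [(hℓ _ _ t (ht 0) (ht 2)).2, (hℓ _ _ t (ht 0) (ht 1)).2, (hℓ _ _ t (ht 1) (ht 2)).2,
      ← Complex.exp_add, ← Complex.exp_add, ← Complex.exp_add] at e
    have : (2 * Real.pi * Complex.I * r x t : ℂ) =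
        (2 * Real.pi * Complex.I * h (κ ∘ x) t + 2 * Real.pi * Complex.I * ℓ (x 0) (x 2) t) -
        (2 * Real.pi * Complex.I * ℓ (x 0) (x 1) t + 2 * Real.pi * Complex.I * ℓ (x 1) (x 2) t +
          2 * Real.pi * Complex.I * h' (κ ∘ x) t) := by
      simp only [r]; push_cast; ring
    rw [this, Complex.exp_sub, e, div_self (Complex.exp_ne_zero _)]
  have hcob : ((fun x => z.1 (κ ∘ x)) - fun x => z'.1 (κ ∘ x)) ∈ cechCoboundaries M 2 := by
    refine ⟨W', fun x t => round (r x t), hW', fun x => continuousOn_int_of_real (hrc x) (hrz x),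
      forall_vec4.2 fun a b d e t ht => ?_⟩
    have h1 : κ ∘ ![a, b, d, e] = ![κ a, κ b, κ d, κ e] := by ext i; fin_cases i <;> rfl
    have h3 : ∀ a b d, κ ∘ ![a, b, d] = ![κ a, κ b, κ d] := by
      intro a b d; ext i; fin_cases i <;> rfl
    have ha : t ∈ W' a := ht 0
    have hb : t ∈ W' b := ht 1
    have hd : t ∈ W' d := ht 2
    have he : t ∈ W' e := ht 3
    have e1 := hzh _ t (hoU ht)
    have e2 := hzh' _ t (hoU' ht)
    rw [h1, cechD_apply_four] at e1 e2
    have : (((z.1 ![κ a, κ b, κ d, κ e] t - z'.1 ![κ a, κ b, κ d, κ e] t : ℤ)) : ℝ) =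
        ((cechD (fun x t => round (r x t)) ![a, b, d, e] t : ℤ) : ℝ) := by
      rw [cechD_cast, cechD_apply_four, hrz _ t (overlap_vec3 hb hd he),
        hrz _ t (overlap_vec3 ha hd he), hrz _ t (overlap_vec3 ha hb he),
        hrz _ t (overlap_vec3 ha hb hd)]
      push_cast
      rw [e1, e2]
      simp only [r, h3, Matrix.cons_val_zero, Matrix.cons_val_one, Matrix.cons_val]
      ring
    simp only [Pi.sub_apply, h1]
    exact_mod_cast this
  -- So far only the pullbacks of `z` and `z'` by `κ` are compared; each differs from the original
  -- by a coboundary.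
  have h1 := sub_comp_mem_cechCoboundaries (κ := κ) hV hW' (fun x t ht => (hsub x ht).1.2) hVz hVd
  have h2 := sub_comp_mem_cechCoboundaries (κ := κ) hV' hW' (fun x t ht => (hsub x ht).2) hVz' hVd'
  rw [QuotientAddGroup.eq_iff_sub_mem, AddSubgroup.mem_addSubgroupOf]
  have := (cechCoboundaries M 2).add_mem hcob ((cechCoboundaries M 2).sub_mem h1 h2)
  convert this using 1
  push_cast
  abel

/-- `U(1)`-valued cocycles with the same image in `H³(M, ℤ)` are cohomologous. -/
theorem exists_isCohomologousVia {U U' : M → Set M} {g g' : (Fin 3 → M) → M → ℂ}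
    {c : CechH3 M} (hU : IsPointedCover U) (hU' : IsPointedCover U')
    (hc : IsConnectingImage IM U g c) (hc' : IsConnectingImage IM U' g' c) :
    ∃ W l, IsCohomologousVia IM U U' W g g' l := by
  obtain ⟨h, z, hh, hgh, hzh, rfl⟩ := hc
  obtain ⟨h', z', hh', hgh', hzh', hzz⟩ := hc'
  rw [QuotientAddGroup.eq_iff_sub_mem, AddSubgroup.mem_addSubgroupOf] at hzz
  obtain ⟨V, b, hV, hb, hbz⟩ := hzz
  have hW : IsPointedCover fun x => U x ∩ U' x ∩ V x := (hU.inter hU').inter hV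
  set W : M → Set M := fun x => U x ∩ U' x ∩ V x with hWdef
  have hoU : ∀ {k : ℕ} {x : Fin k → M} {t}, t ∈ overlap W x → t ∈ overlap U x :=
    fun ht i => (ht i).1.1
  have hoU' : ∀ {k : ℕ} {x : Fin k → M} {t}, t ∈ overlap W x → t ∈ overlap U' x :=
    fun ht i => (ht i).1.2
  have hoV : ∀ {k : ℕ} {x : Fin k → M} {t}, t ∈ overlap W x → t ∈ overlap V x :=
    fun ht i => (ht i).2
  -- As `z' - z = δb`, the sum `h - h' + b` is a smooth real cocycle. The integers `b` disappear
  -- again after exponentiation.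
  let f : (Fin 3 → M) → M → ℝ := fun x t => h x t - h' x t + b x t
  have hf : ∀ x, ∀ t ∈ overlap W x, ContMDiffAt IM 𝓘(ℝ, ℝ) ∞ (f x) t := by
    intro x t ht
    refine (((hh x).contMDiffAt ((hU.isOpen_overlap x).mem_nhds (hoU ht))).sub
      ((hh' x).contMDiffAt ((hU'.isOpen_overlap x).mem_nhds (hoU' ht)))).add ?_
    have h1 : ContinuousAt (b x) t :=
      (hb x).continuousAt ((hV.isOpen_overlap x).mem_nhds (hoV ht))
    refine contMDiffAt_const (c := (b x t : ℝ)) |>.congr_of_eventuallyEq ?_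
    have h2 : ∀ᶠ s in 𝓝 t, b x s = b x t :=
      h1.tendsto.eventually ((isOpen_discrete {b x t}).mem_nhds rfl)
    filter_upwards [h2] with s hs
    rw [hs]
  have hfd : ∀ a x y w t, t ∈ W a → t ∈ W x → t ∈ W y → t ∈ W w →
      f ![x, y, w] t = f ![a, y, w] t - f ![a, x, w] t + f ![a, x, y] t := by
    intro a x y w t ha hx hy hw
    have ht : t ∈ overlap W ![a, x, y, w] := overlap_vec4 ha hx hy hw
    have e1 := hzh _ t (hoU ht)
    have e2 := hzh' _ t (hoU' ht)
    have e3 := hbz _ t (hoV ht)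
    have e4 : ((z'.1 ![a, x, y, w] t : ℤ) : ℝ) - (z.1 ![a, x, y, w] t : ℝ) =
        ((cechD b ![a, x, y, w] t : ℤ) : ℝ) := by
      rw [← e3]; simp
    rw [cechD_cast, cechD_apply_four] at e4
    rw [cechD_apply_four] at e1 e2
    simp only [f]
    linear_combination e2 - e1 - e4
  obtain ⟨ρ, hρ⟩ := SmoothPartitionOfUnity.exists_isSubordinate IM isClosed_univ W
    (fun x => (hW x).1) (fun x _ => mem_iUnion.2 ⟨x, (hW x).2⟩)
  -- The standard contraction `ℓ_xy = ∑ ρ_a f_axy` solves `δℓ = f`: average the cocycle identity for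
  -- `(a, x, y, w)` over `a` and use that the `ρ_a` sum to `1`.
  let ℓ : M → M → M → ℝ := fun x y t => ∑ᶠ a, ρ a t • f ![a, x, y] t
  have hℓ : ∀ x y, ∀ t ∈ W x ∩ W y, ContMDiffAt IM 𝓘(ℝ, ℝ) ∞ (ℓ x y) t := by
    intro x y t ht
    refine ρ.contMDiffAt_finsum fun a ha => hf _ t (overlap_vec3 (hρ a ha) ht.1 ht.2)
  have hℓd : ∀ x y w t, t ∈ W x → t ∈ W y → t ∈ W w →
      f ![x, y, w] t = ℓ y w t - ℓ x w t + ℓ x y t := by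
    intro x y w t hx hy hw
    have hfs : ∀ u : M → ℝ, (Function.support fun a => ρ a t • u a).Finite := fun u =>
      (ρ.locallyFinite.point_finite t).subset fun a ha => by
        simp only [Function.mem_support, smul_eq_mul] at ha
        exact left_ne_zero_of_mul ha
    have h1 : f ![x, y, w] t = ∑ᶠ a, ρ a t • f ![x, y, w] t := by
      rw [← finsum_smul, ρ.sum_eq_one (mem_univ t), one_smul]
    rw [h1]
    simp only [ℓ]
    rw [← finsum_sub_distrib (hfs _) (hfs _), ← finsum_add_distrib _ (hfs _)]
    · refine finsum_congr fun a => ?_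
      by_cases ha : ρ a t = 0
      · simp [ha]
      · rw [hfd a x y w t (hρ a (subset_tsupport _ ha)) hx hy hw]
        simp only [smul_eq_mul]
        ring
    · refine ((hfs fun a => f ![a, y, w] t).union (hfs fun a => f ![a, x, w] t)).subset ?_
      exact Function.support_sub _ _
  refine ⟨W, fun x y t => Complex.exp (2 * Real.pi * Complex.I * ℓ x y t), hW,
    fun x t ht => ht.1.1, fun x t ht => ht.1.2, fun x y t _ => norm_exp_two_pi _, fun x y t ht => ?_,
    forall_vec3.2 fun x y w t ht => ?_⟩
  · exact smoothNear_exp ((hW x).1.inter (hW y).1)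
      (fun s hs => (hℓ x y s hs).contMDiffWithinAt) ht
  · simp only [Matrix.cons_val_zero, Matrix.cons_val_one, Matrix.cons_val]
    rw [hgh _ t (hoU ht), hgh' _ t (hoU' ht), ← Complex.exp_add, ← Complex.exp_add,
      ← Complex.exp_add]
    have e := hℓd x y w t (ht 0) (ht 1) (ht 2)
    have e' : (h ![x, y, w] t : ℂ) = h' ![x, y, w] t + ℓ y w t - ℓ x w t + ℓ x y t
        - ((b ![x, y, w] t : ℝ) : ℂ) := by
      have : h ![x, y, w] t = h' ![x, y, w] t + ℓ y w t - ℓ x w t + ℓ x y t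
        - (b ![x, y, w] t : ℝ) := by
        simp only [f] at e
        linear_combination e
      rw [this]; push_cast; ring
    rw [e', ← mul_one (Complex.exp (2 * Real.pi * Complex.I * ℓ x y t + _ + _)),
      ← exp_two_pi_int (-(b ![x, y, w] t)), ← Complex.exp_add]
    congr 1
    push_cast
    ring

/-- After a refinement, a smooth `U(1)`-valued 2-cocycle has an image in `H³(M, ℤ)`. -/
theorem exists_isConnectingImage {U : M → Set M} {g : (Fin 3 → M) → M → ℂ} (hU : IsPointedCover U)
    (hg : ∀ x, ∀ t ∈ overlap U x, ‖g x t‖ = 1)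
    (hgs : ∀ x, ∀ t ∈ overlap U x, SmoothNear IM id (g x) t)
    (hgd : ∀ a x y w t, t ∈ U a → t ∈ U x → t ∈ U y → t ∈ U w →
      g ![a, x, y] t * g ![a, y, w] t = g ![x, y, w] t * g ![a, x, w] t) :
    ∃ (U' : M → Set M) (κ : M → M) (c : CechH3 M), IsPointedCover U' ∧ (∀ x, U' x ⊆ U (κ x)) ∧
      IsConnectingImage IM U' (fun x => g (κ ∘ x)) c := by
  have hlog : ∀ i j k t, t ∈ overlap U ![i, j, k] → ∃ (A : Set M) (m : M → ℝ), A ∈ 𝓝 t ∧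
      ∀ s ∈ A, ContMDiffAt IM 𝓘(ℝ, ℝ) ∞ m s ∧
        g ![i, j, k] s = Complex.exp (2 * Real.pi * Complex.I * m s) := by
    intro i j k t ht
    have hn := (hU.isOpen_overlap ![i, j, k]).mem_nhds ht
    exact exists_local_log (by filter_upwards [hn] with s hs using hgs _ s hs)
      (by filter_upwards [hn] with s hs using hg _ s hs)
  choose! A m hA hm using hlog
  obtain ⟨W', κ, hW', hsub, hW'A⟩ := exists_refinement IM hU A
    (fun i j k t hi hj hk => hA i j k t (overlap_vec3 hi hj hk))
  -- The logarithm is the one found near the point that indexes the first set of the overlap; the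
  -- refinement ensures that the overlap lies in its domain.
  let h : (Fin 3 → M) → M → ℝ := fun x => m (κ (x 0)) (κ (x 1)) (κ (x 2)) (x 0)
  have hh : ∀ x, ∀ t ∈ overlap W' x, ContMDiffAt IM 𝓘(ℝ, ℝ) ∞ (h x) t ∧
      g (κ ∘ x) t = Complex.exp (2 * Real.pi * Complex.I * h x t) := by
    refine forall_vec3.2 fun x y w t ht => ?_
    have h1 := hW'A x y w ⟨t, ⟨ht 0, ht 1⟩, ht 2⟩
    have h3 : κ ∘ ![x, y, w] = ![κ x, κ y, κ w] := by ext i; fin_cases i <;> rfl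
    rw [h3]
    exact hm _ _ _ _ (overlap_vec3 h1.1 h1.2.1 h1.2.2.1) t (h1.2.2.2 (ht 0))
  have hr : ∀ x, ∀ t ∈ overlap W' x, ((round (cechD h x t) : ℤ) : ℝ) = cechD h x t := by
    refine forall_vec4.2 fun a x y w t ht => ?_
    have ha : t ∈ W' a := ht 0
    have hx : t ∈ W' x := ht 1
    have hy : t ∈ W' y := ht 2
    have hw : t ∈ W' w := ht 3
    apply exists_int_of_exp_two_pi
    rw [cechD_apply_four]
    have e := hgd (κ a) (κ x) (κ y) (κ w) t (hsub _ ha) (hsub _ hx) (hsub _ hy) (hsub _ hw)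
    have h3 : ∀ x y w, ![κ x, κ y, κ w] = κ ∘ ![x, y, w] := by
      intro x y w; ext i; fin_cases i <;> rfl
    simp only [h3] at e
    rw [(hh _ t (overlap_vec3 ha hx hy)).2, (hh _ t (overlap_vec3 ha hy hw)).2,
      (hh _ t (overlap_vec3 hx hy hw)).2, (hh _ t (overlap_vec3 ha hx hw)).2,
      ← Complex.exp_add, ← Complex.exp_add] at e
    have : (2 * Real.pi * Complex.I * ((h ![x, y, w] t - h ![a, y, w] t + h ![a, x, w] t -
        h ![a, x, y] t : ℝ) : ℂ) : ℂ) = (2 * Real.pi * Complex.I * h ![x, y, w] t +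
        2 * Real.pi * Complex.I * h ![a, x, w] t) - (2 * Real.pi * Complex.I * h ![a, x, y] t +
        2 * Real.pi * Complex.I * h ![a, y, w] t) := by
      push_cast; ring
    rw [this, Complex.exp_sub, e, div_self (Complex.exp_ne_zero _)]
  -- `δh` is continuous with integer values, hence locally constant, and `δδh = 0`.
  have hz : (fun x t => round (cechD h x t)) ∈ cechCocycles M 3 := by
    refine ⟨W', hW', fun x => continuousOn_int_of_real ?_ (hr x), fun x t ht => ?_⟩
    · rw [← vec4_eta x]
      intro t ht
      have hc : ∀ y, t ∈ overlap W' y → ContinuousAt (h y) t := fun y hy =>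
        (hh y t hy).1.continuousAt
      have : cechD h ![x 0, x 1, x 2, x 3] = fun t => h ![x 1, x 2, x 3] t - h ![x 0, x 2, x 3] t +
          h ![x 0, x 1, x 3] t - h ![x 0, x 1, x 2] t := funext fun t => cechD_apply_four _ _ _ _ _ _
      rw [this]
      exact ((((hc _ (overlap_vec3 (ht 1) (ht 2) (ht 3))).sub
        (hc _ (overlap_vec3 (ht 0) (ht 2) (ht 3)))).add
        (hc _ (overlap_vec3 (ht 0) (ht 1) (ht 3)))).sub
        (hc _ (overlap_vec3 (ht 0) (ht 1) (ht 2)))).continuousWithinAt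
    · have hx : x = ![x 0, x 1, x 2, x 3, x 4] := by ext i; fin_cases i <;> rfl
      have h0 := ht 0; have h1 := ht 1; have h2 := ht 2; have h3 := ht 3; have h4 := ht 4
      rw [hx]
      have : ((cechD (fun x t => round (cechD h x t)) ![x 0, x 1, x 2, x 3, x 4] t : ℤ) : ℝ) =
          0 := by
        rw [cechD_cast, cechD_apply_five, hr _ t (overlap_vec4 h1 h2 h3 h4),
          hr _ t (overlap_vec4 h0 h2 h3 h4), hr _ t (overlap_vec4 h0 h1 h3 h4),
          hr _ t (overlap_vec4 h0 h1 h2 h4), hr _ t (overlap_vec4 h0 h1 h2 h3)]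
        simp only [cechD_apply_four]
        ring
      exact_mod_cast this
  exact ⟨W', κ, QuotientAddGroup.mk ⟨_, hz⟩, hW', hsub, h, ⟨_, hz⟩,
    fun x t ht => (hh x t ht).1.contMDiffWithinAt, fun x t ht => (hh x t ht).2, hr, rfl⟩

end Global

end Connecting

/-! ### Smooth calculus on bundle gerbes -/

section Gerbe

variable {EM : Type*} [NormedAddCommGroup EM] [NormedSpace ℝ EM] {HM : Type*} [TopologicalSpace HM]
  {IM : ModelWithCorners ℝ EM HM} {M : Type*} [TopologicalSpace M] [ChartedSpace HM M]
  {EY : Type*} [NormedAddCommGroup EY] [NormedSpace ℝ EY] {HY : Type*} [TopologicalSpace HY]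
  {IY : ModelWithCorners ℝ EY HY} {Y : Type*} [TopologicalSpace Y] [ChartedSpace HY Y]
  {π : Y → M}
  {E' : Type*} [NormedAddCommGroup E'] [NormedSpace ℝ E'] {H' : Type*} [TopologicalSpace H']
  {I' : ModelWithCorners ℝ E' H'} {N' : Type*} [TopologicalSpace N'] [ChartedSpace H' N']
  {B : Type*} [TopologicalSpace B] {inc : B → N'}

theorem SmoothMapNear.ypair {φ₁ φ₂ : B → Y} {b : B} (h₁ : SmoothMapNear I' inc IY id φ₁ b)
    (h₂ : SmoothMapNear I' inc IY id φ₂ b) (h : ∀ x, π (φ₁ x) = π (φ₂ x)) :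
    SmoothMapNear I' inc (IY.prod IY) (Subtype.val : FibreProd2 π → Y × Y)
      (fun x => _root_.ypair (h x)) b :=
  SmoothMapNear.prodMk IsInducing.subtypeVal h₁ h₂ continuous_id continuous_id fun _ => rfl

theorem SmoothMapNear.ytriple {φ₁ φ₂ φ₃ : B → Y} {b : B} (h₁ : SmoothMapNear I' inc IY id φ₁ b)
    (h₂ : SmoothMapNear I' inc IY id φ₂ b) (h₃ : SmoothMapNear I' inc IY id φ₃ b)
    (h : ∀ x, π (φ₁ x) = π (φ₂ x)) (h' : ∀ x, π (φ₂ x) = π (φ₃ x)) :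
    SmoothMapNear I' inc (IY.prod (IY.prod IY)) (Subtype.val : FibreProd3 π → Y × Y × Y)
      (fun x => ⟨(φ₁ x, φ₂ x, φ₃ x), h x, h' x⟩) b :=
  SmoothMapNear.prodMk (inc'' := (id : Y × Y → Y × Y)) (ψ := fun x => (φ₂ x, φ₃ x))
    IsInducing.subtypeVal h₁
    (SmoothMapNear.prodMk (ι := (id : Y × Y → Y × Y)) IsInducing.id h₂ h₃ continuous_id
      continuous_id fun _ => rfl)
    continuous_id continuous_id fun _ => rfl

theorem SmoothMapNear.id_id {E : Type*} [NormedAddCommGroup E] [NormedSpace ℝ E] {H : Type*}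
    [TopologicalSpace H] {I : ModelWithCorners ℝ E H} {N : Type*} [TopologicalSpace N]
    [ChartedSpace H N] (b : N) : SmoothMapNear I (id : N → N) I id (fun x => x) b :=
  SmoothMapNear.of_contMDiffOn isOpen_univ contMDiff_id.contMDiffOn (mem_univ _)

theorem IsLocallySplit.smoothMapNear (hπ : IsLocallySplit IM IY π) (y : Y) :
    SmoothMapNear IY id IM id π y :=
  SmoothMapNear.of_contMDiffOn isOpen_univ hπ.1.contMDiffOn (mem_univ _)

/-- A locally split map has sections that are smooth near any given point. -/
theorem IsLocallySplit.exists_sections (hπ : IsLocallySplit IM IY π) :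
    ∃ (s : M → M → Y) (U : M → Set M), (∀ x t, π (s x t) = t) ∧ IsPointedCover U ∧
      ∀ x, ContMDiffOn IM IY ∞ (s x) (U x) := by
  classical
  choose U s hU hx hs hsec using hπ.2
  -- Outside `U x` the value at `t` of the section around `t` itself is used, so that `s x` is a
  -- set-theoretic section on all of `M`; smoothness is claimed only on `U x`.
  refine ⟨fun x t => if t ∈ U x then s x t else s t t, U, fun x t => ?_, fun x => ⟨hU x, hx x⟩,
    fun x => (hs x).congr fun t ht => if_pos ht⟩
  by_cases h : t ∈ U x
  · simp only [h, if_true]; exact hsec x t h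
  · simp only [h, if_false]; exact hsec t t (hx t)

namespace BundleGerbe

variable (G : BundleGerbe IM IY π)

theorem finrank_L (q : FibreProd2 π) : Module.finrank ℂ (G.L.Fiber q) = 1 :=
  G.L.finrank_of_isLine G.line q

/-- The unit vector of the local frame of `L` around `q₀`. -/
def unitFrame (q₀ q : FibreProd2 π) : G.L.Fiber q :=
  G.L.frame q₀ ⟨0, by rw [G.line q₀]; exact one_pos⟩ q

theorem norm_unitFrame {q₀ q : FibreProd2 π} (h : q ∈ G.L.dom q₀) : ‖G.unitFrame q₀ q‖ = 1 :=
  (G.L.isONB h).norm_eq _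

theorem exists_norm_eq_one (q : FibreProd2 π) : ∃ a : G.L.Fiber q, ‖a‖ = 1 :=
  ⟨_, G.norm_unitFrame (G.L.mem_dom q)⟩

variable {G}

/-- The product of the bundle gerbe. -/
noncomputable def prod {y₁ y₂ y₃ : Y} {h₁₂ : π y₁ = π y₂} {h₂₃ : π y₂ = π y₃}
    (a : G.L.Fiber (ypair h₁₂)) (b : G.L.Fiber (ypair h₂₃)) :
    G.L.Fiber (ypair (h₁₂.trans h₂₃)) :=
  G.mul h₁₂ h₂₃ (a ⊗ₜ b)

section Prod

variable {y₁ y₂ y₃ y₄ : Y} {h₁₂ : π y₁ = π y₂} {h₂₃ : π y₂ = π y₃} {h₃₄ : π y₃ = π y₄}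
  (a : G.L.Fiber (ypair h₁₂)) (b : G.L.Fiber (ypair h₂₃)) (c : G.L.Fiber (ypair h₃₄))

theorem norm_prod : ‖prod a b‖ = ‖a‖ * ‖b‖ := by
  rw [prod, LinearIsometryEquiv.norm_map, TensorProduct.norm_tmul]

theorem prod_smul_left (z : ℂ) : prod (z • a) b = z • prod a b := by
  rw [prod, ← TensorProduct.smul_tmul', map_smul]; rfl

theorem prod_smul_right (z : ℂ) : prod a (z • b) = z • prod a b := by
  rw [prod, TensorProduct.tmul_smul, map_smul]; rfl

theorem prod_assoc : prod (prod a b) c = prod a (prod b c) := G.mul_assoc h₁₂ h₂₃ h₃₄ a b c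

end Prod

theorem prod_smooth {φ₁ φ₂ φ₃ : B → Y} {b : B} (hφ₁ : SmoothMapNear I' inc IY id φ₁ b)
    (hφ₂ : SmoothMapNear I' inc IY id φ₂ b) (hφ₃ : SmoothMapNear I' inc IY id φ₃ b)
    {h₁₂ : ∀ x, π (φ₁ x) = π (φ₂ x)} {h₂₃ : ∀ x, π (φ₂ x) = π (φ₃ x)}
    {σ : ∀ x, G.L.Fiber (ypair (h₁₂ x))} {τ : ∀ x, G.L.Fiber (ypair (h₂₃ x))}
    (hσ : G.L.SmoothSectionNear I' inc (fun x => ypair (h₁₂ x)) σ b)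
    (hτ : G.L.SmoothSectionNear I' inc (fun x => ypair (h₂₃ x)) τ b) :
    G.L.SmoothSectionNear I' inc (fun x => ypair ((h₁₂ x).trans (h₂₃ x)))
      (fun x => prod (σ x) (τ x)) b := by
  refine SmoothSec.tmul (e := fun i x => G.L.frame (ypair (h₁₂ b)) i (ypair (h₁₂ x)))
    (e' := fun i x => G.L.frame (ypair (h₂₃ b)) i (ypair (h₂₃ x)))
    (e'' := fun i x => G.L.frame (ypair ((h₁₂ b).trans (h₂₃ b))) i
      (ypair ((h₁₂ x).trans (h₂₃ x)))) hσ hτ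
    (G.L.eventually_isONB (hφ₁.ypair hφ₂ h₁₂).1 (G.L.mem_dom _))
    (G.L.eventually_isONB (hφ₂.ypair hφ₃ h₂₃).1 (G.L.mem_dom _))
    (fun x => (G.mul (h₁₂ x) (h₂₃ x)).toLinearEquiv.toLinearMap) fun i j => ?_
  exact fun k => (G.smooth_mul ⟨(φ₁ b, φ₂ b, φ₃ b), h₁₂ b, h₂₃ b⟩ i j k).comp
    (hφ₁.ytriple hφ₂ hφ₃ h₁₂ h₂₃)

theorem unitFrame_smooth {f : B → FibreProd2 π} {b : B} {q₀ : FibreProd2 π}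
    (hf : SmoothMapNear I' inc (IY.prod IY) Subtype.val f b) (h : f b ∈ G.L.dom q₀) :
    G.L.SmoothSectionNear I' inc f (fun x => G.unitFrame q₀ (f x)) b :=
  HermitianBundle.smoothSectionNear_frame hf h _

/-! ### The Dixmier–Douady class of a bundle gerbe -/

variable (G) in
/-- Local unit sections, not yet adapted to logarithms, for a family of local sections of `π`. -/
theorem exists_unit_sections [FiniteDimensional ℝ EM] [IsManifold IM ∞ M] [T2Space M]
    [SigmaCompactSpace M] :
    ∃ (U : M → Set M) (s : M → M → Y) (hs : ∀ x t, π (s x t) = t)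
      (σ : ∀ x y t, G.L.Fiber (ypair ((hs x t).trans (hs y t).symm))),
      IsPointedCover U ∧ (∀ x, ContMDiffOn IM IY ∞ (s x) (U x)) ∧
      (∀ x y, ∀ t ∈ U x ∩ U y, ‖σ x y t‖ = 1) ∧
      (∀ x y, ∀ t ∈ U x ∩ U y, G.L.SmoothSectionNear IM (id : M → M)
        (fun t' => ypair ((hs x t').trans (hs y t').symm)) (σ x y) t) := by
  obtain ⟨s, U, hs, hU, hsU⟩ := G.locallySplit.exists_sections
  have hsm : ∀ i t, t ∈ U i → SmoothMapNear IM id IY id (s i) t := fun i t ht =>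
    SmoothMapNear.of_contMDiffOn (hU i).1 (hsU i) ht
  let p : M → M → M → FibreProd2 π := fun i j t => ypair ((hs i t).trans (hs j t).symm)
  have hp : ∀ i j t, t ∈ U i → t ∈ U j →
      SmoothMapNear IM id (IY.prod IY) Subtype.val (p i j) t := fun i j t hi hj =>
    (hsm i t hi).ypair (hsm j t hj) fun t => (hs i t).trans (hs j t).symm
  -- A frame of `L` around one point of `Y^{[2]}` need not cover the image of a whole overlap. After
  -- this refinement the frame chosen at the point `x` covers all of `U' x ∩ U' y`.
  obtain ⟨U', κ, hU', hsub, hN⟩ := exists_refinement IM hU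
    (fun i j _ t => {t' | p i j t' ∈ G.L.dom (p i j t)}) (fun i j k t hi hj _ =>
      (hp i j t hi hj).1.preimage_mem_nhds ((G.L.isOpen_dom _).mem_nhds (G.L.mem_dom _)))
  refine ⟨U', fun x => s (κ x), fun x => hs (κ x),
    fun x y t => G.unitFrame (p (κ x) (κ y) x) (p (κ x) (κ y) t), hU',
    fun x => (hsU _).mono (hsub x), fun x y t ht => ?_, fun x y t ht => ?_⟩
  · exact G.norm_unitFrame ((hN x y y ⟨t, ht, ht.2⟩).2.2.2 ht.1)
  · exact unitFrame_smooth (hp _ _ t (hsub _ ht.1) (hsub _ ht.2))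
      ((hN x y y ⟨t, ht, ht.2⟩).2.2.2 ht.1)

variable [FiniteDimensional ℝ EM] [IsManifold IM ∞ M] [T2Space M] [SigmaCompactSpace M]

variable (G) in
-- `L` has rank one, so the product of two unit sections is a phase `g` times the third.
-- Associativity applied to three of them gives the cocycle identity, and a further refinement
-- provides logarithms of `g`.
theorem exists_represents : ∃ c, G.Represents c := by
  obtain ⟨U, s, hs, σ, hU, hsU, hσ, hσs⟩ := G.exists_unit_sections
  have hsm : ∀ i t, t ∈ U i → SmoothMapNear IM id IY id (s i) t := fun i t ht =>
    SmoothMapNear.of_contMDiffOn (hU i).1 (hsU i) ht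
  let g : (Fin 3 → M) → M → ℂ := fun x t =>
    ⟪σ (x 0) (x 2) t, prod (σ (x 0) (x 1) t) (σ (x 1) (x 2) t)⟫_ℂ
  have hg : ∀ x, ∀ t ∈ overlap U x, prod (σ (x 0) (x 1) t) (σ (x 1) (x 2) t) =
      g x t • σ (x 0) (x 2) t := fun x t ht =>
    eq_inner_smul (G.finrank_L _) (hσ _ _ t ⟨ht 0, ht 2⟩) _
  have hgd : ∀ a x y w t, t ∈ U a → t ∈ U x → t ∈ U y → t ∈ U w →
      g ![a, x, y] t * g ![a, y, w] t = g ![x, y, w] t * g ![a, x, w] t := by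
    intro a x y w t ha hx hy hw
    have e1 : prod (σ a x t) (σ x y t) = g ![a, x, y] t • σ a y t :=
      hg ![a, x, y] t (overlap_vec3 ha hx hy)
    have e2 : prod (σ a y t) (σ y w t) = g ![a, y, w] t • σ a w t :=
      hg ![a, y, w] t (overlap_vec3 ha hy hw)
    have e3 : prod (σ x y t) (σ y w t) = g ![x, y, w] t • σ x w t :=
      hg ![x, y, w] t (overlap_vec3 hx hy hw)
    have e4 : prod (σ a x t) (σ x w t) = g ![a, x, w] t • σ a w t :=
      hg ![a, x, w] t (overlap_vec3 ha hx hw)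
    have e5 := prod_assoc (σ a x t) (σ x y t) (σ y w t)
    rw [e1, prod_smul_left, e2, e3, prod_smul_right, e4, smul_smul, smul_smul] at e5
    have hne : σ a w t ≠ 0 := by
      intro h0
      have := hσ a w t ⟨ha, hw⟩
      simp [h0] at this
    exact smul_left_injective _ hne e5
  obtain ⟨U', κ, c, hU', hsub, hc⟩ := exists_isConnectingImage (IM := IM) (g := g) hU
    (fun x t ht => norm_inner_eq_one (G.finrank_L _) (hσ _ _ t ⟨ht 0, ht 2⟩)
      (by rw [norm_prod, hσ _ _ t ⟨ht 0, ht 1⟩, hσ _ _ t ⟨ht 1, ht 2⟩, one_mul]))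
    (fun x t ht => HermitianBundle.SmoothSectionNear.inner
      ((hsm _ t (ht 0)).ypair (hsm _ t (ht 2)) _).1 (hσs _ _ t ⟨ht 0, ht 2⟩)
      (prod_smooth (hsm _ t (ht 0)) (hsm _ t (ht 1)) (hsm _ t (ht 2))
        (hσs _ _ t ⟨ht 0, ht 1⟩) (hσs _ _ t ⟨ht 1, ht 2⟩))) hgd
  exact ⟨c, U', fun x => s (κ x), fun x => hs (κ x), fun x y => σ (κ x) (κ y), fun x => g (κ ∘ x),
    hU', fun x => (hsU _).mono (hsub x), fun x y t ht => hσ _ _ t ⟨hsub _ ht.1, hsub _ ht.2⟩,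
    fun x y t ht => hσs _ _ t ⟨hsub _ ht.1, hsub _ ht.2⟩,
    fun x t ht => hg (κ ∘ x) t fun i => hsub _ (ht i), hc⟩

/-- Unit sections `τ_x` of `L` along `(s_x, s'_x)` compare the two sets of choices. Both `σ_xy τ_y`
and `τ_x σ'_xy` lie in the line over `(s_x, s'_y)`, so they differ by a phase `l_xy`. Moving `τ`
through the product `σ_xy σ_yz` by associativity gives `g l_xz = l_xy l_yz g'`. -/
theorem Represents.unique {c c' : CechH3 M} (h : G.Represents c) (h' : G.Represents c') :
    c = c' := by
  obtain ⟨U, s, hs, σ, g, hU, hsU, hσ, hσs, hg, hc⟩ := h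
  obtain ⟨U', s', hs', σ', g', hU', hsU', hσ', hσs', hg', hc'⟩ := h'
  have hsm : ∀ i t, t ∈ U i → SmoothMapNear IM id IY id (s i) t := fun i t ht =>
    SmoothMapNear.of_contMDiffOn (hU i).1 (hsU i) ht
  have hsm' : ∀ i t, t ∈ U' i → SmoothMapNear IM id IY id (s' i) t := fun i t ht =>
    SmoothMapNear.of_contMDiffOn (hU' i).1 (hsU' i) ht
  let p : M → M → FibreProd2 π := fun x t => ypair ((hs x t).trans (hs' x t).symm)
  have hp : ∀ x t, t ∈ U x ∩ U' x → SmoothMapNear IM id (IY.prod IY) Subtype.val (p x) t :=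
    fun x t ht => (hsm x t ht.1).ypair (hsm' x t ht.2) fun t => (hs x t).trans (hs' x t).symm
  let τ : ∀ x t, G.L.Fiber (ypair ((hs x t).trans (hs' x t).symm)) := fun x t =>
    G.unitFrame (p x x) (p x t)
  let W : M → Set M := fun x => (U x ∩ U' x) ∩ p x ⁻¹' G.L.dom (p x x)
  have hτ : ∀ x t, t ∈ W x → ‖τ x t‖ = 1 := fun x t ht => G.norm_unitFrame ht.2
  have hτs : ∀ x t, t ∈ W x → G.L.SmoothSectionNear IM (id : M → M)
      (fun t' => ypair ((hs x t').trans (hs' x t').symm)) (τ x) t := fun x t ht =>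
    unitFrame_smooth (hp x t ht.1) ht.2
  let l : M → M → M → ℂ := fun x y t =>
    ⟪prod (τ x t) (σ' x y t), prod (σ x y t) (τ y t)⟫_ℂ
  have hn1 : ∀ x y t, t ∈ W x ∩ W y → ‖prod (τ x t) (σ' x y t)‖ = 1 := fun x y t ht => by
    rw [norm_prod, hτ x t ht.1, hσ' x y t ⟨ht.1.1.2, ht.2.1.2⟩, one_mul]
  have hn2 : ∀ x y t, t ∈ W x ∩ W y → ‖prod (σ x y t) (τ y t)‖ = 1 := fun x y t ht => by
    rw [norm_prod, hτ y t ht.2, hσ x y t ⟨ht.1.1.1, ht.2.1.1⟩, one_mul]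
  have hl : ∀ x y t, t ∈ W x ∩ W y → prod (σ x y t) (τ y t) = l x y t • prod (τ x t) (σ' x y t) :=
    fun x y t ht => eq_inner_smul (G.finrank_L _) (hn1 x y t ht) _
  refine IsCohomologousVia.connecting_eq (W := W) (l := l) ⟨fun x => ⟨?_, ?_⟩, fun x t ht => ht.1.1,
    fun x t ht => ht.1.2, fun x y t ht => norm_inner_eq_one (G.finrank_L _) (hn1 x y t ht)
    (hn2 x y t ht), fun x y t ht => ?_, fun x t ht => ?_⟩ hc hc'
  · refine ContinuousOn.isOpen_inter_preimage (fun t ht => (hp x t ht).1.continuousWithinAt)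
      ((hU x).1.inter (hU' x).1) (G.L.isOpen_dom _)
  · exact ⟨⟨(hU x).2, (hU' x).2⟩, G.L.mem_dom _⟩
  · obtain ⟨hx, hy⟩ := ht
    exact HermitianBundle.SmoothSectionNear.inner
      ((hsm x t hx.1.1).ypair (hsm' y t hy.1.2) fun t => (hs x t).trans (hs' y t).symm).1
      (prod_smooth (hsm x t hx.1.1) (hsm' x t hx.1.2) (hsm' y t hy.1.2) (hτs x t hx)
        (hσs' x y t ⟨hx.1.2, hy.1.2⟩))
      (prod_smooth (hsm x t hx.1.1) (hsm y t hy.1.1) (hsm' y t hy.1.2)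
        (hσs x y t ⟨hx.1.1, hy.1.1⟩) (hτs y t hy))
  · have h0 := ht 0; have h1 := ht 1; have h2 := ht 2
    have e1 : prod (σ (x 0) (x 1) t) (σ (x 1) (x 2) t) = g x t • σ (x 0) (x 2) t :=
      hg x t fun i => (ht i).1.1
    have e2 : prod (σ' (x 0) (x 1) t) (σ' (x 1) (x 2) t) = g' x t • σ' (x 0) (x 2) t :=
      hg' x t fun i => (ht i).1.2
    have e3 := prod_assoc (σ (x 0) (x 1) t) (σ (x 1) (x 2) t) (τ (x 2) t)
    rw [e1, prod_smul_left, hl _ _ t ⟨h0, h2⟩, hl _ _ t ⟨h1, h2⟩, prod_smul_right, ← prod_assoc,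
      hl _ _ t ⟨h0, h1⟩, prod_smul_left, prod_assoc, e2, prod_smul_right, smul_smul, smul_smul,
      smul_smul] at e3
    have hne : prod (τ (x 0) t) (σ' (x 0) (x 2) t) ≠ 0 := by
      intro h
      have := hn1 (x 0) (x 2) t ⟨h0, h2⟩
      simp [h] at this
    have e4 := smul_left_injective _ hne e3
    rw [e4]; ring

variable (G) in
theorem exists_hasDDClass : ∃ d, G.HasDDClass d := by
  obtain ⟨d, hd⟩ := G.exists_represents
  exact ⟨d, fun c' => ⟨fun h => h.unique hd, fun h => h ▸ hd⟩⟩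

end BundleGerbe

end Gerbe

/-! ### Smooth families of matrices -/

section Matrices

variable {E : Type*} [NormedAddCommGroup E] [NormedSpace ℝ E] {H : Type*} [TopologicalSpace H]
  {I : ModelWithCorners ℝ E H} {N : Type*} [TopologicalSpace N] [ChartedSpace H N]
  {B : Type*} [TopologicalSpace B] {inc : B → N}
  {F : B → Type*} [∀ b, NormedAddCommGroup (F b)] [∀ b, InnerProductSpace ℂ (F b)]

/-- The constant standard frame of `ℂ^n`. -/
noncomputable def stdFrame (B : Type*) (n : ℕ) (i : Fin n) (_ : B) : EuclideanSpace ℂ (Fin n) :=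
  EuclideanSpace.single i 1

theorem isONB_std (n : ℕ) :
    IsONB fun i : Fin n => (EuclideanSpace.single i 1 : EuclideanSpace ℂ (Fin n)) :=
  IsONB.of_iso (LinearIsometryEquiv.refl ℂ _) fun _ => rfl

theorem eventually_isONB_std {n : ℕ} {b : B} :
    ∀ᶠ x in 𝓝 b, IsONB fun i => stdFrame B n i x :=
  Eventually.of_forall fun _ => isONB_std n

theorem smoothMatrixNear_iff {m n : ℕ}
    {u : B → EuclideanSpace ℂ (Fin m) → EuclideanSpace ℂ (Fin n)} {b : B} :
    SmoothMatrixNear I inc u b ↔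
      ∀ i, SmoothSec I inc (stdFrame B n) (fun x => u x (EuclideanSpace.single i 1)) b := by
  simp only [SmoothMatrixNear, SmoothSec, stdFrame, EuclideanSpace.inner_single_left, map_one,
    one_mul]

theorem SmoothMatrixNear.eventually {m n : ℕ}
    {u : B → EuclideanSpace ℂ (Fin m) → EuclideanSpace ℂ (Fin n)} {b : B}
    (h : SmoothMatrixNear I inc u b) (hinc : Continuous inc) :
    ∀ᶠ x in 𝓝 b, SmoothMatrixNear I inc u x := by
  simp only [SmoothMatrixNear, eventually_all]
  exact fun i j => (h i j).eventually hinc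

end Matrices

/-! ### The Dixmier–Douady class of a projective bundle is unique -/

section ProjClass

variable {EM : Type*} [NormedAddCommGroup EM] [NormedSpace ℝ EM] [FiniteDimensional ℝ EM]
  {HM : Type*} [TopologicalSpace HM] {IM : ModelWithCorners ℝ EM HM}
  {M : Type*} [TopologicalSpace M] [ChartedSpace HM M] [IsManifold IM ∞ M]
  [T2Space M] [SigmaCompactSpace M]

/-- Let `w_x` be a smooth unitary lift of the change from the chart `k' x` to the chart `k x`. Then
`w_x u'_xy` and `u_xy w_y` lift the same projective map, so they differ by a phase `l_xy`; comparing
them on triple overlaps gives `g' l_xz = l_xy l_yz g`. -/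
theorem ProjectiveBundle.Represents.unique {P : ProjectiveBundle IM M} {c c' : CechH3 M}
    (h : P.Represents c) (h' : P.Represents c') : c = c' := by
  obtain ⟨U, k, u, g, hU, hUk, hus, hue, hug, hc⟩ := h
  obtain ⟨U', k', u', g', hU', hUk', hus', hue', hug', hc'⟩ := h'
  have htr := fun x => P.transition (k' x) (k x) x ⟨hUk' x (hU' x).2, hUk x (hU x).2⟩
  choose w hws hwe using htr
  let A : M → Set M := fun x => {t | t ∈ U x ∧ t ∈ U' x ∧
    SmoothMatrixNear IM id (fun y => w x y) t ∧
    ∀ p, P.chart (k' x) t p = P.chart (k x) t (projMap (w x t) p)}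
  let W : M → Set M := fun x => interior (A x)
  have hW : ∀ {x t}, t ∈ W x → t ∈ U x ∧ t ∈ U' x ∧ SmoothMatrixNear IM id (fun y => w x y) t ∧
    ∀ p, P.chart (k' x) t p = P.chart (k x) t (projMap (w x t) p) :=
    fun {x t} h => (interior_subset h : t ∈ A x)
  -- A unit vector, available because ranks are positive. It expresses the phase `l` as an inner
  -- product of smooth vectors, which shows that `l` is smooth.
  let e₀ : ∀ y, EuclideanSpace ℂ (Fin (P.rank (k' y))) := fun y =>
    EuclideanSpace.single ⟨0, P.rank_pos _⟩ 1
  have he₀ : ∀ y, ‖e₀ y‖ = 1 := fun y => by simp [e₀]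
  let l : M → M → M → ℂ := fun x y t => ⟪u x y t (w y t (e₀ y)), w x t (u' x y t (e₀ y))⟫_ℂ
  have key : ∀ x y t, t ∈ W x ∩ W y → ‖l x y t‖ = 1 ∧
      ∀ v, w x t (u' x y t v) = l x y t • u x y t (w y t v) := by
    rintro x y t ⟨hx, hy⟩
    obtain ⟨hx1, hx2, -, hx3⟩ := hW hx
    obtain ⟨hy1, hy2, -, hy3⟩ := hW hy
    obtain ⟨e, he, hep⟩ := hue x y t ⟨hx1, hy1⟩
    obtain ⟨e', he', hep'⟩ := hue' x y t ⟨hx2, hy2⟩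
    obtain ⟨z, hz, hzv⟩ := exists_smul_of_projMap_eq ((w y t).trans e) (e'.trans (w x t)) (by
      intro p
      apply (P.bijective_chart (k x) t (hUk x hx1)).1
      rw [projMap_trans, projMap_trans, ← hx3, ← hep', hy3, hep])
    simp only [LinearIsometryEquiv.trans_apply] at hzv
    have hl : l x y t = z := by
      refine inner_eq_of_eq_smul ?_ ?_
      · rw [he, he', hzv]
      · rw [he, LinearIsometryEquiv.norm_map, LinearIsometryEquiv.norm_map, he₀]
    exact ⟨hl ▸ hz, fun v => by rw [he, he', hl, hzv]⟩
  refine (IsCohomologousVia.connecting_eq (W := W) (l := l) ⟨fun x => ⟨isOpen_interior, ?_⟩,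
    fun x t ht => (hW ht).2.1, fun x t ht => (hW ht).1, fun x y t ht => (key x y t ht).1,
    fun x y t ht => ?_, fun x t ht => ?_⟩ hc' hc).symm
  · rw [mem_interior_iff_mem_nhds]
    filter_upwards [(hU x).1.mem_nhds (hU x).2, (hU' x).1.mem_nhds (hU' x).2,
      (hws x).eventually continuous_id, hwe x] with t a b c d using ⟨a, b, c, d⟩
  · obtain ⟨hx1, hx2, hx3, -⟩ := hW ht.1
    obtain ⟨hy1, hy2, hy3, -⟩ := hW ht.2
    have h1 := smoothMatrixNear_iff.1 (hus x y t ⟨hx1, hy1⟩)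
    have h2 := smoothMatrixNear_iff.1 (hus' x y t ⟨hx2, hy2⟩)
    refine SmoothSec.inner (e := stdFrame M _) ?_ ?_ eventually_isONB_std
    · exact SmoothSec.map (smoothMatrixNear_iff.1 hy3 _) eventually_isONB_std (u x y) h1
    · exact SmoothSec.map (h2 _) eventually_isONB_std
        (fun t => (w x t).toLinearEquiv.toLinearMap) (smoothMatrixNear_iff.1 hx3)
  · have h0 := ht 0; have h1 := ht 1; have h2 := ht 2
    obtain ⟨e, he, -⟩ := hue (x 0) (x 2) t ⟨(hW h0).1, (hW h2).1⟩
    have e1 := hug x t fun i => (hW (ht i)).1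
    have e2 := hug' x t (fun i => (hW (ht i)).2.1) (e₀ (x 2))
    have e3 := congrArg (w (x 0) t) e2
    rw [(key _ _ t ⟨h0, h1⟩).2, (key _ _ t ⟨h1, h2⟩).2, map_smul, map_smul, e1,
      (key _ _ t ⟨h0, h2⟩).2, smul_smul, smul_smul, smul_smul] at e3
    have hne : u (x 0) (x 2) t (w (x 2) t (e₀ (x 2))) ≠ 0 := by
      rw [he]
      intro h
      have := he₀ (x 2)
      rw [← (w (x 2) t).norm_map, ← e.norm_map, h] at this
      simp at this
    have e4 := smul_left_injective _ hne e3
    linear_combination -e4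

end ProjClass

/-! ### The action on a bundle gerbe module -/

section Module

theorem isometryEquiv_ne_zero {V W : Type*} [NormedAddCommGroup V] [InnerProductSpace ℂ V]
    [NormedAddCommGroup W] [InnerProductSpace ℂ W] (u : V ≃ₗᵢ[ℂ] W) {v : V} (hv : v ≠ 0) :
    u v ≠ 0 := fun h => hv (u.injective (h.trans (map_zero u).symm))

theorem inner_symm_apply {V W : Type*} [NormedAddCommGroup V] [InnerProductSpace ℂ V]
    [NormedAddCommGroup W] [InnerProductSpace ℂ W] (u : V ≃ₗᵢ[ℂ] W) (v : V) (w : W) :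
    ⟪v, u.symm w⟫_ℂ = ⟪u v, w⟫_ℂ := by
  rw [← u.inner_map_map, LinearIsometryEquiv.apply_symm_apply]

theorem euclidean_coord {n : ℕ} (v : EuclideanSpace ℂ (Fin n)) (i : Fin n) :
    v i = ⟪EuclideanSpace.single i (1 : ℂ), v⟫_ℂ := by
  simp [EuclideanSpace.inner_single_left]

/-- The frame used to test smoothness changes with the point, so openness involves a change of
frame. -/
theorem HermitianBundle.SmoothSectionNear.eventually {E : Type*} [NormedAddCommGroup E]
    [NormedSpace ℝ E] {H : Type*} [TopologicalSpace H] {I : ModelWithCorners ℝ E H} {N : Type*}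
    [TopologicalSpace N] [ChartedSpace H N] {V : HermitianBundle I (id : N → N)}
    {σ : ∀ b, V.Fiber b} {b : N} (h : V.SmoothSectionNear I id id σ b) :
    ∀ᶠ x in 𝓝 b, V.SmoothSectionNear I id id σ x := by
  have h1 : ∀ᶠ x in 𝓝 b, ∀ i, SmoothNear I (id : N → N) (fun y => ⟪V.frame b i y, σ y⟫_ℂ) x :=
    eventually_all.2 fun i => (h i).eventually continuous_id
  filter_upwards [h1, (V.isOpen_dom b).mem_nhds (V.mem_dom b)] with x hx hd
  exact (HermitianBundle.smoothSec_iff (SmoothMapNear.id_id x) hd).2 hx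

variable {EM : Type*} [NormedAddCommGroup EM] [NormedSpace ℝ EM] {HM : Type*} [TopologicalSpace HM]
  {IM : ModelWithCorners ℝ EM HM} {M : Type*} [TopologicalSpace M] [ChartedSpace HM M]
  {EY : Type*} [NormedAddCommGroup EY] [NormedSpace ℝ EY] {HY : Type*} [TopologicalSpace HY]
  {IY : ModelWithCorners ℝ EY HY} {Y : Type*} [TopologicalSpace Y] [ChartedSpace HY Y]
  {π : Y → M}
  {E' : Type*} [NormedAddCommGroup E'] [NormedSpace ℝ E'] {H' : Type*} [TopologicalSpace H']
  {I' : ModelWithCorners ℝ E' H'} {N' : Type*} [TopologicalSpace N'] [ChartedSpace H' N']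
  {B : Type*} [TopologicalSpace B] {inc : B → N'}

namespace BundleGerbe

variable {G : BundleGerbe IM IY π}

namespace GerbeModule

variable (A : GerbeModule G)

section Action

variable {y₁ y₂ y₃ : Y} {h : π y₁ = π y₂} {h' : π y₂ = π y₃}

theorem act_smul_left (z : ℂ) (a : G.L.Fiber (ypair h)) (e : A.E.Fiber y₂) :
    A.act h ((z • a) ⊗ₜ e) = z • A.act h (a ⊗ₜ e) := by
  rw [← TensorProduct.smul_tmul', map_smul]

theorem act_smul_right (z : ℂ) (a : G.L.Fiber (ypair h)) (e : A.E.Fiber y₂) :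
    A.act h (a ⊗ₜ (z • e)) = z • A.act h (a ⊗ₜ e) := by
  rw [TensorProduct.tmul_smul, map_smul]

/-- The unitary isomorphism `E_{y₂} ≃ E_{y₁}` given by the action of a unit vector. -/
noncomputable def actIso (a : G.L.Fiber (ypair h)) (ha : ‖a‖ = 1) :
    A.E.Fiber y₂ ≃ₗᵢ[ℂ] A.E.Fiber y₁ :=
  tensorLineIso (G.finrank_L _) (A.act h) ha

@[simp] theorem actIso_apply (a : G.L.Fiber (ypair h)) (ha : ‖a‖ = 1) (e : A.E.Fiber y₂) :
    A.actIso a ha e = A.act h (a ⊗ₜ e) :=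
  tensorLineIso_apply _ _ _ _

variable (h) in
/-- The canonical identification `P(E_{y₂}) ≃ P(E_{y₁})`. -/
noncomputable def tr : ℙ ℂ (A.E.Fiber y₂) ≃ ℙ ℂ (A.E.Fiber y₁) :=
  projEquiv (A.actIso (h := h) _ (G.exists_norm_eq_one (ypair h)).choose_spec)

/-- Unit vectors of the line `L_{(y₁,y₂)}` differ by a phase, which acts trivially on projective
space. The arbitrary choice in `tr` is therefore harmless. -/
theorem tr_eq (a : G.L.Fiber (ypair h)) (ha : ‖a‖ = 1) (p : ℙ ℂ (A.E.Fiber y₂)) :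
    A.tr h p = projMap (A.actIso a ha) p := by
  refine projMap_smul_eq (u := A.actIso a ha)
    (c := ⟪a, (G.exists_norm_eq_one (ypair h)).choose⟫_ℂ) (fun v => ?_) p
  rw [actIso_apply, actIso_apply, ← act_smul_left, ← eq_inner_smul (G.finrank_L _) ha]

theorem tr_mk (a : G.L.Fiber (ypair h)) (e : A.E.Fiber y₂) (he : e ≠ 0)
    (hae : A.act h (a ⊗ₜ e) ≠ 0) :
    A.tr h (Projectivization.mk ℂ e he) = Projectivization.mk ℂ _ hae := by
  obtain ⟨b, hb⟩ := G.exists_norm_eq_one (ypair h)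
  have h1 : A.actIso b hb e ≠ 0 := isometryEquiv_ne_zero _ he
  rw [A.tr_eq b hb, projMap_mk _ he h1, Projectivization.mk_eq_mk_iff']
  obtain ⟨z, rfl⟩ : ∃ z : ℂ, a = z • b := ⟨_, eq_inner_smul (G.finrank_L _) hb a⟩
  have h3 : z ≠ 0 := by
    rintro rfl
    exact hae (by rw [zero_smul, TensorProduct.zero_tmul, map_zero])
  exact ⟨z⁻¹, by rw [act_smul_left, smul_smul, inv_mul_cancel₀ h3, one_smul, actIso_apply]⟩

/-- This is the cocycle condition of the descent datum: the product of unit vectors is a unit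
vector, and any unit vector computes `tr`. -/
theorem tr_tr (p : ℙ ℂ (A.E.Fiber y₃)) : A.tr h (A.tr h' p) = A.tr (h.trans h') p := by
  obtain ⟨a, ha⟩ := G.exists_norm_eq_one (ypair h)
  obtain ⟨b, hb⟩ := G.exists_norm_eq_one (ypair h')
  have hab : ‖prod a b‖ = 1 := by rw [norm_prod, ha, hb, one_mul]
  rw [A.tr_eq a ha, A.tr_eq b hb, A.tr_eq _ hab, ← projMap_trans]
  congr 1
  ext v
  simp only [LinearIsometryEquiv.trans_apply, actIso_apply]
  exact A.act_mul _ _ _ _ _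

end Action

variable {A}

theorem act_smooth {φ₁ φ₂ : B → Y} {b : B} (hφ₁ : SmoothMapNear I' inc IY id φ₁ b)
    (hφ₂ : SmoothMapNear I' inc IY id φ₂ b) {h₁₂ : ∀ x, π (φ₁ x) = π (φ₂ x)}
    {σ : ∀ x, G.L.Fiber (ypair (h₁₂ x))} {τ : ∀ x, A.E.Fiber (φ₂ x)}
    (hσ : G.L.SmoothSectionNear I' inc (fun x => ypair (h₁₂ x)) σ b)
    (hτ : A.E.SmoothSectionNear I' inc φ₂ τ b) :
    A.E.SmoothSectionNear I' inc φ₁ (fun x => A.act (h₁₂ x) (σ x ⊗ₜ τ x)) b := by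
  refine SmoothSec.tmul (e := fun i x => G.L.frame (ypair (h₁₂ b)) i (ypair (h₁₂ x)))
    (e' := fun i x => A.E.frame (φ₂ b) i (φ₂ x))
    (e'' := fun i x => A.E.frame (φ₁ b) i (φ₁ x)) hσ hτ
    (G.L.eventually_isONB (hφ₁.ypair hφ₂ h₁₂).1 (G.L.mem_dom _))
    (A.E.eventually_isONB hφ₂.1 (A.E.mem_dom _))
    (fun x => (A.act (h₁₂ x)).toLinearEquiv.toLinearMap) fun i j => ?_
  exact fun k => (A.smooth_act (ypair (h₁₂ b)) i j k).comp (hφ₁.ypair hφ₂ h₁₂)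

/-! ### Descent of projectivisations -/

/-- The bijections `θ : P(E_y) ≃ P_x` exhibit `P` as the descent of `P(E)`; the smoothness
condition is expressed by smooth orthonormal frames of `E` that lift the charts of `P`. -/
structure IsDescent (A : GerbeModule G) (P : ProjectiveBundle IM M)
    (θ : ∀ {x : M} {y : Y}, π y = x → (ℙ ℂ (A.E.Fiber y) ≃ P.Fiber x)) : Prop where
  exists_frame : ∀ {x₀ : M} {y₀ : Y}, π y₀ = x₀ → ∃ f : Fin (P.rank x₀) → ∀ y, A.E.Fiber y,
    (∀ i, A.E.SmoothSectionNear IY (id : Y → Y) id (f i) y₀) ∧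
    ∀ᶠ y in 𝓝 y₀, ∃ e : EuclideanSpace ℂ (Fin (P.rank x₀)) ≃ₗᵢ[ℂ] A.E.Fiber y,
      (∀ i, e (EuclideanSpace.single i 1) = f i y) ∧
      ∀ {x : M} (h : π y = x) p, θ h (projMap e p) = P.chart x₀ x p
  tr_eq : ∀ {x : M} {y₁ y₂ : Y} (h₁ : π y₁ = x) (h₂ : π y₂ = x) p,
    θ h₁ (A.tr (h₁.trans h₂.symm) p) = θ h₂ p

/-- The two forms exchange the matrix `u` from the frame of `E` to the chart of `P` with a frame
lifting the chart, through `f_i = ∑_j (u⁻¹ e_i)_j • frame_j`. The equivariance condition for all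
nonzero products reduces to `tr` because nonzero vectors of `L` induce the same projective map. -/
theorem descendsTo_iff {P : ProjectiveBundle IM M} :
    A.DescendsTo P ↔
      ∃ θ : ∀ {x : M} {y : Y}, π y = x → (ℙ ℂ (A.E.Fiber y) ≃ P.Fiber x), A.IsDescent P θ := by
  constructor
  · rintro ⟨θ, hu, ht⟩
    refine ⟨θ, ?_, ?_⟩
    · rintro x₀ y₀ rfl
      obtain ⟨u, hus, hue⟩ := hu y₀
      refine ⟨fun i y => ∑ j, (u y).symm (EuclideanSpace.single i 1) j • A.E.frame y₀ j y,
        fun i j => ?_, ?_⟩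
      · refine (hus j i).conj.congr ?_
        filter_upwards [(A.E.isOpen_dom y₀).mem_nhds (A.E.mem_dom y₀)] with y hy
        simp only [id]
        rw [(A.E.isONB hy).1.inner_right_fintype, euclidean_coord, euclidean_coord,
          inner_conj_symm, inner_symm_apply]
      · filter_upwards [hue, (A.E.isOpen_dom y₀).mem_nhds (A.E.mem_dom y₀)] with y hy hd
        refine ⟨(u y).symm.trans (A.E.frameIso hd), fun i => ?_, ?_⟩
        · rw [LinearIsometryEquiv.trans_apply, (A.E.isONB hd).expand (A.E.frameIso hd _)]
          refine Finset.sum_congr rfl fun j _ => ?_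
          have h1 := (A.E.isONB hd).iso_symm_apply
            ((A.E.isONB hd).iso ((u y).symm (EuclideanSpace.single i 1))) j
          rw [LinearIsometryEquiv.symm_apply_apply] at h1
          rw [h1, HermitianBundle.frameIso_eq]
        · rintro x rfl p
          rw [projMap_trans, hy hd, ← projMap_trans, LinearIsometryEquiv.symm_trans_self,
            projMap_refl]
    · intro x y₁ y₂ h₁ h₂ p
      induction p using Projectivization.ind with
      | h e he =>
        obtain ⟨a, ha⟩ := G.exists_norm_eq_one (ypair (h₁.trans h₂.symm))
        have hae : A.act (h₁.trans h₂.symm) (a ⊗ₜ e) ≠ 0 := by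
          rw [← A.actIso_apply a ha]
          exact isometryEquiv_ne_zero _ he
        rw [A.tr_mk a e he hae]
        exact ht h₁ h₂ a e he hae
  · rintro ⟨θ, hf, ht⟩
    refine ⟨θ, fun y₀ => ?_, fun {x y₁ y₂} h₁ h₂ a e he hae => ?_⟩
    · obtain ⟨f, hfs, hfe⟩ := hf (rfl : π y₀ = π y₀)
      have hev : ∀ᶠ y in 𝓝 y₀, ∃ u : EuclideanSpace ℂ (Fin (A.E.rank y₀)) ≃ₗᵢ[ℂ]
          EuclideanSpace ℂ (Fin (P.rank (π y₀))),
          (∀ i j, u (EuclideanSpace.single i 1) j = ⟪f j y, A.E.frame y₀ i y⟫_ℂ) ∧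
          ∀ (hy : y ∈ A.E.dom y₀) p,
            θ rfl (projMap (A.E.frameIso hy) p) = P.chart (π y₀) (π y) (projMap u p) := by
        filter_upwards [hfe, (A.E.isOpen_dom y₀).mem_nhds (A.E.mem_dom y₀)] with y ⟨e, he, hep⟩ hd
        refine ⟨(A.E.frameIso hd).trans e.symm, fun i j => ?_, fun _ p => ?_⟩
        · rw [euclidean_coord, LinearIsometryEquiv.trans_apply, inner_symm_apply, he,
            HermitianBundle.frameIso_eq, IsONB.iso_single]
        · rw [← hep rfl, ← projMap_trans]
          congr 2
          ext v
          simp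
      obtain ⟨u₀, -⟩ := hev.self_of_nhds
      obtain ⟨u, hu⟩ := exists_choice_of_eventually (fun _ => ⟨u₀⟩) hev
      refine ⟨u, fun i j => ?_, hu.mono fun y h => h.2⟩
      refine (HermitianBundle.SmoothSectionNear.inner (f := id) continuousAt_id (hfs j)
        (HermitianBundle.smoothSectionNear_frame (SmoothMapNear.id_id y₀)
          (A.E.mem_dom y₀) i)).congr ?_
      filter_upwards [hu] with y hy using hy.1 i j
    · rw [← A.tr_mk a e he hae]
      exact ht h₁ h₂ _

/-- The projective bundle to which a bundle gerbe module descends represents the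
Dixmier–Douady class of the bundle gerbe. -/
theorem IsDescent.represents {P : ProjectiveBundle IM M}
    {θ : ∀ {x : M} {y : Y}, π y = x → (ℙ ℂ (A.E.Fiber y) ≃ P.Fiber x)} (hθ : A.IsDescent P θ)
    {c : CechH3 M} (hc : G.Represents c) : P.Represents c := by
  obtain ⟨U, s, hs, σ, g, hU, hsU, hσ, hσs, hg, hgc⟩ := hc
  choose f hfs hfe using fun x => hθ.exists_frame (hs x x)
  have hsm : ∀ i t, t ∈ U i → SmoothMapNear IM id IY id (s i) t := fun i t ht =>
    SmoothMapNear.of_contMDiffOn (hU i).1 (hsU i) ht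
  let IsLift : ∀ x y, (EuclideanSpace ℂ (Fin (P.rank x)) ≃ₗᵢ[ℂ] A.E.Fiber y) → Prop :=
    fun x₀ y e => (∀ i, e (EuclideanSpace.single i 1) = f x₀ i y) ∧
      ∀ {x : M} (h : π y = x) p, θ h (projMap e p) = P.chart x₀ x p
  let D : M → Set M := fun x => {t | t ∈ U x ∧ t ∈ P.dom x ∧
    (∀ i, A.E.SmoothSectionNear IY (id : Y → Y) id (f x i) (s x t)) ∧ ∃ e, IsLift x (s x t) e}
  let W : M → Set M := fun x => interior (D x)
  have hWD : ∀ {x t}, t ∈ W x → t ∈ D x := fun h => interior_subset h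
  -- The matrix is defined everywhere by its entries, from which smoothness follows. Where lifts `e`
  -- and `e'` of the charts exist it equals `e⁻¹ ∘ (σ ·) ∘ e'`, which shows that it is unitary.
  let u : ∀ x y, M → (EuclideanSpace ℂ (Fin (P.rank y)) →ₗ[ℂ] EuclideanSpace ℂ (Fin (P.rank x))) :=
    fun x y t => (EuclideanSpace.basisFun (Fin (P.rank y)) ℂ).toBasis.constr ℂ fun j =>
      WithLp.toLp 2 fun i => ⟪f x i (s x t),
        A.act ((hs x t).trans (hs y t).symm) (σ x y t ⊗ₜ f y j (s y t))⟫_ℂ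
  have hus : ∀ x y t i, u x y t (EuclideanSpace.single i 1) = WithLp.toLp 2 fun j =>
      ⟪f x j (s x t), A.act ((hs x t).trans (hs y t).symm) (σ x y t ⊗ₜ f y i (s y t))⟫_ℂ := by
    intro x y t i
    have hb : (EuclideanSpace.basisFun (Fin (P.rank y)) ℂ).toBasis i =
        EuclideanSpace.single i 1 := by simp
    rw [← hb]
    exact Module.Basis.constr_basis _ _ _ i
  have hue : ∀ x y t, t ∈ U x ∩ U y → ∀ e e', IsLift x (s x t) e → IsLift y (s y t) e' → ∀ v,
      u x y t v = e.symm (A.act ((hs x t).trans (hs y t).symm) (σ x y t ⊗ₜ e' v)) := by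
    intro x y t ht e e' he he'
    have : u x y t = ((e'.trans (A.actIso (σ x y t) (hσ x y t ht))).trans
        e.symm).toLinearEquiv.toLinearMap := by
      refine euclidean_ext fun j => ?_
      ext i
      rw [hus]
      change ⟪f x i (s x t), A.act _ (σ x y t ⊗ₜ f y j (s y t))⟫_ℂ =
        (e.symm (A.actIso (σ x y t) (hσ x y t ht) (e' _))) i
      rw [actIso_apply, euclidean_coord (e.symm _), inner_symm_apply, he.1, he'.1]
    intro v
    rw [this]
    change e.symm (A.actIso (σ x y t) (hσ x y t ht) (e' _)) = _
    rw [actIso_apply]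
  have hWU : ∀ x, W x ⊆ U x := fun x t ht => (hWD ht).1
  refine ⟨W, id, u, g, fun x => ⟨isOpen_interior, ?_⟩, fun x t ht => (hWD ht).2.1,
    fun x y t ht => ?_, fun x y t ht => ?_, fun x t ht v => ?_, ?_⟩
  · rw [mem_interior_iff_mem_nhds]
    have hc := (hsm x x (hU x).2).1
    filter_upwards [(hU x).1.mem_nhds (hU x).2, (P.isOpen_dom x).mem_nhds (P.mem_dom x),
      hc.eventually (eventually_all.2 fun i => (hfs x i).eventually), hc.eventually (hfe x)]
      with t a b c d using ⟨a, b, c, d⟩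
  · intro i j
    obtain ⟨hx, hx', hxs, -⟩ := hWD ht.1
    obtain ⟨hy, hy', hys, -⟩ := hWD ht.2
    refine (HermitianBundle.SmoothSectionNear.inner (V := A.E) (f := s x) (hsm x t hx).1
      ((hxs j).comp (hsm x t hx))
      (act_smooth (hsm x t hx) (hsm y t hy) (hσs x y t ⟨hx, hy⟩)
        ((hys i).comp (hsm y t hy)))).congr (Eventually.of_forall fun t => ?_)
    simp only [hus]
  · obtain ⟨hx, hx', hxs, e, he⟩ := hWD ht.1
    obtain ⟨hy, hy', hys, e', he'⟩ := hWD ht.2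
    refine ⟨(e'.trans (A.actIso (σ x y t) (hσ x y t ⟨hx, hy⟩))).trans e.symm, fun v => ?_,
      fun p => ?_⟩
    · rw [hue x y t ⟨hx, hy⟩ e e' he he', LinearIsometryEquiv.trans_apply,
        LinearIsometryEquiv.trans_apply, actIso_apply]
    · have h1 := he'.2 (hs y t) p
      have h2 := fun q => he.2 (hs x t) q
      simp only [id]
      rw [← h1, ← h2, ← hθ.tr_eq (hs x t) (hs y t), A.tr_eq _ (hσ x y t ⟨hx, hy⟩),
        ← projMap_trans, ← projMap_trans]
      congr 2
      ext v
      simp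
  -- The middle factors `e'` and `e'⁻¹` cancel, and compatibility with the product turns `σ_xy σ_yz
  -- = g σ_xz` into the same relation for `u`.
  · obtain ⟨hx, -, -, e, he⟩ := hWD (ht 0)
    obtain ⟨hy, -, -, e', he'⟩ := hWD (ht 1)
    obtain ⟨hz, -, -, e'', he''⟩ := hWD (ht 2)
    rw [hue _ _ t ⟨hx, hy⟩ e e' he he', hue _ _ t ⟨hy, hz⟩ e' e'' he' he'',
      hue _ _ t ⟨hx, hz⟩ e e'' he he'', LinearIsometryEquiv.apply_symm_apply, A.act_mul,
      hg x t fun i => hWU _ (ht i), act_smul_left, map_smul]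
  · obtain ⟨h, z, h1, h2, h3, h4⟩ := hgc
    have hsub : ∀ {k : ℕ} (x : Fin k → M), overlap W x ⊆ overlap U x := fun x t ht i =>
      hWU _ (ht i)
    exact ⟨h, z, fun x => (h1 x).mono (hsub x), fun x t ht => h2 x t (hsub x ht),
      fun x t ht => h3 x t (hsub x ht), h4⟩

end GerbeModule

end BundleGerbe

end Module

/-! ### Existence and uniqueness of descent -/

section Descent

theorem HermitianBundle.SmoothSectionNear.sum {E : Type*} [NormedAddCommGroup E] [NormedSpace ℝ E]
    {H : Type*} [TopologicalSpace H] {I : ModelWithCorners ℝ E H} {N : Type*} [TopologicalSpace N]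
    [ChartedSpace H N] {B : Type*} [TopologicalSpace B] {inc : B → N} {V : HermitianBundle I inc}
    {E' : Type*} [NormedAddCommGroup E'] [NormedSpace ℝ E'] {H' : Type*} [TopologicalSpace H']
    {I' : ModelWithCorners ℝ E' H'} {N' : Type*} [TopologicalSpace N'] [ChartedSpace H' N']
    {B' : Type*} [TopologicalSpace B'] {inc' : B' → N'} {f : B' → B} {b : B'} {κ : Type*}
    (t : Finset κ) {σ : κ → ∀ b, V.Fiber (f b)}
    (hσ : ∀ k ∈ t, V.SmoothSectionNear I' inc' f (σ k) b) :
    V.SmoothSectionNear I' inc' f (fun x => ∑ k ∈ t, σ k x) b :=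
  SmoothSec.sum (e := fun i x => V.frame (f b) i (f x)) t hσ

theorem isometryEquiv_eq_sum {n : ℕ} {V : Type*} [NormedAddCommGroup V] [InnerProductSpace ℂ V]
    (e : EuclideanSpace ℂ (Fin n) ≃ₗᵢ[ℂ] V) (v : EuclideanSpace ℂ (Fin n)) :
    e v = ∑ j, v j • e (EuclideanSpace.single j 1) := by
  conv_lhs => rw [(isONB_std n).expand v, map_sum]
  refine Finset.sum_congr rfl fun j _ => ?_
  rw [map_smul, ← euclidean_coord]

variable {EM : Type*} [NormedAddCommGroup EM] [NormedSpace ℝ EM] {HM : Type*} [TopologicalSpace HM]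
  {IM : ModelWithCorners ℝ EM HM} {M : Type*} [TopologicalSpace M] [ChartedSpace HM M]
  {EY : Type*} [NormedAddCommGroup EY] [NormedSpace ℝ EY] {HY : Type*} [TopologicalSpace HY]
  {IY : ModelWithCorners ℝ EY HY} {Y : Type*} [TopologicalSpace Y] [ChartedSpace HY Y]
  {π : Y → M} {G : BundleGerbe IM IY π}

namespace BundleGerbe.GerbeModule

variable {A B : GerbeModule G} {P Q : ProjectiveBundle IM M}

theorem exists_ne_zero (A : GerbeModule G) (y : Y) : ∃ e : A.E.Fiber y, e ≠ 0 := by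
  refine ⟨A.E.frame y ⟨0, A.rank_pos y⟩ y, fun h => ?_⟩
  have := (A.E.isONB (A.E.mem_dom y)).norm_eq ⟨0, A.rank_pos y⟩
  simp [h] at this

instance nonempty_projectivization (A : GerbeModule G) (y : Y) : Nonempty (ℙ ℂ (A.E.Fiber y)) := by
  obtain ⟨e, he⟩ := A.exists_ne_zero y
  exact ⟨Projectivization.mk ℂ e he⟩

/-- The chart of the descended projective bundle defined by a local section `s` of `π` and the frame
of `E` around `y₀`. -/
noncomputable def descentChart (A : GerbeModule G) {s : M → Y} (hs : ∀ t, π (s t) = t) (y₀ : Y)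
    {t : M} {y : Y} (h : π y = t) (p : ℙ ℂ (EuclideanSpace ℂ (Fin (A.E.rank y₀)))) :
    ℙ ℂ (A.E.Fiber y) :=
  open Classical in
  if hd : s t ∈ A.E.dom y₀ then A.tr (h.trans (hs t).symm) (projMap (A.E.frameIso hd) p)
  else Classical.arbitrary _

theorem descentChart_eq {s : M → Y} {hs : ∀ t, π (s t) = t} {y₀ : Y} {t : M} {y : Y}
    {h : π y = t} (hd : s t ∈ A.E.dom y₀) (p : ℙ ℂ (EuclideanSpace ℂ (Fin (A.E.rank y₀)))) :
    A.descentChart hs y₀ h p = A.tr (h.trans (hs t).symm) (projMap (A.E.frameIso hd) p) :=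
  dif_pos hd

/-- The transition map is the frame around `y₀`, followed by a unit vector of `L` along `(s', s)`,
followed by the inverse of the frame around `y₁`. The section `c` only names the fibre in which the
charts take values; its smoothness plays no role, since it cancels by `tr_tr`. -/
theorem descentChart_transition {s s' : M → Y} {hs : ∀ t, π (s t) = t} {hs' : ∀ t, π (s' t) = t}
    {c : M → Y} {hc : ∀ t, π (c t) = t} {y₀ y₁ : Y} {t : M} (h : SmoothMapNear IM id IY id s t)
    (h' : SmoothMapNear IM id IY id s' t) (hd : s t ∈ A.E.dom y₀) (hd' : s' t ∈ A.E.dom y₁) :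
    ProjUnitaryNear IM (fun t => A.descentChart hs y₀ (hc t))
      (fun t => A.descentChart hs' y₁ (hc t)) (fun _ p => p) t := by
  let q : M → FibreProd2 π := fun t => ypair ((hs' t).trans (hs t).symm)
  have hq : SmoothMapNear IM id (IY.prod IY) Subtype.val q t :=
    h'.ypair h fun t => (hs' t).trans (hs t).symm
  have hev : ∀ᶠ x in 𝓝 t, ∃ u : EuclideanSpace ℂ (Fin (A.E.rank y₀)) ≃ₗᵢ[ℂ]
      EuclideanSpace ℂ (Fin (A.E.rank y₁)),
      (∀ i j, u (EuclideanSpace.single i 1) j = ⟪A.E.frame y₁ j (s' x),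
        A.act (q x).2 (G.unitFrame (q t) (q x) ⊗ₜ A.E.frame y₀ i (s x))⟫_ℂ) ∧
      ∀ p, A.descentChart hs y₀ (hc x) p = A.descentChart hs' y₁ (hc x) (projMap u p) := by
    filter_upwards [hq.1.preimage_mem_nhds ((G.L.isOpen_dom _).mem_nhds (G.L.mem_dom (q t))),
      h.1.preimage_mem_nhds ((A.E.isOpen_dom _).mem_nhds hd),
      h'.1.preimage_mem_nhds ((A.E.isOpen_dom _).mem_nhds hd')] with x hx hx1 hx2
    refine ⟨((A.E.frameIso hx1).trans (A.actIso (h := (q x).2) _ (G.norm_unitFrame hx))).trans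
      (A.E.frameIso hx2).symm, fun i j => ?_, fun p => ?_⟩
    · rw [euclidean_coord, LinearIsometryEquiv.trans_apply, inner_symm_apply,
        LinearIsometryEquiv.trans_apply, actIso_apply]
      simp only [HermitianBundle.frameIso_eq, IsONB.iso_single]
      rfl
    · rw [descentChart_eq hx1, descentChart_eq hx2, projMap_trans _ (A.E.frameIso hx2).symm,
        ← projMap_trans _ (A.E.frameIso hx2), LinearIsometryEquiv.symm_trans_self,
        projMap_refl, projMap_trans, ← A.tr_eq, A.tr_tr]
  obtain ⟨u₀, -⟩ := hev.self_of_nhds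
  obtain ⟨u, hu⟩ := exists_choice_of_eventually (fun _ => ⟨u₀⟩) hev
  refine ⟨u, fun i j => ?_, hu.mono fun y h => h.2⟩
  refine (HermitianBundle.SmoothSectionNear.inner (f := s') h'.1
    (HermitianBundle.smoothSectionNear_frame h' hd' j)
    (act_smooth h' h (unitFrame_smooth hq (G.L.mem_dom _))
      (HermitianBundle.smoothSectionNear_frame h hd i))).congr ?_
  filter_upwards [hu] with y hy using hy.1 i j

/-- The projectivisation of a bundle gerbe module descends. -/
theorem exists_descendsTo (A : GerbeModule G) : ∃ P : ProjectiveBundle IM M, A.DescendsTo P := by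
  obtain ⟨s, U, hs, hU, hsU⟩ := G.locallySplit.exists_sections
  have hsm : ∀ i t, t ∈ U i → SmoothMapNear IM id IY id (s i) t := fun i t ht =>
    SmoothMapNear.of_contMDiffOn (hU i).1 (hsU i) ht
  -- The point `s x x` of the fibre of `π` need not vary continuously with `x`; the smooth structure
  -- comes entirely from the charts.
  let P : ProjectiveBundle IM M :=
    { Fiber := fun x => ℙ ℂ (A.E.Fiber (s x x))
      rank := fun x => A.E.rank (s x x)
      rank_pos := fun x => A.rank_pos _
      dom := fun x => U x ∩ s x ⁻¹' A.E.dom (s x x)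
      isOpen_dom := fun x => (hsU x).continuousOn.isOpen_inter_preimage (hU x).1 (A.E.isOpen_dom _)
      mem_dom := fun x => ⟨(hU x).2, A.E.mem_dom _⟩
      chart := fun a x => A.descentChart (hs a) (s a a) (hs x x)
      bijective_chart := fun a x hx => by
        have : A.descentChart (hs a) (s a a) (hs x x) =
            (projEquiv (A.E.frameIso hx.2)).trans (A.tr ((hs x x).trans (hs a x).symm)) :=
          funext fun p => descentChart_eq hx.2 p
        rw [this]
        exact Equiv.bijective _
      transition := fun a a' x hx => descentChart_transition (hc := fun x => hs x x)
        (hsm a x hx.1.1) (hsm a' x hx.2.1) hx.1.2 hx.2.2 }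
  refine ⟨P, descendsTo_iff.2 ⟨fun {x y} h => A.tr ((hs x x).trans h.symm), ?_, ?_⟩⟩
  · rintro x₀ y₀ rfl
    have hπ := G.locallySplit.smoothMapNear y₀
    have hs' : SmoothMapNear IY id IY id (fun y => s (π y₀) (π y)) y₀ :=
      (hsm (π y₀) (π y₀) (hU _).2).comp hπ
    let q : Y → FibreProd2 π := fun y => ypair (hs (π y₀) (π y)).symm
    have hq : SmoothMapNear IY id (IY.prod IY) Subtype.val q y₀ :=
      (SmoothMapNear.id_id y₀).ypair hs' fun y => (hs (π y₀) (π y)).symm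
    -- The frame of `E` along the local section is moved along the fibres of `π` by a smooth unit
    -- section of `L`.
    refine ⟨fun i y => A.act (hs (π y₀) (π y)).symm (G.unitFrame (q y₀) (q y) ⊗ₜ
      A.E.frame (s (π y₀) (π y₀)) i (s (π y₀) (π y))), fun i => ?_, ?_⟩
    · exact act_smooth (SmoothMapNear.id_id y₀) hs' (unitFrame_smooth hq (G.L.mem_dom _))
        (HermitianBundle.smoothSectionNear_frame hs' (A.E.mem_dom _) i)
    · filter_upwards [hq.1.preimage_mem_nhds ((G.L.isOpen_dom _).mem_nhds (G.L.mem_dom (q y₀))),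
        hs'.1.preimage_mem_nhds ((A.E.isOpen_dom _).mem_nhds (A.E.mem_dom _))] with y hy hy'
      refine ⟨(A.E.frameIso hy').trans (A.actIso (h := (hs (π y₀) (π y)).symm) _
        (G.norm_unitFrame hy)), fun i => ?_, ?_⟩
      · rw [LinearIsometryEquiv.trans_apply, actIso_apply, HermitianBundle.frameIso_eq,
          IsONB.iso_single]
      · rintro x rfl p
        rw [projMap_trans, ← A.tr_eq, A.tr_tr]
        exact (descentChart_eq (hs := hs (π y₀)) (h := hs (π y) (π y)) hy' p).symm
  · intro x y₁ y₂ h₁ h₂ p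
    exact A.tr_tr p

/-- The descended projective bundle is unique up to isomorphism. -/
theorem DescendsTo.iso (hP : A.DescendsTo P) (hQ : A.DescendsTo Q) : P.Iso Q := by
  obtain ⟨θ, hθ⟩ := descendsTo_iff.1 hP
  obtain ⟨η, hη⟩ := descendsTo_iff.1 hQ
  obtain ⟨s, U, hs, hU, hsU⟩ := G.locallySplit.exists_sections
  refine ⟨fun x => (θ (hs x x)).symm.trans (η (hs x x)), fun x => ?_⟩
  have hsm : SmoothMapNear IM id IY id (s x) x :=
    SmoothMapNear.of_contMDiffOn (hU x).1 (hsU x) (hU x).2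
  obtain ⟨f, hf, hfe⟩ := hθ.exists_frame (hs x x)
  obtain ⟨g, hg, hge⟩ := hη.exists_frame (hs x x)
  have hev : ∀ᶠ t in 𝓝 x, ∃ u : EuclideanSpace ℂ (Fin (P.rank x)) ≃ₗᵢ[ℂ]
      EuclideanSpace ℂ (Fin (Q.rank x)),
      (∀ i j, u (EuclideanSpace.single i 1) j = ⟪g j (s x t), f i (s x t)⟫_ℂ) ∧
      ∀ p, ((θ (hs t t)).symm.trans (η (hs t t))) (P.chart x t p) =
        Q.chart x t (projMap u p) := by
    filter_upwards [hsm.1.eventually hfe, hsm.1.eventually hge] with t ⟨e, he, hep⟩ ⟨e', he', hep'⟩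
    refine ⟨e.trans e'.symm, fun i j => ?_, fun p => ?_⟩
    · rw [euclidean_coord, LinearIsometryEquiv.trans_apply, inner_symm_apply, he, he']
    · rw [← hep (hs x t), ← hep' (hs x t), ← hθ.tr_eq (hs t t) (hs x t), Equiv.trans_apply,
        Equiv.symm_apply_apply, hη.tr_eq (hs t t) (hs x t), ← projMap_trans]
      congr 2
      ext v
      simp
  obtain ⟨u₀, -⟩ := hev.self_of_nhds
  obtain ⟨u, hu⟩ := exists_choice_of_eventually (fun _ => ⟨u₀⟩) hev
  refine ⟨u, fun i j => ?_, hu.mono fun y h => h.2⟩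
  refine (HermitianBundle.SmoothSectionNear.inner (V := A.E) (f := s x) hsm.1
    ((hg j).comp hsm) ((hf i).comp hsm)).congr ?_
  filter_upwards [hu] with y hy using hy.1 i j

/-- A smooth unitary lift of the inverse isomorphism, written in charts, rotates a frame lifting a
chart of `P` into one lifting a chart of `Q`. -/
theorem DescendsTo.of_iso (hP : A.DescendsTo P) (h : P.Iso Q) : A.DescendsTo Q := by
  obtain ⟨θ, hθ⟩ := descendsTo_iff.1 hP
  obtain ⟨η, hη⟩ := h
  refine descendsTo_iff.2 ⟨fun {x y} h => (θ h).trans (η x), ?_, fun {x y₁ y₂} h₁ h₂ p => ?_⟩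
  · intro x₀ y₀ h₀
    obtain ⟨f, hf, hfe⟩ := hθ.exists_frame h₀
    obtain ⟨u, hu, hue⟩ := (hη x₀).symm
    have hπ := G.locallySplit.smoothMapNear y₀
    refine ⟨fun i y => ∑ j, u (π y) (EuclideanSpace.single i 1) j • f j y, fun i => ?_, ?_⟩
    · refine HermitianBundle.SmoothSectionNear.sum Finset.univ fun j _ => (hf j).smul ?_
      exact SmoothNear.comp (by rw [h₀]; exact hu i j) hπ
    · have hue' : ∀ᶠ y in 𝓝 y₀, ∀ p, (η (π y)).symm (Q.chart x₀ (π y) p) =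
          P.chart x₀ (π y) (projMap (u (π y)) p) := hπ.1.eventually (by rw [h₀]; exact hue)
      filter_upwards [hfe, hue'] with y ⟨e, he, hep⟩ hy
      refine ⟨(u (π y)).trans e, fun i => ?_, ?_⟩
      · rw [LinearIsometryEquiv.trans_apply, isometryEquiv_eq_sum]
        simp only [he]
      · rintro x rfl p
        rw [Equiv.trans_apply, projMap_trans, hep, ← hy, Equiv.apply_symm_apply]
  · exact congrArg (η x) (hθ.tr_eq h₁ h₂ p)

/-- Descent data are transported along fibrewise projective bijections that lift locally to smooth
unitary maps. -/
theorem DescendsTo.of_local_lift (hB : B.DescendsTo P)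
    (T : ∀ y, ℙ ℂ (B.E.Fiber y) ≃ ℙ ℂ (A.E.Fiber y))
    (hT : ∀ {y₁ y₂ : Y} (h : π y₁ = π y₂) p, T y₁ (B.tr h p) = A.tr h (T y₂ p))
    (hl : ∀ y₀, ∃ Ψ : ∀ y, B.E.Fiber y ≃ₗᵢ[ℂ] A.E.Fiber y,
      (∀ j, A.E.SmoothSectionNear IY (id : Y → Y) id (fun y => Ψ y (B.E.frame y₀ j y)) y₀) ∧
      ∀ y p, projMap (Ψ y) p = T y p) : A.DescendsTo P := by
  obtain ⟨θ, hθ⟩ := descendsTo_iff.1 hB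
  refine descendsTo_iff.2 ⟨fun {x y} h => (T y).symm.trans (θ h), ?_, fun {x y₁ y₂} h₁ h₂ p => ?_⟩
  · intro x₀ y₀ h₀
    obtain ⟨f, hf, hfe⟩ := hθ.exists_frame h₀
    obtain ⟨Ψ, hΨ, hΨT⟩ := hl y₀
    refine ⟨fun i y => Ψ y (f i y), fun i => ?_, ?_⟩
    · exact SmoothSec.map (e := fun i y => B.E.frame y₀ i y) (e' := fun i y => A.E.frame y₀ i y)
        (hf i) (B.E.eventually_isONB (f := id) continuousAt_id (B.E.mem_dom _))
        (fun y => (Ψ y).toLinearEquiv.toLinearMap) hΨ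
    · filter_upwards [hfe] with y ⟨e, he, hep⟩
      refine ⟨e.trans (Ψ y), fun i => ?_, fun {x} h p => ?_⟩
      · rw [LinearIsometryEquiv.trans_apply, he]
      · rw [projMap_trans, hΨT, Equiv.trans_apply, Equiv.symm_apply_apply, hep]
  · rw [Equiv.trans_apply, Equiv.trans_apply, ← hθ.tr_eq h₁ h₂]
    congr 1
    rw [Equiv.symm_apply_eq, hT, Equiv.apply_symm_apply]

theorem DescendsTo.of_module_iso (hB : B.DescendsTo P) (h : B.Iso A) : A.DescendsTo P := by
  obtain ⟨θ, hθ, hθa⟩ := h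
  refine hB.of_local_lift (fun y => projEquiv (θ y)) (fun {y₁ y₂} h p => ?_)
    fun y₀ => ⟨θ, fun j => hθ y₀ j, fun y p => rfl⟩
  obtain ⟨a, ha⟩ := G.exists_norm_eq_one (ypair h)
  rw [B.tr_eq a ha, A.tr_eq a ha, projEquiv_apply, projEquiv_apply, ← projMap_trans,
    ← projMap_trans]
  congr 1
  ext v
  simp [hθa]

/-- A unit vector `k` of `K_x` gives a unitary map `e ↦ Θ(k ⊗ e)` from `B_y` to `A_y`, whose
projectivisation does not depend on `k`. Taking `k` from a local frame of `K` makes it smooth near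
any given point. -/
theorem DescendsTo.of_isTwist (hB : B.DescendsTo P) {K : HermitianBundle IM (id : M → M)}
    (hK : K.IsLine) (h : IsTwist K A B) : A.DescendsTo P := by
  classical
  obtain ⟨Θ, hΘ, hΘa⟩ := h
  have hfr := K.finrank_of_isLine hK
  choose k₀ hk₀ using fun x => exists_norm_eq_one_of_finrank (hfr x)
  let T : ∀ {x : M} {y : Y} (h : π y = x), ℙ ℂ (B.E.Fiber y) ≃ ℙ ℂ (A.E.Fiber y) :=
    fun {x y} h => projEquiv (tensorLineIso (hfr x) (Θ h) (hk₀ x))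
  have hTr : ∀ {x : M} {y : Y} (h : π y = x) p, T h p = T rfl p := by
    rintro x y rfl p; rfl
  have hTk : ∀ {x : M} {y : Y} (h : π y = x) {k : K.Fiber x} (hk : ‖k‖ = 1) p,
      T h p = projMap (tensorLineIso (hfr x) (Θ h) hk) p := by
    intro x y h k hk p
    refine projMap_smul_eq (u := tensorLineIso (hfr x) (Θ h) hk) (c := ⟪k, k₀ x⟫_ℂ) (fun v => ?_) p
    rw [tensorLineIso_apply, tensorLineIso_apply, ← map_smul, TensorProduct.smul_tmul',
      ← eq_inner_smul (hfr x) hk]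
  refine hB.of_local_lift (fun y => T rfl) (fun {y₁ y₂} h p => ?_) fun y₀ => ?_
  · obtain ⟨a, ha⟩ := G.exists_norm_eq_one (ypair h)
    rw [B.tr_eq a ha, A.tr_eq a ha, ← hTr h, projEquiv_apply, projEquiv_apply, ← projMap_trans,
      ← projMap_trans]
    congr 1
    ext v
    simp only [LinearIsometryEquiv.trans_apply, actIso_apply, tensorLineIso_apply]
    exact hΘa h rfl _ _ _
  · have h0 : 0 < K.rank (π y₀) := by rw [hK]; exact one_pos
    let k : ∀ y : Y, K.Fiber (π y) := fun y =>
      if ‖K.frame (π y₀) ⟨0, h0⟩ (π y)‖ = 1 then K.frame (π y₀) ⟨0, h0⟩ (π y) else k₀ (π y)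
    have hk : ∀ y, ‖k y‖ = 1 := by
      intro y
      by_cases h : ‖K.frame (π y₀) ⟨0, h0⟩ (π y)‖ = 1
      · simp only [k, h, if_true]
      · simp only [k, h, if_false]
        exact hk₀ _
    refine ⟨fun y => tensorLineIso (hfr (π y)) (Θ rfl) (hk y), fun j => ?_,
      fun y p => (hTk rfl (hk y) p).symm⟩
    refine (hΘ y₀ ⟨0, h0⟩ j).congr ?_
    have hπ := G.locallySplit.smoothMapNear y₀
    filter_upwards [hπ.1.preimage_mem_nhds ((K.isOpen_dom _).mem_nhds (K.mem_dom (π y₀)))]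
      with y hy
    have h1 := (K.isONB hy).norm_eq ⟨0, h0⟩
    rw [tensorLineIso_apply]
    simp only [k, h1, if_true]

end BundleGerbe.GerbeModule

end Descent

/-! ### Local smooth isomorphisms of hermitian bundles -/

section LocalIso

variable {E : Type*} [NormedAddCommGroup E] [NormedSpace ℝ E] {H : Type*} [TopologicalSpace H]
  {I : ModelWithCorners ℝ E H} {N : Type*} [TopologicalSpace N] [ChartedSpace H N]
  {V W : HermitianBundle I (id : N → N)}
  {E' : Type*} [NormedAddCommGroup E'] [NormedSpace ℝ E'] {H' : Type*} [TopologicalSpace H']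
  {I' : ModelWithCorners ℝ E' H'} {N' : Type*} [TopologicalSpace N'] [ChartedSpace H' N']
  {B' : Type*} [TopologicalSpace B'] {inc' : B' → N'}

namespace HermitianBundle

/-- A family of unitary maps is smooth near `b`. -/
def SmoothIsoNear (V W : HermitianBundle I (id : N → N)) (ψ : ∀ b, V.Fiber b ≃ₗᵢ[ℂ] W.Fiber b)
    (b : N) : Prop :=
  ∀ i, W.SmoothSectionNear I id id (fun b' => ψ b' (V.frame b i b')) b

variable {ψ : ∀ b, V.Fiber b ≃ₗᵢ[ℂ] W.Fiber b}

theorem SmoothIsoNear.map {f : B' → N} {b : B'} (hψ : V.SmoothIsoNear W ψ (f b))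
    (hf : SmoothMapNear I' inc' I id f b) {τ : ∀ x, V.Fiber (f x)}
    (hτ : V.SmoothSectionNear I' inc' f τ b) :
    W.SmoothSectionNear I' inc' f (fun x => ψ (f x) (τ x)) b :=
  SmoothSec.map (e := fun i x => V.frame (f b) i (f x)) (e' := fun i x => W.frame (f b) i (f x)) hτ
    (V.eventually_isONB hf.1 (V.mem_dom _)) (fun x => (ψ (f x)).toLinearEquiv.toLinearMap)
    fun i j => SmoothNear.comp (hψ i j) hf

theorem SmoothIsoNear.eventually {b : N} (hψ : V.SmoothIsoNear W ψ b) :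
    ∀ᶠ x in 𝓝 b, V.SmoothIsoNear W ψ x := by
  filter_upwards [eventually_all.2 fun i => SmoothSectionNear.eventually (hψ i),
    (V.isOpen_dom b).mem_nhds (V.mem_dom b)] with x hx hd i
  refine SmoothSec.map (e := fun i y => V.frame b i y) (e' := fun i y => W.frame x i y)
    (σ := fun y => V.frame x i y) ?_ (V.eventually_isONB (f := id) continuousAt_id hd)
    (fun y => (ψ y).toLinearEquiv.toLinearMap) fun j => hx j
  exact smoothSec_frame (SmoothMapNear.id_id x) hd (V.mem_dom x) i

end HermitianBundle

end LocalIso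

/-! ### Modules with the same descent differ by a line bundle -/

section Twist

variable {EM : Type*} [NormedAddCommGroup EM] [NormedSpace ℝ EM] {HM : Type*} [TopologicalSpace HM]
  {IM : ModelWithCorners ℝ EM HM} {M : Type*} [TopologicalSpace M] [ChartedSpace HM M]
  {EY : Type*} [NormedAddCommGroup EY] [NormedSpace ℝ EY] {HY : Type*} [TopologicalSpace HY]
  {IY : ModelWithCorners ℝ EY HY} {Y : Type*} [TopologicalSpace Y] [ChartedSpace HY Y]
  {π : Y → M} {G : BundleGerbe IM IY π}

namespace BundleGerbe

/-- In contrast to `unitFrame`, the section has norm one everywhere, so it defines `actIso` at every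
point. -/
theorem exists_unit_section {E' : Type*} [NormedAddCommGroup E'] [NormedSpace ℝ E'] {H' : Type*}
    [TopologicalSpace H'] {I' : ModelWithCorners ℝ E' H'} {N' : Type*} [TopologicalSpace N']
    [ChartedSpace H' N'] {B : Type*} [TopologicalSpace B] {inc : B → N'}
    {f : B → FibreProd2 π} {b : B} (hf : SmoothMapNear I' inc (IY.prod IY) Subtype.val f b) :
    ∃ σ : ∀ x, G.L.Fiber (f x), (∀ x, ‖σ x‖ = 1) ∧ G.L.SmoothSectionNear I' inc f σ b := by
  have hev : ∀ᶠ x in 𝓝 b, ∃ a : {a : G.L.Fiber (f x) // ‖a‖ = 1},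
      a.1 = G.unitFrame (f b) (f x) := by
    filter_upwards [hf.1.preimage_mem_nhds ((G.L.isOpen_dom _).mem_nhds (G.L.mem_dom (f b)))]
      with x hx
    exact ⟨⟨_, G.norm_unitFrame hx⟩, rfl⟩
  obtain ⟨σ, hσ⟩ := exists_choice_of_eventually
    (fun x => ⟨⟨_, (G.exists_norm_eq_one (f x)).choose_spec⟩⟩) hev
  exact ⟨fun x => (σ x).1, fun x => (σ x).2, (unitFrame_smooth hf (G.L.mem_dom _)).congr hσ⟩

namespace GerbeModule

variable {A B : GerbeModule G} {P : ProjectiveBundle IM M}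

theorem symm_act_smooth {E' : Type*} [NormedAddCommGroup E'] [NormedSpace ℝ E'] {H' : Type*}
    [TopologicalSpace H'] {I' : ModelWithCorners ℝ E' H'} {N' : Type*} [TopologicalSpace N']
    [ChartedSpace H' N'] {X : Type*} [TopologicalSpace X] {inc : X → N'} {φ₁ φ₂ : X → Y} {b : X}
    (hφ₁ : SmoothMapNear I' inc IY id φ₁ b) (hφ₂ : SmoothMapNear I' inc IY id φ₂ b)
    {h₁₂ : ∀ x, π (φ₁ x) = π (φ₂ x)} {σ : ∀ x, G.L.Fiber (ypair (h₁₂ x))}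
    (hσ1 : ∀ x, ‖σ x‖ = 1) {τ : ∀ x, A.E.Fiber (φ₁ x)}
    (hσ : G.L.SmoothSectionNear I' inc (fun x => ypair (h₁₂ x)) σ b)
    (hτ : A.E.SmoothSectionNear I' inc φ₁ τ b) :
    A.E.SmoothSectionNear I' inc φ₂ (fun x => (A.actIso (σ x) (hσ1 x)).symm (τ x)) b := by
  refine SmoothSec.symm_map (e := fun i x => A.E.frame (φ₂ b) i (φ₂ x))
    (e' := fun i x => A.E.frame (φ₁ b) i (φ₁ x)) hτ (A.E.eventually_isONB hφ₁.1 (A.E.mem_dom _))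
    (fun x => A.actIso (σ x) (hσ1 x)) fun i => ?_
  simp only [actIso_apply]
  exact act_smooth hφ₁ hφ₂ hσ (HermitianBundle.smoothSectionNear_frame hφ₂ (A.E.mem_dom _) i)

/-- A unitary map `B_y ≃ A_y` that lifts the identity of the descended projective bundle. -/
def IsLift (θA : ∀ {x : M} {y : Y}, π y = x → (ℙ ℂ (A.E.Fiber y) ≃ P.Fiber x))
    (θB : ∀ {x : M} {y : Y}, π y = x → (ℙ ℂ (B.E.Fiber y) ≃ P.Fiber x)) (y : Y)
    (φ : B.E.Fiber y ≃ₗᵢ[ℂ] A.E.Fiber y) : Prop :=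
  ∀ {x : M} (h : π y = x) p, θA h (projMap φ p) = θB h p

section Lifts

variable {θA : ∀ {x : M} {y : Y}, π y = x → (ℙ ℂ (A.E.Fiber y) ≃ P.Fiber x)}
  {θB : ∀ {x : M} {y : Y}, π y = x → (ℙ ℂ (B.E.Fiber y) ≃ P.Fiber x)}

/-- Both modules have local frames that lift the same chart of `P`, and the unitary map that carries
one frame to the other lifts the identity of `P`. -/
theorem IsDescent.exists_lift (hA : A.IsDescent P θA) (hB : B.IsDescent P θB) (y₀ : Y) :
    ∃ ψ : ∀ y, B.E.Fiber y ≃ₗᵢ[ℂ] A.E.Fiber y, B.E.SmoothIsoNear A.E ψ y₀ ∧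
      ∀ᶠ y in 𝓝 y₀, IsLift θA θB y (ψ y) := by
  have hlocal : ∀ y₀, ∃ (n : ℕ) (f : Fin n → ∀ y, A.E.Fiber y) (g : Fin n → ∀ y, B.E.Fiber y),
      (∀ i, A.E.SmoothSectionNear IY (id : Y → Y) id (f i) y₀) ∧
      (∀ i, B.E.SmoothSectionNear IY (id : Y → Y) id (g i) y₀) ∧
      (∀ᶠ y in 𝓝 y₀, IsONB fun i => g i y) ∧
      ∀ᶠ y in 𝓝 y₀, ∃ e : B.E.Fiber y ≃ₗᵢ[ℂ] A.E.Fiber y,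
        IsLift θA θB y e ∧ ∀ i, e (g i y) = f i y := by
    intro y₀
    obtain ⟨f, hf, hfe⟩ := hA.exists_frame (rfl : π y₀ = π y₀)
    obtain ⟨g, hg, hge⟩ := hB.exists_frame (rfl : π y₀ = π y₀)
    refine ⟨_, f, g, hf, hg, hge.mono fun y ⟨e, he, _⟩ => IsONB.of_iso e he, ?_⟩
    filter_upwards [hfe, hge] with y ⟨e, he, hep⟩ ⟨e', he', hep'⟩
    refine ⟨e'.symm.trans e, fun {x} h p => ?_, fun i => ?_⟩
    · rw [projMap_trans, hep, ← hep' h, ← projMap_trans, LinearIsometryEquiv.symm_trans_self,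
        projMap_refl]
    · rw [LinearIsometryEquiv.trans_apply, ← he', LinearIsometryEquiv.symm_apply_apply, he]
  obtain ⟨n, f, g, hf, hg, hgo, hev⟩ := hlocal y₀
  -- Away from `y₀` some unitary map `B_y ≃ A_y` still has to be supplied; the local statement at
  -- `y` itself yields one.
  obtain ⟨ψ, hψ⟩ := exists_choice_of_eventually (fun y => by
    obtain ⟨_, _, _, _, _, _, h⟩ := hlocal y
    exact ⟨h.self_of_nhds.choose⟩) hev
  refine ⟨ψ, fun j => ?_, hψ.mono fun y h => h.1⟩
  refine SmoothSec.map (e := g) (e' := fun i y => A.E.frame y₀ i y)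
    (σ := fun y => B.E.frame y₀ j y) (fun i => ?_) hgo
    (fun y => (ψ y).toLinearEquiv.toLinearMap) fun i => ?_
  · exact HermitianBundle.SmoothSectionNear.inner (f := id) continuousAt_id (hg i)
      (HermitianBundle.smoothSectionNear_frame (SmoothMapNear.id_id y₀) (B.E.mem_dom _) j)
  · exact SmoothSec.congr (e := fun i y => A.E.frame y₀ i y) (hf i) (hψ.mono fun y h => h.2 i)

theorem IsLift.exists_smul {y : Y} {φ φ' : B.E.Fiber y ≃ₗᵢ[ℂ] A.E.Fiber y}
    (h : IsLift θA θB y φ) (h' : IsLift θA θB y φ') : ∃ c : ℂ, ‖c‖ = 1 ∧ ∀ v, φ' v = c • φ v :=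
  exists_smul_of_projMap_eq φ φ' fun p => (θA rfl).injective (by rw [h rfl, h' rfl])

/-- The lift over `y₁` induced by a lift over `y₂` and a unit vector of `L_{(y₁,y₂)}`. -/
noncomputable def moveLift {y₁ y₂ : Y} {h : π y₁ = π y₂} (a : G.L.Fiber (ypair h)) (ha : ‖a‖ = 1)
    (φ : B.E.Fiber y₂ ≃ₗᵢ[ℂ] A.E.Fiber y₂) : B.E.Fiber y₁ ≃ₗᵢ[ℂ] A.E.Fiber y₁ :=
  ((B.actIso a ha).symm.trans φ).trans (A.actIso a ha)

/-- The phase of `a` cancels in the conjugation, so the moved lift intertwines the actions of all of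
`L_{(y₁,y₂)}`. -/
theorem moveLift_act {y₁ y₂ : Y} {h : π y₁ = π y₂} {a : G.L.Fiber (ypair h)} {ha : ‖a‖ = 1}
    (φ : B.E.Fiber y₂ ≃ₗᵢ[ℂ] A.E.Fiber y₂) (b : G.L.Fiber (ypair h)) (e : B.E.Fiber y₂) :
    moveLift a ha φ (B.act h (b ⊗ₜ e)) = A.act h (b ⊗ₜ φ e) := by
  obtain ⟨z, rfl⟩ : ∃ z : ℂ, b = z • a := ⟨_, eq_inner_smul (G.finrank_L _) ha b⟩
  rw [act_smul_left, map_smul, act_smul_left, ← B.actIso_apply a ha, moveLift,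
    LinearIsometryEquiv.trans_apply, LinearIsometryEquiv.trans_apply,
    LinearIsometryEquiv.symm_apply_apply, actIso_apply]

theorem isLift_moveLift (hA : A.IsDescent P θA) (hB : B.IsDescent P θB) {y₁ y₂ : Y}
    {h : π y₁ = π y₂} (a : G.L.Fiber (ypair h)) (ha : ‖a‖ = 1)
    {φ : B.E.Fiber y₂ ≃ₗᵢ[ℂ] A.E.Fiber y₂} (hφ : IsLift θA θB y₂ φ) :
    IsLift θA θB y₁ (moveLift a ha φ) := by
  intro x hx p
  obtain ⟨q, rfl⟩ := (B.tr h).surjective p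
  rw [hB.tr_eq hx (h.symm.trans hx), B.tr_eq a ha, ← hφ (h.symm.trans hx),
    ← hA.tr_eq hx (h.symm.trans hx), A.tr_eq a ha, ← projMap_trans, ← projMap_trans]
  congr 2
  ext v
  simp [moveLift, -actIso_apply]

end Lifts

/-- Bundle gerbe modules that descend to the same projective bundle differ by the pullback of a
hermitian line bundle. -/
theorem exists_isTwist (hPA : A.DescendsTo P) (hPB : B.DescendsTo P) :
    ∃ K : HermitianBundle IM (id : M → M), K.IsLine ∧ IsTwist K A B := by
  obtain ⟨θA, hA⟩ := descendsTo_iff.1 hPA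
  obtain ⟨θB, hB⟩ := descendsTo_iff.1 hPB
  obtain ⟨s, U, hs, hU, hsU⟩ := G.locallySplit.exists_sections
  have hsm : ∀ i t, t ∈ U i → SmoothMapNear IM id IY id (s i) t := fun i t ht =>
    SmoothMapNear.of_contMDiffOn (hU i).1 (hsU i) ht
  choose ψ hψ hψl using fun x => hA.exists_lift hB (s x x)
  choose ε hε using fun {x : M} {y : Y} (h : π y = x) =>
    G.exists_norm_eq_one (ypair (h.trans (hs x x).symm))
  let φ : ∀ {x : M} {y : Y}, π y = x → (B.E.Fiber y ≃ₗᵢ[ℂ] A.E.Fiber y) :=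
    -- One lift is fixed at a single point of each fibre of `π` and moved to the rest of the fibre
    -- by `L`. It commutes with the action along the fibre, but depends on `x` in an uncontrolled
    -- way.
    fun {x y} h => moveLift (ε h) (hε h) (ψ x (s x x))
  have hφl : ∀ {x y} (h : π y = x), IsLift θA θB y (φ h) := fun {x y} h =>
    isLift_moveLift hA hB _ _ (hψl x).self_of_nhds
  have hφa : ∀ {x : M} {y₁ y₂ : Y} (h₁ : π y₁ = x) (h₂ : π y₂ = x)
      (a : G.L.Fiber (ypair (h₁.trans h₂.symm))) (e : B.E.Fiber y₂),
      φ h₁ (B.act (h₁.trans h₂.symm) (a ⊗ₜ e)) = A.act (h₁.trans h₂.symm) (a ⊗ₜ φ h₂ e) := by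
    intro x y₁ y₂ h₁ h₂ a e
    obtain ⟨e, rfl⟩ := (B.actIso (ε h₂) (hε h₂)).surjective e
    rw [actIso_apply, B.act_mul, moveLift_act, moveLift_act, A.act_mul]
  let A' : M → Set M := fun x => {t | t ∈ U x ∧ B.E.SmoothIsoNear A.E (ψ x) (s x t) ∧
    IsLift θA θB (s x t) (ψ x (s x t))}
  let W : M → Set M := fun x => interior (A' x)
  have hWA : ∀ {x t}, t ∈ W x → t ∈ A' x := fun h => interior_subset h
  have hWm : ∀ x, x ∈ W x := by
    intro x
    rw [mem_interior_iff_mem_nhds]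
    have hc := (hsm x x (hU x).2).1
    filter_upwards [(hU x).1.mem_nhds (hU x).2, hc.eventually (hψ x).eventually,
      hc.eventually (hψl x)] with t a b c using ⟨a, b, c⟩
  -- Along the section `s x` there is also the smooth lift `ψ x`. The phase `κ` between it and `φ`
  -- measures the lack of smoothness of `φ`.
  have hκ : ∀ x t, ∃ c : ℂ, t ∈ W x → ‖c‖ = 1 ∧ ∀ v, ψ x (s x t) v = c • φ (hs x t) v := by
    intro x t
    by_cases ht : t ∈ W x
    · obtain ⟨c, hc⟩ := IsLift.exists_smul (hφl (hs x t)) (hWA ht).2.2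
      exact ⟨c, fun _ => hc⟩
    · exact ⟨0, fun h => absurd h ht⟩
  choose κ hκ using hκ
  have hfrC : Module.finrank ℂ ℂ = 1 := Module.finrank_self ℂ
  -- The fibre `ℂ` at `x` stands for the multiples of `φ` over `x`, and the smooth lifts `ψ x = κ φ`
  -- are the frames. The transition function is the inner product of `ψ_x(σ · τ)` with `σ ·
  -- ψ_{x'}(τ)` for unit sections `σ` of `L` and `τ` of `B`, hence smooth.
  let K : HermitianBundle IM (id : M → M) :=
    { Fiber := fun _ => ℂ
      rank := fun _ => 1
      dom := W
      isOpen_dom := fun _ => isOpen_interior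
      mem_dom := hWm
      frame := fun x _ t => κ x t
      orthonormal_frame := fun x t ht => by
        refine ⟨fun _ => (hκ x t ht).1, fun i j hij => absurd (Subsingleton.elim i j) hij⟩
      span_frame := fun x t ht => by
        refine Submodule.eq_top_iff'.2 fun c => ?_
        rw [eq_inner_smul hfrC (hκ x t ht).1 c]
        exact Submodule.smul_mem _ _ (Submodule.subset_span ⟨0, rfl⟩)
      smooth_frame := fun x x' t ht _ _ => by
        obtain ⟨h1, h2⟩ := ht
        have hm := hsm x t (hWA h1).1
        have hm' := hsm x' t (hWA h2).1
        obtain ⟨σ, hσ1, hσ⟩ := exists_unit_section (G := G)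
          (hm.ypair hm' fun t => (hs x t).trans (hs x' t).symm)
        let τ : ∀ r, B.E.Fiber (s x' r) := fun r => B.E.frame (s x' t) ⟨0, B.rank_pos _⟩ (s x' r)
        have hτ : B.E.SmoothSectionNear IM (id : M → M) (s x') τ t :=
          HermitianBundle.smoothSectionNear_frame hm' (B.E.mem_dom _) _
        refine (HermitianBundle.SmoothSectionNear.inner (V := A.E) (f := s x) hm.1
          (HermitianBundle.SmoothIsoNear.map (hWA h1).2.1 hm (act_smooth hm hm' hσ hτ))
          (act_smooth hm hm' hσ (HermitianBundle.SmoothIsoNear.map (hWA h2).2.1 hm' hτ))).congr ?_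
        filter_upwards [isOpen_interior.mem_nhds h1, isOpen_interior.mem_nhds h2,
          hm'.1.preimage_mem_nhds ((B.E.isOpen_dom _).mem_nhds (B.E.mem_dom (s x' t)))]
          with r hr hr' hrd
        have hn : ‖A.act ((hs x r).trans (hs x' r).symm) (σ r ⊗ₜ φ (hs x' r) (τ r))‖ = 1 := by
          rw [← A.actIso_apply _ (hσ1 r), LinearIsometryEquiv.norm_map,
            LinearIsometryEquiv.norm_map]
          exact (B.E.isONB hrd).norm_eq _
        rw [(hκ x r hr).2, (hκ x' r hr').2, hφa (hs x r) (hs x' r), act_smul_right,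
          inner_smul_left, inner_smul_right, inner_self_eq_norm_sq_to_K, hn]
        simp [mul_comm] }
  have hone : ‖(1 : ℂ)‖ = 1 := norm_one
  let Θ : ∀ {x : M} {y : Y}, π y = x → (K.Fiber x ⊗[ℂ] B.E.Fiber y ≃ₗᵢ[ℂ] A.E.Fiber y) :=
    fun {x y} h => lineTensorIso hfrC hone (φ h)
  have hΘ : ∀ {x : M} {y : Y} (h : π y = x) (k : K.Fiber x) (e : B.E.Fiber y),
      Θ h (k ⊗ₜ e) = (show ℂ from k) • φ h e := by
    intro x y h k e
    refine (lineTensorIso_tmul hfrC hone (φ h) k e).trans ?_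
    congr 1
    exact inner_eq_of_eq_smul (by simp) hone
  refine ⟨K, fun _ => rfl, Θ, fun y₀ i j => ?_, fun {x y₁ y₂} h₁ h₂ k a e => ?_⟩
  · have hπ := G.locallySplit.smoothMapNear y₀
    have hs' : SmoothMapNear IY id IY id (fun y => s (π y₀) (π y)) y₀ :=
      (hsm (π y₀) (π y₀) (hU _).2).comp hπ
    obtain ⟨σ, hσ1, hσ⟩ := exists_unit_section (G := G)
      ((SmoothMapNear.id_id y₀).ypair hs' fun y => (hs (π y₀) (π y)).symm)
    have hfr : B.E.SmoothSectionNear IY (id : Y → Y) (fun y => y)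
        (fun y => B.E.frame y₀ j y) y₀ :=
      HermitianBundle.smoothSectionNear_frame (SmoothMapNear.id_id y₀) (B.E.mem_dom _) j
    refine (act_smooth (SmoothMapNear.id_id y₀) hs' hσ
      (HermitianBundle.SmoothIsoNear.map (f := fun y => s (π y₀) (π y)) (hψ (π y₀)) hs'
        (symm_act_smooth (SmoothMapNear.id_id y₀) hs' hσ1 hσ hfr))).congr ?_
    -- Equivariance of `φ` identifies `κ φ(e)` with `σ · ψ(σ⁻¹ · e)`, which is smooth in `y`.
    filter_upwards [hπ.1.preimage_mem_nhds (isOpen_interior.mem_nhds (hWm (π y₀)))] with y hy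
    rw [hΘ, (hκ (π y₀) (π y) hy).2, act_smul_right, ← hφa rfl (hs (π y₀) (π y)),
      ← B.actIso_apply _ (hσ1 y), LinearIsometryEquiv.apply_symm_apply]
    rfl
  · rw [hΘ, hΘ, hφa h₁ h₂, act_smul_right]

end GerbeModule

end BundleGerbe

end Twist

/-! ### Modules from twisted cocycles -/

section Twisted

variable {EM : Type*} [NormedAddCommGroup EM] [NormedSpace ℝ EM] {HM : Type*} [TopologicalSpace HM]
  {IM : ModelWithCorners ℝ EM HM} {M : Type*} [TopologicalSpace M] [ChartedSpace HM M]
  {EY : Type*} [NormedAddCommGroup EY] [NormedSpace ℝ EY] {HY : Type*} [TopologicalSpace HY]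
  {IY : ModelWithCorners ℝ EY HY} {Y : Type*} [TopologicalSpace Y] [ChartedSpace HY Y]
  {π : Y → M}

namespace BundleGerbe

/-- Local data for a bundle gerbe module: unitary transition functions `u` of ranks `r` whose
failure to be a cocycle is that of local unit sections `σ` of the line bundle of the gerbe. -/
structure TwistedCocycle (G : BundleGerbe IM IY π) (r : M → ℕ) where
  W : M → Set M
  s : M → M → Y
  π_s : ∀ x t, π (s x t) = t
  σ : ∀ x y t, G.L.Fiber (ypair ((π_s x t).trans (π_s y t).symm))
  u : ∀ x y, M → (EuclideanSpace ℂ (Fin (r y)) →ₗ[ℂ] EuclideanSpace ℂ (Fin (r x)))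
  g : M → M → M → M → ℂ
  isPointedCover : IsPointedCover W
  contMDiffOn_s : ∀ x, ContMDiffOn IM IY ∞ (s x) (W x)
  norm_σ : ∀ {x y t}, t ∈ W x → t ∈ W y → ‖σ x y t‖ = 1
  smooth_σ : ∀ {x y t}, t ∈ W x → t ∈ W y → G.L.SmoothSectionNear IM (id : M → M)
    (fun t' => ypair ((π_s x t').trans (π_s y t').symm)) (σ x y) t
  prod_σ : ∀ {x y z t}, t ∈ W x → t ∈ W y → t ∈ W z →
    prod (σ x y t) (σ y z t) = g x y z t • σ x z t
  smooth_u : ∀ {x y t}, t ∈ W x → t ∈ W y → SmoothMatrixNear IM id (fun t' => u x y t') t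
  exists_iso : ∀ {x y t}, t ∈ W x → t ∈ W y →
    ∃ e : EuclideanSpace ℂ (Fin (r y)) ≃ₗᵢ[ℂ] EuclideanSpace ℂ (Fin (r x)), ∀ v, u x y t v = e v
  u_comp : ∀ {x y z t}, t ∈ W x → t ∈ W y → t ∈ W z → ∀ v,
    u x y t (u y z t v) = g x y z t • u x z t v

namespace TwistedCocycle

variable {G : BundleGerbe IM IY π} {r : M → ℕ} (T : TwistedCocycle G r)

theorem mem_W (x : M) : x ∈ T.W x := (T.isPointedCover x).2

theorem norm_g {x y z t : M} (hx : t ∈ T.W x) (hy : t ∈ T.W y) (hz : t ∈ T.W z) :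
    ‖T.g x y z t‖ = 1 := by
  have h := congrArg norm (T.prod_σ hx hy hz)
  rw [norm_prod, norm_smul, T.norm_σ hx hy, T.norm_σ hy hz, T.norm_σ hx hz, mul_one, mul_one] at h
  exact h.symm

/-- A unit vector of `L_{(y, s)}`, where `s` is the value at `x = π y` of the local section around
`x`. -/
noncomputable def ε {x : M} {y : Y} (h : π y = x) :
    G.L.Fiber (ypair (h.trans (T.π_s x x).symm)) :=
  (G.exists_norm_eq_one _).choose

theorem norm_ε {x : M} {y : Y} (h : π y = x) : ‖T.ε h‖ = 1 := (G.exists_norm_eq_one _).choose_spec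

/-- The fibre of the module. -/
abbrev Fib (_ : TwistedCocycle G r) (y : Y) : Type := EuclideanSpace ℂ (Fin (r (π y)))

/-- The fibre over `y` depends only on `π y`. -/
noncomputable def τ {x : M} {y : Y} (h : π y = x) :
    T.Fib y ≃ₗᵢ[ℂ] EuclideanSpace ℂ (Fin (r x)) := by
  subst h
  exact LinearIsometryEquiv.refl ℂ _

/-- The vector of `ℂ^{r x}` with coordinates `v` with respect to `x₀` and `a ∈ L_{(y, s)}`, where
`s` is the value at `x = π y` of the local section around `x₀`. -/
noncomputable def vec {x : M} {y : Y} (h : π y = x) {x₀ : M}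
    (a : G.L.Fiber (ypair (h.trans (T.π_s x₀ x).symm))) (v : EuclideanSpace ℂ (Fin (r x₀))) :
    EuclideanSpace ℂ (Fin (r x)) :=
  ⟪prod (T.ε h) (T.σ x x₀ x), a⟫_ℂ • T.u x x₀ x v

theorem τ_vec {x : M} {y : Y} (h : π y = x) {x₀ : M}
    (a : G.L.Fiber (ypair (h.trans (T.π_s x₀ x).symm))) (v : EuclideanSpace ℂ (Fin (r x₀))) :
    T.τ h (T.vec rfl (by subst h; exact a) v) = T.vec h a v := by
  subst h
  rfl

section Vec

variable {x : M} {y : Y} {h : π y = x} {x₀ x₁ : M}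

variable (h) in
theorem norm_prod_ε_σ (hx : x ∈ T.W x₀) : ‖prod (T.ε h) (T.σ x x₀ x)‖ = 1 := by
  rw [norm_prod, T.norm_ε, T.norm_σ (T.mem_W x) hx, one_mul]

/-- The fibre over `y` is the union of the `L_{(y,s)} ⊗ ℂ^r` glued by `σ` and `u`, identified with
`ℂ^{r x}` through the chart indexed by `x = π y` itself. That identification is not smooth in `y`,
but it drops out of inner products: the factor `g` from `prod_σ` cancels the one from `u_comp`. The
right-hand side involves only smooth data. -/
theorem inner_vec (hx₀ : x ∈ T.W x₀) (hx₁ : x ∈ T.W x₁)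
    (a : G.L.Fiber (ypair (h.trans (T.π_s x₀ x).symm))) (v : EuclideanSpace ℂ (Fin (r x₀)))
    (b : G.L.Fiber (ypair (h.trans (T.π_s x₁ x).symm))) (w : EuclideanSpace ℂ (Fin (r x₁))) :
    ⟪T.vec h a v, T.vec h b w⟫_ℂ = ⟪prod a (T.σ x₀ x₁ x), b⟫_ℂ * ⟪v, T.u x₀ x₁ x w⟫_ℂ := by
  have hm := T.mem_W x
  obtain ⟨α, rfl⟩ : ∃ α : ℂ, a = α • prod (T.ε h) (T.σ x x₀ x) :=
    ⟨_, eq_inner_smul (G.finrank_L _) (T.norm_prod_ε_σ _ hx₀) a⟩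
  have hg := T.norm_g hm hx₀ hx₁
  have h1 : prod (prod (T.ε h) (T.σ x x₀ x)) (T.σ x₀ x₁ x) =
      T.g x x₀ x₁ x • prod (T.ε h) (T.σ x x₁ x) := by
    rw [prod_assoc, T.prod_σ hm hx₀ hx₁, prod_smul_right]
  obtain ⟨e, he⟩ := T.exists_iso hm hx₀
  have h2 : ⟪v, T.u x₀ x₁ x w⟫_ℂ = T.g x x₀ x₁ x * ⟪T.u x x₀ x v, T.u x x₁ x w⟫_ℂ := by
    rw [← inner_smul_right, ← T.u_comp hm hx₀ hx₁, he, he, e.inner_map_map]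
  have h3 : starRingEnd ℂ (T.g x x₀ x₁ x) * T.g x x₀ x₁ x = 1 := by
    rw [RCLike.conj_mul, hg]; simp
  rw [vec, vec, prod_smul_left, h1, h2, inner_smul_left, inner_smul_left, inner_smul_left,
    inner_smul_right, inner_smul_right, inner_self_eq_norm_sq_to_K, T.norm_prod_ε_σ h hx₀]
  simp only [RCLike.ofReal_one, one_pow, mul_one]
  linear_combination (-(starRingEnd ℂ α) * ⟪prod (T.ε h) (T.σ x x₁ x), b⟫_ℂ *
    ⟪T.u x x₀ x v, T.u x x₁ x w⟫_ℂ) * h3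

theorem exists_vecIso (hx₀ : x ∈ T.W x₀) {a : G.L.Fiber (ypair (h.trans (T.π_s x₀ x).symm))}
    (ha : ‖a‖ = 1) : ∃ e : EuclideanSpace ℂ (Fin (r x₀)) ≃ₗᵢ[ℂ] EuclideanSpace ℂ (Fin (r x)),
      ∀ v, e v = T.vec h a v := by
  obtain ⟨e, he⟩ := T.exists_iso (T.mem_W x) hx₀
  refine ⟨e.trans (tensorLineIso (Module.finrank_self ℂ) (TensorProduct.lidIsometry ℂ _)
    (norm_inner_eq_one (G.finrank_L _) (T.norm_prod_ε_σ h hx₀) ha)), fun v => ?_⟩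
  rw [LinearIsometryEquiv.trans_apply, tensorLineIso_apply, vec, he]
  simp

end Vec

section Act

variable {x : M} {y₁ y₂ y₃ : Y}

/-- `ζ` is the quotient of `ε` at `y₁` by `ε` at `y₂`, and multiplication by the latter is unitary.
-/
theorem exists_divide (h₁ : π y₁ = x) (h₂ : π y₂ = x) :
    ∃ ζ : G.L.Fiber (ypair (h₁.trans h₂.symm)), ‖ζ‖ = 1 ∧
      ∀ a : G.L.Fiber (ypair (h₁.trans h₂.symm)), ⟪ζ, a⟫_ℂ = ⟪T.ε h₁, prod a (T.ε h₂)⟫_ℂ := by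
  obtain ⟨b, hb⟩ := G.exists_norm_eq_one (ypair (h₁.trans h₂.symm))
  have hc := norm_inner_eq_one (G.finrank_L _) (T.norm_ε h₁)
    (show ‖prod b (T.ε h₂)‖ = 1 by rw [norm_prod, hb, T.norm_ε, one_mul])
  refine ⟨starRingEnd ℂ ⟪T.ε h₁, prod b (T.ε h₂)⟫_ℂ • b, ?_, fun a => ?_⟩
  · rw [norm_smul, RCLike.norm_conj, hb, mul_one]; exact hc
  · conv_rhs => rw [eq_inner_smul (G.finrank_L _) hb a, prod_smul_left, inner_smul_right]
    rw [inner_smul_left, RCLike.conj_conj, mul_comm]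

/-- The action of the gerbe. -/
noncomputable def act (h : π y₁ = π y₂) :
    G.L.Fiber (ypair h) ⊗[ℂ] T.Fib y₂ ≃ₗᵢ[ℂ] T.Fib y₁ :=
  lineTensorIso (G.finrank_L _) (T.exists_divide h rfl).choose_spec.1 (T.τ h).symm

/-- After identifying both fibres with `ℂ^{r x}`, the vector `a` acts as the scalar that compares `a
ε₂` with `ε₁`. Compatibility with the product then comes down to associativity in `L`. -/
theorem τ_act (h₁ : π y₁ = x) (h₂ : π y₂ = x) (a : G.L.Fiber (ypair (h₁.trans h₂.symm)))
    (e : T.Fib y₂) : T.τ h₁ (T.act (h₁.trans h₂.symm) (a ⊗ₜ e)) =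
      ⟪T.ε h₁, prod a (T.ε h₂)⟫_ℂ • T.τ h₂ e := by
  subst h₂
  rw [act, lineTensorIso_tmul, (T.exists_divide h₁ rfl).choose_spec.2, map_smul,
    LinearIsometryEquiv.apply_symm_apply]
  rfl

theorem act_mul (h₁₂ : π y₁ = π y₂) (h₂₃ : π y₂ = π y₃) (a : G.L.Fiber (ypair h₁₂))
    (b : G.L.Fiber (ypair h₂₃)) (e : T.Fib y₃) :
    T.act h₁₂ (a ⊗ₜ T.act h₂₃ (b ⊗ₜ e)) = T.act (h₁₂.trans h₂₃) (prod a b ⊗ₜ e) := by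
  apply (T.τ (h₁₂.trans h₂₃)).injective
  rw [T.τ_act (h₁₂.trans h₂₃) h₂₃, T.τ_act h₂₃ rfl, T.τ_act (h₁₂.trans h₂₃) rfl, smul_smul,
    prod_assoc, eq_inner_smul (G.finrank_L _) (T.norm_ε h₂₃) (prod b (T.ε rfl)), prod_smul_right,
    inner_smul_right, inner_smul_right, inner_self_eq_norm_sq_to_K, T.norm_ε]
  congr 1
  simp [mul_comm]

/-- In local coordinates the gerbe acts on the `L`-factor alone, so the action is smooth because the
product is. -/
theorem act_vec {h : π y₁ = π y₂} {x₀ : M} (hx₀ : π y₂ ∈ T.W x₀) (b : G.L.Fiber (ypair h))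
    (a : G.L.Fiber (ypair (T.π_s x₀ (π y₂)).symm)) (v : EuclideanSpace ℂ (Fin (r x₀))) :
    T.τ h (T.act h (b ⊗ₜ T.vec rfl a v)) = T.vec h (prod b a) v := by
  rw [T.τ_act h rfl, T.τ_vec rfl, vec, vec, smul_smul]
  congr 1
  conv_rhs => rw [eq_inner_smul (G.finrank_L _) (T.norm_prod_ε_σ _ hx₀) a, prod_smul_right,
    ← prod_assoc, eq_inner_smul (G.finrank_L _) (T.norm_ε h) (prod b (T.ε rfl)), prod_smul_left]
  rw [inner_smul_right, inner_smul_right, inner_self_eq_norm_sq_to_K, T.norm_prod_ε_σ h hx₀]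
  simp [mul_comm]

end Act

/-! ### The smooth structure of the module of a twisted cocycle -/

section Bundle

theorem smooth_s {x t : M} (h : t ∈ T.W x) : SmoothMapNear IM id IY id (T.s x) t :=
  SmoothMapNear.of_contMDiffOn (T.isPointedCover x).1 (T.contMDiffOn_s x) h

/-- The point `(y, s)` of the fibre product, where `s` is the value at `π y` of the local section
around `x`. -/
abbrev pt (x : M) (y : Y) : FibreProd2 π := ypair (T.π_s x (π y)).symm

variable {E' : Type*} [NormedAddCommGroup E'] [NormedSpace ℝ E'] {H' : Type*} [TopologicalSpace H']
  {I' : ModelWithCorners ℝ E' H'} {N' : Type*} [TopologicalSpace N'] [ChartedSpace H' N']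
  {B : Type*} [TopologicalSpace B] {inc : B → N'} {f : B → Y} {b : B}

theorem smooth_s_comp (hf : SmoothMapNear I' inc IY id f b) {x : M} (h : π (f b) ∈ T.W x) :
    SmoothMapNear I' inc IY id (fun c => T.s x (π (f c))) b :=
  SmoothMapNear.comp (φ := fun c => π (f c)) (T.smooth_s h)
    ((G.locallySplit.smoothMapNear (f b)).comp hf)

theorem smooth_pt (hf : SmoothMapNear I' inc IY id f b) {x : M} (h : π (f b) ∈ T.W x) :
    SmoothMapNear I' inc (IY.prod IY) Subtype.val (fun c => T.pt x (f c)) b :=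
  hf.ypair (T.smooth_s_comp hf h) _

/-- Smoothness of the inner products of local sections of the module. -/
theorem smooth_inner_vec (hf : SmoothMapNear I' inc IY id f b) {x₀ x₁ : M} (h₀ : π (f b) ∈ T.W x₀)
    (h₁ : π (f b) ∈ T.W x₁) {α : ∀ c, G.L.Fiber (T.pt x₀ (f c))}
    {β : ∀ c, G.L.Fiber (T.pt x₁ (f c))}
    (hα : G.L.SmoothSectionNear I' inc (fun c => T.pt x₀ (f c)) α b)
    (hβ : G.L.SmoothSectionNear I' inc (fun c => T.pt x₁ (f c)) β b) (i : Fin (r x₀))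
    (j : Fin (r x₁)) :
    SmoothNear I' inc (fun c => ⟪T.vec rfl (α c) (EuclideanSpace.single i 1),
      T.vec rfl (β c) (EuclideanSpace.single j 1)⟫_ℂ) b := by
  have hπ := (G.locallySplit.smoothMapNear (f b)).comp hf
  have h1 := HermitianBundle.SmoothSectionNear.inner (T.smooth_pt hf h₁).1
    (prod_smooth hf (T.smooth_s_comp hf h₀) (T.smooth_s_comp hf h₁) hα
      (HermitianBundle.SmoothSectionNear.comp (φ := fun c => π (f c)) (T.smooth_σ h₀ h₁) hπ)) hβ
  have h2 := SmoothNear.comp (φ := fun c => π (f c)) (T.smooth_u h₀ h₁ j i) hπ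
  refine (h1.mul h2).congr ?_
  filter_upwards [hπ.1.preimage_mem_nhds ((T.isPointedCover x₀).1.mem_nhds h₀),
    hπ.1.preimage_mem_nhds ((T.isPointedCover x₁).1.mem_nhds h₁)] with c hc₀ hc₁
  rw [T.inner_vec hc₀ hc₁, ← euclidean_coord]

theorem smooth_inner_τ_vec (hf : SmoothMapNear I' inc IY id f b) {m : B → M}
    (h : ∀ c, π (f c) = m c) {x₀ x₁ : M} (h₀ : π (f b) ∈ T.W x₀)
    (h₁ : π (f b) ∈ T.W x₁) {α : ∀ c, G.L.Fiber (T.pt x₀ (f c))}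
    {β : ∀ c, G.L.Fiber (ypair ((h c).trans (T.π_s x₁ (m c)).symm))}
    (hα : G.L.SmoothSectionNear I' inc (fun c => T.pt x₀ (f c)) α b)
    (hβ : G.L.SmoothSectionNear I' inc (fun c => ypair ((h c).trans (T.π_s x₁ (m c)).symm)) β b)
    (i : Fin (r x₀)) (j : Fin (r x₁)) :
    SmoothNear I' inc (fun c => ⟪T.τ (h c) (T.vec rfl (α c) (EuclideanSpace.single i 1)),
      T.vec (h c) (β c) (EuclideanSpace.single j 1)⟫_ℂ) b := by
  obtain rfl : (fun c => π (f c)) = m := funext h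
  exact T.smooth_inner_vec hf h₀ h₁ hα hβ i j

/-- The domain of the frame of the module around `y₀`. -/
def frameDom (y₀ : Y) : Set Y :=
  π ⁻¹' T.W (π y₀) ∩ T.pt (π y₀) ⁻¹' G.L.dom (T.pt (π y₀) y₀)

/-- The unit section of `L` used in the frame of the module around `y₀`. -/
def frameUnit (y₀ y : Y) : G.L.Fiber (T.pt (π y₀) y) := G.unitFrame (T.pt (π y₀) y₀) _

theorem frameUnit_smooth (hf : SmoothMapNear I' inc IY id f b) {y₀ : Y} (h : f b ∈ T.frameDom y₀) :
    G.L.SmoothSectionNear I' inc (fun c => T.pt (π y₀) (f c)) (fun c => T.frameUnit y₀ (f c)) b :=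
  unitFrame_smooth (T.smooth_pt hf h.1) h.2

theorem mem_frameDom (y₀ : Y) : y₀ ∈ T.frameDom y₀ := ⟨T.mem_W _, G.L.mem_dom _⟩

theorem exists_frame_iso {y₀ y : Y} (h : y ∈ T.frameDom y₀) :
    ∃ e : EuclideanSpace ℂ (Fin (r (π y₀))) ≃ₗᵢ[ℂ] T.Fib y,
      ∀ v, e v = T.vec rfl (T.frameUnit y₀ y) v :=
  T.exists_vecIso h.1 (G.norm_unitFrame h.2)

theorem isONB_frame {y₀ y : Y} (h : y ∈ T.frameDom y₀) :
    IsONB fun i => (T.vec rfl (T.frameUnit y₀ y) (EuclideanSpace.single i 1) : T.Fib y) := by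
  obtain ⟨e, he⟩ := T.exists_frame_iso h
  exact IsONB.of_iso e fun i => he _

/-- The hermitian bundle underlying the module. -/
noncomputable def bundle : HermitianBundle IY (id : Y → Y) where
  Fiber := T.Fib
  rank y := r (π y)
  dom := T.frameDom
  isOpen_dom y₀ := by
    have hc : Continuous π := G.locallySplit.1.continuous
    refine ContinuousOn.isOpen_inter_preimage (fun y hy => ?_)
      ((T.isPointedCover _).1.preimage hc) (G.L.isOpen_dom _)
    exact (T.smooth_pt (f := fun y => y) (SmoothMapNear.id_id y) hy).1.continuousWithinAt
  mem_dom := T.mem_frameDom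
  frame y₀ i y := T.vec rfl (T.frameUnit y₀ y) (EuclideanSpace.single i 1)
  orthonormal_frame _ _ h := (T.isONB_frame h).1
  span_frame _ _ h := (T.isONB_frame h).2
  smooth_frame y₀ y₁ y h i j := T.smooth_inner_vec (f := fun y => y) (SmoothMapNear.id_id y) h.1.1
    h.2.1 (T.frameUnit_smooth (f := fun y => y) (SmoothMapNear.id_id y) h.1)
    (T.frameUnit_smooth (f := fun y => y) (SmoothMapNear.id_id y) h.2) i j

theorem smooth_act (q₀ : FibreProd2 π) (i j) :
    T.bundle.SmoothSectionNear (IY.prod IY) (Subtype.val : FibreProd2 π → Y × Y) (fun q => q.1.1)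
      (fun q => T.act q.2 (G.L.frame q₀ i q ⊗ₜ T.bundle.frame q₀.1.2 j q.1.2)) q₀ := by
  intro k
  have h₁ : SmoothMapNear (IY.prod IY) (Subtype.val : FibreProd2 π → Y × Y) IY id
      (fun q => q.1.1) q₀ :=
    ⟨by fun_prop, univ, Prod.fst, isOpen_univ, mem_univ _, contMDiff_fst.contMDiffOn,
      EventuallyEq.rfl⟩
  have h₂ : SmoothMapNear (IY.prod IY) (Subtype.val : FibreProd2 π → Y × Y) IY id
      (fun q => q.1.2) q₀ :=
    ⟨by fun_prop, univ, Prod.snd, isOpen_univ, mem_univ _, contMDiff_snd.contMDiffOn,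
      EventuallyEq.rfl⟩
  have hid : SmoothMapNear (IY.prod IY) (Subtype.val : FibreProd2 π → Y × Y) (IY.prod IY)
      Subtype.val (fun q : FibreProd2 π => q) q₀ := h₁.ypair h₂ fun q => q.2
  have hq : π q₀.1.1 ∈ T.W (π q₀.1.2) := by rw [q₀.2]; exact T.mem_W _
  have hℓ : G.L.SmoothSectionNear (IY.prod IY) (Subtype.val : FibreProd2 π → Y × Y) (fun q => q)
      (fun q => G.L.frame q₀ i q) q₀ :=
    HermitianBundle.smoothSectionNear_frame hid (G.L.mem_dom _) i
  have hs : SmoothMapNear (IY.prod IY) (Subtype.val : FibreProd2 π → Y × Y) IY id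
      (fun q => T.s (π q₀.1.2) (π q.1.2)) q₀ := T.smooth_s_comp h₂ (T.mem_W _)
  refine (T.smooth_inner_τ_vec h₁ (m := fun q => π q.1.2) (fun q => q.2) (T.mem_W _) hq
    (T.frameUnit_smooth h₁ (T.mem_frameDom _))
    (prod_smooth (h₁₂ := fun q => q.2) h₁ h₂ hs hℓ
      (T.frameUnit_smooth h₂ (T.mem_frameDom _))) k j).congr ?_
  filter_upwards [h₂.1.preimage_mem_nhds
    ((T.bundle.isOpen_dom _).mem_nhds (T.bundle.mem_dom q₀.1.2))] with q hq₂
  rw [← T.act_vec hq₂.1, LinearIsometryEquiv.inner_map_map]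
  rfl

end Bundle

/-- The bundle gerbe module defined by a twisted cocycle. -/
noncomputable def toGerbeModule (hr : ∀ x, 0 < r x) : GerbeModule G where
  E := T.bundle
  rank_pos y := hr (π y)
  act h := T.act h
  smooth_act := T.smooth_act
  act_mul := T.act_mul

/-- The fibre over `y` is `ℂ^{r x}` with `x = π y`, and the chart `k x` of `P` at `x` projects it to
`P_x`. The matrices `u` project to the transition functions of `P`, so the frames of the module lift
charts of `P`; the scalars in `vec` and in the action vanish projectively. -/
theorem toGerbeModule_descendsTo {P : ProjectiveBundle IM M} {k : M → M}
    (T : TwistedCocycle G fun x => P.rank (k x)) (hk : ∀ x, T.W x ⊆ P.dom (k x))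
    (hu : ∀ {x y t}, t ∈ T.W x → t ∈ T.W y → ∀ e : EuclideanSpace ℂ (Fin (P.rank (k y))) ≃ₗᵢ[ℂ]
      EuclideanSpace ℂ (Fin (P.rank (k x))), (∀ v, T.u x y t v = e v) →
        ∀ p, P.chart (k y) t p = P.chart (k x) t (projMap e p)) :
    (T.toGerbeModule fun x => P.rank_pos (k x)).DescendsTo P := by
  let χ : ∀ x, ℙ ℂ (EuclideanSpace ℂ (Fin (P.rank (k x)))) ≃ P.Fiber x := fun x =>
    Equiv.ofBijective _ (P.bijective_chart (k x) x (hk x (T.mem_W x)))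
  refine GerbeModule.descendsTo_iff.2 ⟨fun {x y} h => (projEquiv (T.τ h)).trans (χ x), ?_, ?_⟩
  · rintro _ y₀ rfl
    -- The frame around `y₀` lifts the chart `k (π y₀)`, while descent is tested in the chart around
    -- `π y₀`; `w` lifts the change between them.
    obtain ⟨w, hw, hwe⟩ := P.transition (π y₀) (k (π y₀)) (π y₀)
      ⟨P.mem_dom _, hk _ (T.mem_W _)⟩
    have hπ := G.locallySplit.smoothMapNear y₀
    refine ⟨fun i y => T.vec rfl (T.frameUnit y₀ y) (w (π y) (EuclideanSpace.single i 1)),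
      fun i => ?_, ?_⟩
    · refine (HermitianBundle.SmoothSectionNear.sum (V := T.bundle) Finset.univ fun j _ =>
        (HermitianBundle.smoothSectionNear_frame (V := T.bundle) (SmoothMapNear.id_id y₀)
          (T.mem_frameDom y₀) j).smul (SmoothNear.comp (hw i j) hπ)).congr ?_
      filter_upwards [T.bundle.isOpen_dom y₀ |>.mem_nhds (T.mem_frameDom y₀)] with y hy
      obtain ⟨e, he⟩ := T.exists_frame_iso hy
      have h1 := isometryEquiv_eq_sum e (w (π y) (EuclideanSpace.single i 1))
      simp only [he] at h1
      exact h1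
    · filter_upwards [hπ.1.eventually hwe,
        (T.bundle.isOpen_dom y₀).mem_nhds (T.mem_frameDom y₀)] with y hy hd
      obtain ⟨e, he⟩ := T.exists_frame_iso hd
      refine ⟨(w (π y)).trans e, fun i => he _, ?_⟩
      rintro _ rfl p
      have hm := T.mem_W (π y)
      obtain ⟨e', he'⟩ := T.exists_iso hm hd.1
      have h1 : projMap e (projMap (w (π y)) p) = projMap e' (projMap (w (π y)) p) :=
        projMap_smul_eq (fun v => by rw [he, ← he']; rfl) _
      rw [hy, hu hm hd.1 e' he', ← h1, ← projMap_trans]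
      exact congrArg (χ (π y)) (projMap_refl _)
  · intro x y₁ y₂ h₁ h₂ p
    obtain ⟨a, ha⟩ := G.exists_norm_eq_one (ypair (h₁.trans h₂.symm))
    rw [GerbeModule.tr_eq _ a ha]
    have key : ∀ φ : T.Fib y₂ ≃ₗᵢ[ℂ] T.Fib y₁,
        (∀ v, T.τ h₁ (φ v) = ⟪T.ε h₁, prod a (T.ε h₂)⟫_ℂ • T.τ h₂ v) →
          ∀ p, projMap (T.τ h₁) (projMap φ p) = projMap (T.τ h₂) p := fun φ hφ p => by
      rw [← projMap_trans]
      exact projMap_smul_eq hφ p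
    refine congrArg (χ x) (key ((T.toGerbeModule fun x => P.rank_pos (k x)).actIso a ha) (fun v => ?_) p)
    refine (congrArg (T.τ h₁) ?_).trans (T.τ_act h₁ h₂ a v)
    exact (T.toGerbeModule fun x => P.rank_pos (k x)).actIso_apply a ha v

end TwistedCocycle

/-- A projective bundle with the same Dixmier–Douady class as the bundle gerbe is the descent of a
bundle gerbe module. -/
theorem exists_module_descendsTo [FiniteDimensional ℝ EM] [IsManifold IM ∞ M] [T2Space M]
    [SigmaCompactSpace M] {G : BundleGerbe IM IY π} {P : ProjectiveBundle IM M} {c : CechH3 M}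
    (hG : G.Represents c) (hP : P.Represents c) : ∃ A : GerbeModule G, A.DescendsTo P := by
  obtain ⟨U, s, hs, σ, g, hU, hsU, hσ, hσs, hg, hc⟩ := hG
  obtain ⟨U', k, u, g', hU', hUk, hus, hue, hug, hc'⟩ := hP
  obtain ⟨W, l, H⟩ := exists_isCohomologousVia hU hU' hc hc'
  let T : TwistedCocycle G fun x => P.rank (k x) :=
    { W := W
      s := s
      π_s := hs
      σ := σ
      -- Rescaling by `l` replaces the multiplier `g'` of `P` by the multiplier `g` of the gerbe,
      -- and leaves the projective maps unchanged.
      u := fun x y t => l x y t • u x y t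
      g := fun x y z => g ![x, y, z]
      isPointedCover := H.isPointedCover
      contMDiffOn_s := fun x => (hsU x).mono (H.subset_left x)
      norm_σ := fun hx hy => hσ _ _ _ ⟨H.subset_left _ hx, H.subset_left _ hy⟩
      smooth_σ := fun hx hy => hσs _ _ _ ⟨H.subset_left _ hx, H.subset_left _ hy⟩
      prod_σ := fun {x y z t} hx hy hz => hg ![x, y, z] t
        (overlap_vec3 (H.subset_left _ hx) (H.subset_left _ hy) (H.subset_left _ hz))
      smooth_u := fun {x y t} hx hy i j => (H.smooth x y t ⟨hx, hy⟩).mul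
        (hus x y t ⟨H.subset_right _ hx, H.subset_right _ hy⟩ i j)
      exists_iso := fun {x y t} hx hy => by
        obtain ⟨e, he, -⟩ := hue x y t ⟨H.subset_right _ hx, H.subset_right _ hy⟩
        refine ⟨e.trans (tensorLineIso (Module.finrank_self ℂ) (TensorProduct.lidIsometry ℂ _)
          (H.norm_eq x y t ⟨hx, hy⟩)), fun v => ?_⟩
        rw [LinearIsometryEquiv.trans_apply, tensorLineIso_apply, LinearMap.smul_apply, he]
        simp
      u_comp := fun {x y z t} hx hy hz v => by
        have h1 : u x y t (u y z t v) = g' ![x, y, z] t • u x z t v := hug ![x, y, z] t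
          (overlap_vec3 (H.subset_right _ hx) (H.subset_right _ hy) (H.subset_right _ hz)) v
        have h2 : g ![x, y, z] t * l x z t = l x y t * l y z t * g' ![x, y, z] t :=
          H.eq ![x, y, z] t (overlap_vec3 hx hy hz)
        simp only [LinearMap.smul_apply, map_smul]
        rw [h1, smul_smul, smul_smul, smul_smul, h2, mul_comm (l y z t)] }
  refine ⟨_, T.toGerbeModule_descendsTo (fun x => (H.subset_right x).trans (hUk x)) ?_⟩
  intro x y t hx hy e he p
  obtain ⟨e', he', hp⟩ := hue x y t ⟨H.subset_right _ hx, H.subset_right _ hy⟩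
  rw [hp, projMap_smul_eq (u := e') (u' := e) (c := l x y t)]
  intro v
  rw [← he, ← he']
  rfl

end BundleGerbe

end Twisted

/-! ### The bijection between modules up to line bundles and projective bundles -/

theorem mainTheorem7
    {EM : Type*} [NormedAddCommGroup EM] [NormedSpace ℝ EM] [FiniteDimensional ℝ EM]
    {HM : Type*} [TopologicalSpace HM] (IM : ModelWithCorners ℝ EM HM)
    {M : Type*} [TopologicalSpace M] [ChartedSpace HM M] [IsManifold IM ∞ M]
    [T2Space M] [SigmaCompactSpace M]
    {EY : Type*} [NormedAddCommGroup EY] [NormedSpace ℝ EY]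
    {HY : Type*} [TopologicalSpace HY] (IY : ModelWithCorners ℝ EY HY)
    {Y : Type*} [TopologicalSpace Y] [ChartedSpace HY Y] [IsManifold IY ∞ Y]
    (π : Y → M) (G : BundleGerbe IM IY π) :
    ∃ d : CechH3 M, G.HasDDClass d ∧
      ∃ Φ : G.ModModLin → Pro IM d, Function.Bijective Φ ∧
        ∀ (A : G.GerbeModule) (P : ProjectiveBundle IM M),
          (Φ A.toModModLin : Quotient (ProjectiveBundle.isoSetoid IM M)) = Quotient.mk _ P ↔
            A.DescendsTo P := by
  obtain ⟨d, hd⟩ := G.exists_hasDDClass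
  choose D hD using fun A : G.GerbeModule => A.exists_descendsTo
  have hDd : ∀ A, (D A).HasDDClass d := by
    intro A
    obtain ⟨θ, hθ⟩ := BundleGerbe.GerbeModule.descendsTo_iff.1 (hD A)
    have h1 := hθ.represents ((hd d).2 rfl)
    exact fun c => ⟨fun h => h.unique h1, fun h => h ▸ h1⟩
  -- Isomorphic or twisted modules descend to the same projective bundles, so uniqueness of descent
  -- makes the chosen `D` well defined on classes.
  let Φ : G.ModModLin → Pro IM d := Quot.lift
    (Quotient.lift (fun A => ⟨Quotient.mk _ (D A), D A, hDd A, rfl⟩) fun A B h =>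
      Subtype.ext (Quotient.sound ((hD A).of_module_iso h |>.iso (hD B))))
    (by
      rintro _ _ ⟨K, A, B, hK, rfl, rfl, h⟩
      exact Subtype.ext (Quotient.sound ((hD A).iso ((hD B).of_isTwist hK h))))
  have hΦ : ∀ (A : G.GerbeModule) (P : ProjectiveBundle IM M),
      (Φ A.toModModLin : Quotient (ProjectiveBundle.isoSetoid IM M)) = Quotient.mk _ P ↔
        A.DescendsTo P := fun A P =>
    ⟨fun h => (hD A).of_iso (Quotient.exact h), fun h => Quotient.sound ((hD A).iso h)⟩
  refine ⟨d, hd, Φ, ⟨?_, ?_⟩, hΦ⟩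
  -- Equal images mean that `A` and `B` both descend to `D B`; the line bundle of lifts then relates
  -- them.
  · rintro ⟨⟨A⟩⟩ ⟨⟨B⟩⟩ h
    have hA : A.DescendsTo (D B) := (hΦ A (D B)).1 (congrArg Subtype.val h)
    obtain ⟨K, hK, hAB⟩ := BundleGerbe.GerbeModule.exists_isTwist hA (hD B)
    exact Quot.sound ⟨K, A, B, hK, rfl, rfl, hAB⟩
  · rintro ⟨_, P, hP, rfl⟩
    obtain ⟨A, hA⟩ := BundleGerbe.exists_module_descendsTo ((hd d).2 rfl) ((hP d).2 rfl)
    exact ⟨A.toModModLin, Subtype.ext ((hΦ A P).2 hA)⟩
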